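/- Let $n\ge 0$ be an integer and let $V:(0,\infty)\to\mathbb C^{n\times n}$ be $C^\infty$ with $V(x)=V(x)^\dagger$, $\int_0^\infty(1+x)\|V(x)\|\,dx<\infty$, and, for some $\rho\in(1,2]$ and constants $C_j$, $\|V^{(j)}(x)\|\le C_j(1+x)^{-\rho-j}$ for all $x>0$ and $j=0,1,2,\dots$. Let $A,B\in\mathbb C^{n\times n}$ satisfy $-B^\dagger A+A^\dagger B=0$ and $A^\dagger A+B^\dagger B>0$. **The function $h$.** For $k\neq0$, $\operatorname{Im}k\ge0$, let $f(k,x)$ be the Jost solution, i.e. the $n\times n$ matrix solution of $-f''+Vf=k^2f$ on $(0,\infty)$, $C^1$ up to $x=0$, with $f(k,x)=e^{ikx}[I+o(1/x)]$ and $f'(k,x)=ik\,e^{ikx}[I+o(1/x)]$ as $x\to+\infty$. Let $$J(k)=f(-k^*,0)^\dagger B-f'(-k^*,0)^\dagger A$$ be the Jost matrix ($k^*$ is the complex conjugate of $k$). Let $r=\operatorname{rank}A$, which is the total number $n_M+n_N$ of mixed and Neumann conditions when the boundary condition $-B^\dagger\psi(0)+A^\dagger\psi'(0)=0$ is brought to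 diagonal form. Let $c_2=\lim\det J(k)/k^{r}$ as $|k|\to\infty$, $\operatorname{Im}k\ge0$, and $h(k)=\det J(k)/(c_2k^{r})$. For real $k\ne0$ let $\ln h(k)$ be the branch that is continuous on $\mathbb R\setminus\{0\}$ and tends to $0$ as $k\to\pm\infty$, and put $$\ln_e h(k)=\tfrac12(\ln h(k)+\ln h(-k)),\qquad \ln_o h(k)=\tfrac12(\ln h(k)-\ln h(-k)).$$ **The coefficients $e_l$.** On $[0,\infty)$ let $b_0=I$ and $b_{l+1}(x)=-b_l'(x)-\int_x^\infty V(y)b_l(y)\,dy$. Let $c_{-1}=-\frac12A$, let $c_l=b_l(0)^\dagger B-\big(\frac12b_{l+1}(0)^\dagger+b_l'(0)^\dagger\big)A$ for $l\ge0$, and $$d_l=\sum_{\sigma}\operatorname{sign}\sigma\sum_{l_i\ge-1,\;l_1+\dots+l_n=l}(c_{l_1})_{1,\sigma_1}\cdots(c_{l_n})_{n,\sigma_n},$$ where $\sigma$ runs over the permutations of $1,\dots,n$. For $l\ge1$ define recursively $$e_l=\frac{(2i)^{r}}{c_2}\Big(d_{l-r}-\frac1l\sum_{j=1}^{l-1}j\,d_{l-r-j}\,e_j\Big).$$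 **Claim.** For $0<\operatorname{Re}z<\frac12$ the integrals $$F(z)=\int_0^\infty\ln_eh(k)\,k^{2z-1}\,dk,\qquad G(z)=-i\int_0^\infty\ln_oh(k)\,k^{2z-1}\,dk$$ converge absolutely, and $F$, $G$ extend to meromorphic functions on $\{\operatorname{Re}z>0\}$, again denoted by $F$, $G$, such that the following holds. All the integrals below converge absolutely. A simple pole with residue $c$ at $a$ means that the principal part at $a$ is $c/(z-a)$; if $c=0$, the singularity is removable. 1. $F$ is analytic on $\operatorname{Re}z>0$ away from the points $z=j$, $j=1,2,\dots$, where it has simple poles with residue $(-1)^{j+1}2^{-2j-1}e_{2j}$. The integral formula for $F$ is valid for $0<\operatorname{Re}z<1$, and for $j=1,2,\dots$ and $j<\operatorname{Re}z<j+1$ $$F(z)=\int_0^\infty\Big(\ln_eh(k)-\sum_{l=1}^{j}(-1)^l\frac{e_{2l}}{(2k)^{2l}}\Big)k^{2z-1}\,dk.$$ 2. $G$ is analytic on $\operatorname{Re}z>0$ away from the points $z=j+\frac12$, $j=0,1,2,\dots$, where it has simple poles with residue $(-1)^{j}2^{-2j-2}e_{2j+1}$. For $j=1,2,\dots$ and $j-\frac12<\operatorname{Re}z<j+\frac12$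 $$G(z)=\int_0^\infty\Big(-i\ln_oh(k)-\sum_{l=0}^{j-1}(-1)^{l+1}\frac{e_{2l+1}}{(2k)^{2l+1}}\Big)k^{2z-1}\,dk.$$ -/

import Mathlib

open MeasureTheory Filter Set Topology Asymptotics
open scoped Matrix ContDiff ComplexOrder Matrix.Norms.L2Operator

-- The norm on matrices in this file is the operator norm on `ℂⁿ` with its Euclidean norm.

namespace HalfLine

noncomputable section

variable {n : ℕ}

/-- Square complex matrices of size `n`. -/
abbrev Mat (n : ℕ) := Matrix (Fin n) (Fin n) ℂ

/-- The bounds `‖V⁽ʲ⁾(x)‖ ≤ C_j (1 + x)^(-ρ - j)` on `(0, ∞)` for all `j`, with one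
`ρ ∈ (1, 2]`. -/
def SymbolDecay (V : ℝ → Mat n) : Prop :=
  ∃ ρ : ℝ, 1 < ρ ∧ ρ ≤ 2 ∧ ∀ j : ℕ, ∃ C : ℝ, ∀ x : ℝ, 0 < x →
    ‖iteratedDeriv j V x‖ ≤ C * (1 + x) ^ (-ρ - (j : ℝ))

/-- `f` is the Jost solution of `-f'' + V f = k² f` on `(0, ∞)`, for `k ≠ 0` with `Im k ≥ 0`.
It is taken as a `C¹` function on `[0, ∞)`, so that `f(0)` and `f'(0)` have a meaning; only its
restriction to `[0, ∞)` is determined. -/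
structure IsJostSolution (V : ℝ → Mat n) (k : ℂ) (f : ℝ → Mat n) : Prop where
  contDiffOn : ContDiffOn ℝ 1 f (Ici 0)
  equation : ∀ x : ℝ, 0 < x → HasDerivAt (deriv f) (V x * f x - k ^ 2 • f x) x
  asymptotics : (fun x : ℝ => Complex.exp (-(Complex.I * k * x)) • f x - 1)
    =o[atTop] fun x : ℝ => 1 / x
  asymptotics_deriv :
    (fun x : ℝ => Complex.exp (-(Complex.I * k * x)) • deriv f x - (Complex.I * k) • (1 : Mat n))
      =o[atTop] fun x : ℝ => 1 / x

open Classical in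
/-- The Jost solution `f(k, x)`. -/
def jost (V : ℝ → Mat n) (k : ℂ) : ℝ → Mat n :=
  if h : ∃ f, IsJostSolution V k f then h.choose else 0

/-- The Jost matrix `J(k) = f(-k*, 0)† B - f'(-k*, 0)† A`, which is the value at `x = 0` of the
Wronskian of `f(-k*, x)†` and the regular solution `φ(k, x)`, `φ(k, 0) = A`, `φ'(k, 0) = B`. -/
def jostMatrix (V : ℝ → Mat n) (A B : Mat n) (k : ℂ) : Mat n :=
  (jost V (-(starRingEnd ℂ k)) 0)ᴴ * B
    - (derivWithin (jost V (-(starRingEnd ℂ k))) (Ici 0) 0)ᴴ * A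

/-- The number of mixed and Neumann conditions (together) in the boundary condition given by
`(A, B)`: the rank of `A`. See `nonDirichlet_eq_card`. -/
def nonDirichlet (A : Mat n) : ℕ := A.rank

/-- If the boundary matrices are brought to the diagonal form `Ã = -diag (sin θ_j)`,
`B̃ = diag (cos θ_j)` with `θ_j ∈ (0, π]` by `A = M Ã T₂ M† T₁`, `B = M B̃ T₂ M† T₁`
(`M` unitary, `T₁`, `T₂` invertible), then `nonDirichlet A` is the number of mixed conditions
(`θ_j ≠ π/2, π`) plus the number of Neumann conditions (`θ_j = π/2`). -/
theorem nonDirichlet_eq_card (A : Mat n) (θ : Fin n → ℝ) (M T₁ T₂ : Mat n)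
    (hθ : ∀ j, θ j ∈ Ioc 0 Real.pi) (hM : M ∈ Matrix.unitaryGroup (Fin n) ℂ)
    (hT₁ : IsUnit T₁) (hT₂ : IsUnit T₂)
    (hA : A = M * (-Matrix.diagonal fun j => ((Real.sin (θ j) : ℝ) : ℂ)) * T₂ * Mᴴ * T₁) :
    nonDirichlet A
      = (Finset.univ.filter fun j => θ j ≠ Real.pi / 2 ∧ θ j ≠ Real.pi).card
        + (Finset.univ.filter fun j => θ j = Real.pi / 2).card := by
  have hMu : IsUnit M.det := by
    rw [← Matrix.isUnit_iff_isUnit_det]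
    exact ⟨⟨M, star M, (Matrix.mem_unitaryGroup_iff).1 hM, (Matrix.mem_unitaryGroup_iff').1 hM⟩,
      rfl⟩
  have hMu' : IsUnit (Mᴴ).det := by
    rw [Matrix.det_conjTranspose]; exact hMu.star
  rw [nonDirichlet, hA,
    Matrix.rank_mul_eq_left_of_isUnit_det _ _ ((Matrix.isUnit_iff_isUnit_det _).1 hT₁),
    Matrix.rank_mul_eq_left_of_isUnit_det _ _ hMu',
    Matrix.rank_mul_eq_left_of_isUnit_det _ _ ((Matrix.isUnit_iff_isUnit_det _).1 hT₂),
    Matrix.rank_mul_eq_right_of_isUnit_det _ _ hMu, Matrix.diagonal_neg, Matrix.rank_diagonal,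
    Fintype.card_subtype, ← Finset.card_union_of_disjoint]
  · congr 1
    ext j
    have h0 := (hθ j).1
    have hp := (hθ j).2
    simp only [Finset.mem_filter, Finset.mem_univ, true_and, Finset.mem_union, ne_eq,
      neg_eq_zero, Complex.ofReal_eq_zero]
    constructor
    · intro h
      by_cases h2 : θ j = Real.pi / 2
      · exact Or.inr h2
      · exact Or.inl ⟨h2, fun h3 => h (by rw [h3, Real.sin_pi])⟩
    · rintro (h | h)
      · exact (Real.sin_pos_of_pos_of_lt_pi h0 (lt_of_le_of_ne hp h.2)).ne'
      · rw [h, Real.sin_pi_div_two]; exact one_ne_zero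
  · rw [Finset.disjoint_left]
    intro j hj hj'
    simp only [Finset.mem_filter, Finset.mem_univ, true_and] at hj hj'
    exact hj.1 hj'

/-- The leading constant `c₂` in `det J(k) = c₂ k^r (1 + O(1/k))`, `k → ∞` in the closed upper
half-plane, where `r = nonDirichlet A`. -/
def leadingConst (V : ℝ → Mat n) (A B : Mat n) : ℂ :=
  limUnder (Bornology.cobounded ℂ ⊓ 𝓟 {k : ℂ | 0 ≤ k.im})
    fun k => (jostMatrix V A B k).det / k ^ nonDirichlet A

/-- `h(k) = det J(k) / (c₂ k^r)`. -/
def normalizedDet (V : ℝ → Mat n) (A B : Mat n) (k : ℂ) : ℂ :=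
  (jostMatrix V A B k).det / (leadingConst V A B * k ^ nonDirichlet A)

/-- `L` is the branch of `ln h` on `ℝ \ {0}` that is continuous and vanishes at `±∞`. -/
structure IsLogBranch (h : ℂ → ℂ) (L : ℝ → ℂ) : Prop where
  continuousOn : ContinuousOn L {0}ᶜ
  exp_eq : ∀ k : ℝ, k ≠ 0 → Complex.exp (L k) = h k
  tendsto_atTop : Tendsto L atTop (𝓝 0)
  tendsto_atBot : Tendsto L atBot (𝓝 0)

open Classical in
/-- `ln h(k)` for real `k ≠ 0`. -/
def lnDet (V : ℝ → Mat n) (A B : Mat n) : ℝ → ℂ :=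
  if h : ∃ L, IsLogBranch (normalizedDet V A B) L then h.choose else 0

/-- The even part `ln_e h`. -/
def lnEven (V : ℝ → Mat n) (A B : Mat n) (k : ℝ) : ℂ :=
  (1 / 2) * (lnDet V A B k + lnDet V A B (-k))

/-- The odd part `ln_o h`. -/
def lnOdd (V : ℝ → Mat n) (A B : Mat n) (k : ℝ) : ℂ :=
  (1 / 2) * (lnDet V A B k - lnDet V A B (-k))

/-- The coefficients `b_l` on `[0, ∞)`: `b_0 = 1`, `b_{l+1} = -b_l' - ∫_x^∞ V b_l`. -/
def bCoeff (V : ℝ → Mat n) : ℕ → ℝ → Mat n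
  | 0 => fun _ => 1
  | l + 1 => fun x =>
      -derivWithin (bCoeff V l) (Ici 0) x - ∫ y in Ioi x, V y * bCoeff V l y

/-- The coefficients `c_l`, `l ≥ -1`, of the expansion of `J(k)` in powers of `1/(2ik)`. -/
def cCoeff (V : ℝ → Mat n) (A B : Mat n) : ℤ → Mat n
  | Int.ofNat l => (bCoeff V l 0)ᴴ * B
      - ((1 / 2 : ℂ) • (bCoeff V (l + 1) 0)ᴴ + (derivWithin (bCoeff V l) (Ici 0) 0)ᴴ) * A
  | Int.negSucc 0 => -((1 / 2 : ℂ) • A)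
  | Int.negSucc (_ + 1) => 0

/-- The coefficients `d_l` of the expansion of `det J(k)` in powers of `1/(2ik)`. The upper bound
`l + n` on the indices is no restriction: they are at least `-1` and add up to `l`. -/
def dCoeff (V : ℝ → Mat n) (A B : Mat n) (l : ℤ) : ℂ :=
  ∑ σ : Equiv.Perm (Fin n), ((Equiv.Perm.sign σ : ℤ) : ℂ) *
    ∑ p ∈ (Fintype.piFinset fun _ : Fin n => Finset.Icc (-1 : ℤ) (l + n)).filter
        (fun p => ∑ i, p i = l),
      ∏ i, cCoeff V A B (p i) i (σ i)

/-- The coefficients `e_l`, `l ≥ 1`, of the expansion of `ln h(k)` in powers of `1/(2ik)`: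
`e_l = ((2i)^r / c₂) (d_{l-r} - (1/l) ∑_{j=1}^{l-1} j d_{l-r-j} e_j)`. -/
def eCoeff (V : ℝ → Mat n) (A B : Mat n) : ℕ → ℂ
  | 0 => 0
  | l + 1 =>
      (2 * Complex.I) ^ nonDirichlet A / leadingConst V A B *
        (dCoeff V A B ((l : ℤ) + 1 - (nonDirichlet A : ℤ))
          - 1 / ((l : ℂ) + 1) * ∑ j : Fin l, (((j : ℕ) : ℂ) + 1) *
              dCoeff V A B ((l : ℤ) + 1 - (nonDirichlet A : ℤ) - (((j : ℕ) : ℤ) + 1)) *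
                eCoeff V A B ((j : ℕ) + 1))
  termination_by l => l
  decreasing_by have := j.2; omega

/-- The integrand `ln_e h(k) k^(2z-1)` with the terms `l = 1, …, j` of the high-energy expansion
of `ln_e h` subtracted. -/
def evenIntegrand (V : ℝ → Mat n) (A B : Mat n) (j : ℕ) (z : ℂ) (k : ℝ) : ℂ :=
  (lnEven V A B k
      - ∑ l ∈ Finset.Icc 1 j, (-1) ^ l * eCoeff V A B (2 * l) * (1 / (2 * (k : ℂ)) ^ (2 * l)))
    * (k : ℂ) ^ (2 * z - 1)

/-- The integrand `-i ln_o h(k) k^(2z-1)` with the terms `l = 0, …, j - 1` of the high-energy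
expansion of `-i ln_o h` subtracted. -/
def oddIntegrand (V : ℝ → Mat n) (A B : Mat n) (j : ℕ) (z : ℂ) (k : ℝ) : ℂ :=
  (-Complex.I * lnOdd V A B k
      - ∑ l ∈ Finset.range j,
          (-1) ^ (l + 1) * eCoeff V A B (2 * l + 1) * (1 / (2 * (k : ℂ)) ^ (2 * l + 1)))
    * (k : ℂ) ^ (2 * z - 1)

/-- `F(z) = ∫_0^∞ ln_e h(k) k^(2z-1) dk`. -/
def evenMellin (V : ℝ → Mat n) (A B : Mat n) (z : ℂ) : ℂ :=
  ∫ k in Ioi (0 : ℝ), lnEven V A B k * (k : ℂ) ^ (2 * z - 1)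

/-- `G(z) = -i ∫_0^∞ ln_o h(k) k^(2z-1) dk`. -/
def oddMellin (V : ℝ → Mat n) (A B : Mat n) (z : ℂ) : ℂ :=
  -Complex.I * ∫ k in Ioi (0 : ℝ), lnOdd V A B k * (k : ℂ) ^ (2 * z - 1)

/-- The principal part of `f` at `a` is `c / (z - a)`: a simple pole with residue `c` when
`c ≠ 0`, a removable singularity when `c = 0`. -/
def HasSimplePoleWithResidue (f : ℂ → ℂ) (a c : ℂ) : Prop :=
  ∃ g : ℂ → ℂ, AnalyticAt ℂ g a ∧ ∀ᶠ z in 𝓝[≠] a, f z = c / (z - a) + g z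

end

end HalfLine

/-!
The idea is that `F` and `G` are Mellin transforms, in the variable `s = 2z`, of the even and the odd part
of `ln h`. A Mellin transform continues meromorphically as far as the function has a power expansion
at infinity: each power `x ^ (-a)` with coefficient `β` contributes the simple pole `-β / (s - a)`, and
beyond that pole the continuation is the transform of the function minus this power
(`HasPowerExpansion.exists_continuation`). Two facts about `ln h` on the real line are thus needed:
it grows slower than every negative power of `k` at `k = 0`, and `ln h(k) ~ ∑ e_l / (2ik)^l` as
`k → ±∞`. They are collected in `LogDetSpec`.

*High energy.* `m(k, x) = e^{-ikx} f(k, x)` is the bounded solution of a Volterra equation, whose kernel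
is bounded by `t - x`, uniformly for `Im k ≥ 0`. The coefficients `b_l` are symbols
on the half-line, so `m - ∑_{l ≤ N} b_l / (2ik)^l` solves the same equation with a source of size
`k^{-N}`, and the Volterra equation bounds it (`FiniteMoment.exists_remainder_le`). This gives the
expansion of `J(k)`, then those of `det J(k)` and of `h(k)`; the recursion of the `e_l` is
`l a_l = ∑ j e_j a_{l-j}`, which characterizes the coefficients of a logarithm
(`sub_sum_isBigO_of_exp_eq`).

*Order of the determinant.* That `det J(k) / k^r` has a nonzero limit at infinity, and that
`det J(k) / k^m` has a nonzero limit at `k = 0` for some `m`, are two cases of one lemma on determinants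
near a singular matrix (`exists_tendsto_det_div_pow`). At infinity the limit of `J(k) / (-ik)` is `A`, and
`J(k) v → B v` on `ker A`. At `k = 0` the matrix `J(k)` acts on `ker J(0)` as the Wronskian of `f(-k, ·)`
and `f(0, ·)`, which is `-ik (1 + o(1))` (`FiniteMoment.wronskian_zero_right_isLittleO`). In both cases
the orthogonality that the lemma asks for is the selfadjointness of the boundary condition.

*The logarithm.* `J(k)` is invertible for real `k ≠ 0`, because a Wronskian of a solution satisfying the
boundary condition would otherwise be both `0` and `2ik |w|²`. So `h` has a continuous logarithm on each
half-line, and its growth at `0` is that of `log |k|`.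
-/

namespace HalfLine

/-! ### Mellin transforms of functions with a power expansion at infinity -/

section Mellin

open Complex

variable {ψ : ℝ → ℂ} {β : ℕ → ℂ} {lam : ℕ → ℝ}

theorem hasMellin_cpow_Ioi_one {a : ℝ} {s : ℂ} (hs : s.re < a) :
    HasMellin ((Ioi (1 : ℝ)).indicator fun x : ℝ => (x : ℂ) ^ (-(a : ℂ))) s (-(1 / (s - a))) := by
  have hlt : (s - a - 1).re < -1 := by simp; linarith
  have h0 : ∀ x : ℝ, (x : ℂ) ^ (s - 1) • (Ioi (1 : ℝ)).indicator (fun x : ℝ => (x : ℂ) ^ (-(a : ℂ))) x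
      = (Ioi (1 : ℝ)).indicator (fun x : ℝ => (x : ℂ) ^ (s - a - 1)) x := by
    intro x
    by_cases hx : x ∈ Ioi (1 : ℝ)
    · have hx0 : (x : ℂ) ≠ 0 := by
        have : (0 : ℝ) < x := lt_trans one_pos hx
        exact_mod_cast this.ne'
      rw [indicator_of_mem hx, indicator_of_mem hx, smul_eq_mul, ← Complex.cpow_add _ _ hx0]
      congr 1; ring
    · rw [indicator_of_notMem hx, indicator_of_notMem hx, smul_zero]
  have hsub : Ioi (1 : ℝ) ∩ Ioi 0 = Ioi 1 := by
    ext x; simp only [mem_inter_iff, mem_Ioi]; constructor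
    · exact fun h => h.1
    · exact fun h => ⟨h, lt_trans one_pos h⟩
  constructor
  · simp only [MellinConvergent, h0]
    rw [IntegrableOn, integrable_indicator_iff measurableSet_Ioi, IntegrableOn,
      Measure.restrict_restrict measurableSet_Ioi, hsub]
    exact integrableOn_Ioi_cpow_of_lt hlt one_pos
  · simp only [mellin, h0]
    rw [integral_indicator measurableSet_Ioi, Measure.restrict_restrict measurableSet_Ioi, hsub,
      integral_Ioi_cpow_of_lt hlt one_pos]
    have : s - a ≠ 0 := by
      intro h; have := congrArg Complex.re h; simp at this; linarith
    simp
    rw [neg_div, inv_eq_one_div]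

/-- The first `N` terms of the expansion at infinity. -/
noncomputable def partialExpansion (β : ℕ → ℂ) (lam : ℕ → ℝ) (N : ℕ) (x : ℝ) : ℂ :=
  ∑ l ∈ Finset.range N, β l * (x : ℂ) ^ (-(lam l : ℂ))

/-- `ψ` minus the first `N` terms of its expansion at infinity, the latter only on `(1, ∞)`. -/
noncomputable def cutRemainder (ψ : ℝ → ℂ) (β : ℕ → ℂ) (lam : ℕ → ℝ) (N : ℕ) (x : ℝ) : ℂ :=
  ψ x - ∑ l ∈ Finset.range N, β l • (Ioi (1 : ℝ)).indicator (fun x : ℝ => (x : ℂ) ^ (-(lam l : ℂ))) x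

/-- The continuation of the Mellin transform of `ψ` to the strip `0 < Re s < lam N`. -/
noncomputable def mellinStrip (ψ : ℝ → ℂ) (β : ℕ → ℂ) (lam : ℕ → ℝ) (N : ℕ) (s : ℂ) : ℂ :=
  mellin (cutRemainder ψ β lam N) s - ∑ l ∈ Finset.range N, β l / (s - lam l)

/-- The hypotheses under which the Mellin transform is continued: `ψ` grows at `0` slower than
every negative power and has an expansion in the powers `x ^ (-lam l)` at infinity. -/
structure HasPowerExpansion (ψ : ℝ → ℂ) (β : ℕ → ℂ) (lam : ℕ → ℝ) : Prop where
  pos : ∀ l, 0 < lam l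
  strictMono : StrictMono lam
  locallyIntegrableOn : LocallyIntegrableOn ψ (Ioi 0)
  isBigO_zero : ∀ ε : ℝ, 0 < ε → ψ =O[𝓝[>] 0] fun x : ℝ => x ^ (-ε)
  isBigO_atTop : ∀ N, (fun x => ψ x - partialExpansion β lam N x) =O[atTop] fun x : ℝ => x ^ (-lam N)

theorem partialExpansion_eq_indicator {N : ℕ} {x : ℝ} (hx : 1 < x) :
    ∑ l ∈ Finset.range N, β l • (Ioi (1 : ℝ)).indicator (fun x : ℝ => (x : ℂ) ^ (-(lam l : ℂ))) x
      = partialExpansion β lam N x := by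
  refine Finset.sum_congr rfl fun l _ => ?_
  rw [indicator_of_mem (show x ∈ Ioi (1 : ℝ) from hx), smul_eq_mul]

namespace HasPowerExpansion

variable (h : HasPowerExpansion ψ β lam)
include h

theorem cutRemainder_isBigO_atTop (N : ℕ) :
    cutRemainder ψ β lam N =O[atTop] fun x : ℝ => x ^ (-lam N) := by
  refine (h.isBigO_atTop N).congr' ?_ EventuallyEq.rfl
  filter_upwards [eventually_gt_atTop 1] with x hx
  rw [cutRemainder, partialExpansion_eq_indicator hx]

theorem cutRemainder_isBigO_zero (N : ℕ) {ε : ℝ} (hε : 0 < ε) :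
    cutRemainder ψ β lam N =O[𝓝[>] 0] fun x : ℝ => x ^ (-ε) := by
  refine (h.isBigO_zero ε hε).congr' ?_ EventuallyEq.rfl
  filter_upwards [Ioo_mem_nhdsGT one_pos] with x hx
  rw [cutRemainder, Finset.sum_eq_zero, sub_zero]
  intro l _
  rw [indicator_of_notMem (by simpa using hx.2.le), smul_zero]

theorem cutRemainder_locallyIntegrableOn (N : ℕ) :
    LocallyIntegrableOn (cutRemainder ψ β lam N) (Ioi 0) := by
  refine h.locallyIntegrableOn.sub ?_
  have : ∀ s : Finset ℕ, LocallyIntegrableOn (fun x => ∑ l ∈ s, β l •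
      (Ioi (1 : ℝ)).indicator (fun x : ℝ => (x : ℂ) ^ (-(lam l : ℂ))) x) (Ioi 0) := by
    intro s
    induction s using Finset.induction_on with
    | empty => simpa using (locallyIntegrable_zero).locallyIntegrableOn _
    | insert a s ha ih =>
      simp only [Finset.sum_insert ha]
      refine LocallyIntegrableOn.add ?_ ih
      refine LocallyIntegrableOn.smul ?_ (β a)
      have hc : ContinuousOn (fun x : ℝ => (x : ℂ) ^ (-(lam a : ℂ))) (Ioi 0) := by
        intro x hx
        exact (Complex.continuousAt_ofReal_cpow_const x _ (Or.inr (ne_of_gt hx))).continuousWithinAt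
      have hl := hc.locallyIntegrableOn (μ := volume) measurableSet_Ioi
      intro x hx
      obtain ⟨u, hu, hi⟩ := hl x hx
      exact ⟨u, hu, hi.indicator measurableSet_Ioi⟩
  exact this _

theorem cutRemainder_mellinConvergent (N : ℕ) {s : ℂ} (h0 : 0 < s.re) (h1 : s.re < lam N) :
    MellinConvergent (cutRemainder ψ β lam N) s :=
  mellinConvergent_of_isBigO_rpow (h.cutRemainder_locallyIntegrableOn N)
    (h.cutRemainder_isBigO_atTop N) h1 (h.cutRemainder_isBigO_zero N (half_pos h0)) (by linarith)

theorem differentiableAt_mellin_cutRemainder (N : ℕ) {s : ℂ} (h0 : 0 < s.re) (h1 : s.re < lam N) :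
    DifferentiableAt ℂ (mellin (cutRemainder ψ β lam N)) s :=
  mellin_differentiableAt_of_isBigO_rpow (h.cutRemainder_locallyIntegrableOn N)
    (h.cutRemainder_isBigO_atTop N) h1 (h.cutRemainder_isBigO_zero N (half_pos h0)) (by linarith)

theorem analyticAt_mellin_cutRemainder (N : ℕ) {s : ℂ} (h0 : 0 < s.re) (h1 : s.re < lam N) :
    AnalyticAt ℂ (mellin (cutRemainder ψ β lam N)) s := by
  have ho : IsOpen {s : ℂ | 0 < s.re ∧ s.re < lam N} :=
    (isOpen_lt continuous_const Complex.continuous_re).inter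
      (isOpen_lt Complex.continuous_re continuous_const)
  refine DifferentiableOn.analyticAt (s := {s : ℂ | 0 < s.re ∧ s.re < lam N}) ?_
    (ho.mem_nhds ⟨h0, h1⟩)
  exact fun w hw => (h.differentiableAt_mellin_cutRemainder N hw.1 hw.2).differentiableWithinAt

theorem mellinStrip_succ (N : ℕ) {s : ℂ} (h0 : 0 < s.re) (h1 : s.re < lam N) :
    mellinStrip ψ β lam (N + 1) s = mellinStrip ψ β lam N s := by
  have hi := hasMellin_cpow_Ioi_one h1
  have hs := hasMellin_sub (h.cutRemainder_mellinConvergent N h0 h1) (hi.1.const_smul (β N))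
  have he : cutRemainder ψ β lam (N + 1) = fun x => cutRemainder ψ β lam N x
      - β N • (Ioi (1 : ℝ)).indicator (fun x : ℝ => (x : ℂ) ^ (-(lam N : ℂ))) x := by
    funext x; simp only [cutRemainder, Finset.sum_range_succ]; ring
  rw [mellinStrip, he, hs.2, mellin_const_smul, hi.2, mellinStrip, Finset.sum_range_succ]
  simp only [smul_eq_mul]
  ring

theorem mellinStrip_eq_of_le {M N : ℕ} (hMN : M ≤ N) {s : ℂ} (h0 : 0 < s.re) (h1 : s.re < lam M) :
    mellinStrip ψ β lam N s = mellinStrip ψ β lam M s := by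
  induction N, hMN using Nat.le_induction with
  | base => rfl
  | succ N hN ih =>
    rw [h.mellinStrip_succ N h0 (h1.trans_le (h.strictMono.monotone hN)), ih]

/-- On the strip `lam (N - 1) < Re s < lam N` the continuation is the Mellin transform of `ψ` minus
the first `N` terms of its expansion. -/
theorem hasMellin_sub_partialExpansion (N : ℕ) {s : ℂ} (h0 : 0 < s.re) (h1 : s.re < lam N)
    (h2 : ∀ l < N, lam l < s.re) :
    HasMellin (fun x => ψ x - partialExpansion β lam N x) s (mellinStrip ψ β lam N s) := by
  -- to the right of `lam l` the pole term `1/(s - lam l)` is the Mellin transform of the missing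
  -- part of the power, the one on `(0, 1]`
  have hsum : ∀ S : Finset ℕ, (∀ l ∈ S, lam l < s.re) →
      HasMellin (fun x : ℝ => ∑ l ∈ S, β l • (Ioc (0 : ℝ) 1).indicator
        (fun x : ℝ => (x : ℂ) ^ (-(lam l : ℂ))) x) s (∑ l ∈ S, β l / (s - lam l)) := by
    intro S
    induction S using Finset.induction_on with
    | empty => intro _; simp [HasMellin, MellinConvergent, mellin]
    | insert a S ha ih =>
      intro hS
      have h3 := ih fun l hl => hS l (Finset.mem_insert_of_mem hl)
      have h4 := hasMellin_cpow_Ioc (-(lam a : ℂ)) (s := s)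
        (by simpa using hS a (Finset.mem_insert_self _ _))
      have h5 := hasMellin_add (h4.1.const_smul (β a)) h3.1
      simp only [Finset.sum_insert ha]
      refine ⟨h5.1, ?_⟩
      rw [h5.2, mellin_const_smul, h4.2, h3.2, smul_eq_mul, ← sub_eq_add_neg, mul_one_div]
  have h3 := hsum (Finset.range N) fun l hl => h2 l (Finset.mem_range.1 hl)
  have h4 := hasMellin_sub (h.cutRemainder_mellinConvergent N h0 h1) h3.1
  have he : ∀ x ∈ Ioi (0 : ℝ), cutRemainder ψ β lam N x - ∑ l ∈ Finset.range N, β l •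
      (Ioc (0 : ℝ) 1).indicator (fun x : ℝ => (x : ℂ) ^ (-(lam l : ℂ))) x
      = ψ x - partialExpansion β lam N x := by
    intro x hx
    rw [cutRemainder, partialExpansion, sub_sub, ← Finset.sum_add_distrib]
    congr 1
    refine Finset.sum_congr rfl fun l _ => ?_
    rw [← smul_add, smul_eq_mul]
    congr 1
    by_cases h1x : x ≤ 1
    · rw [indicator_of_notMem (by simpa using h1x), indicator_of_mem (show x ∈ Ioc (0 : ℝ) 1 from ⟨hx, h1x⟩),
        zero_add]
    · rw [indicator_of_mem (by simpa using h1x), indicator_of_notMem (fun h => h1x h.2), add_zero]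
  refine ⟨?_, ?_⟩
  · refine IntegrableOn.congr_fun h4.1 (fun x hx => ?_) measurableSet_Ioi
    simp only [he x hx]
  · rw [mellinStrip, ← h3.2, ← h4.2]
    refine setIntegral_congr_fun measurableSet_Ioi fun x hx => ?_
    simp only [he x hx]

/-- The meromorphic continuation of the Mellin transform to the right half-plane. -/
theorem exists_continuation (hlam : Tendsto lam atTop atTop) :
    ∃ M : ℂ → ℂ, (∀ s : ℂ, 0 < s.re → (∀ l, s ≠ lam l) → AnalyticAt ℂ M s) ∧
      (∀ l, ∃ g : ℂ → ℂ, AnalyticAt ℂ g (lam l) ∧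
        ∀ᶠ s in 𝓝[≠] (lam l : ℂ), M s = -β l / (s - lam l) + g s) ∧
      ∀ N : ℕ, ∀ s : ℂ, 0 < s.re → s.re < lam N → (∀ l < N, lam l < s.re) →
        HasMellin (fun x => ψ x - partialExpansion β lam N x) s (M s) := by
  have hex : ∀ s : ℂ, ∃ N, s.re < lam N := fun s => (hlam.eventually_gt_atTop s.re).exists
  choose ν hν using hex
  -- the continuations to the strips agree, so `ν` only has to pick a large enough strip
  have heq : ∀ N : ℕ, ∀ s : ℂ, 0 < s.re → s.re < lam N →
      mellinStrip ψ β lam (ν s) s = mellinStrip ψ β lam N s := by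
    intro N s h0 h1
    rw [← h.mellinStrip_eq_of_le (le_max_left (ν s) N) h0 (hν s),
      ← h.mellinStrip_eq_of_le (le_max_right (ν s) N) h0 h1]
  have hev : ∀ N : ℕ, ∀ s : ℂ, 0 < s.re → s.re < lam N →
      ∀ᶠ w in 𝓝 s, mellinStrip ψ β lam (ν w) w = mellinStrip ψ β lam N w := by
    intro N s h0 h1
    filter_upwards [(isOpen_lt continuous_const Complex.continuous_re).mem_nhds h0,
      (isOpen_lt Complex.continuous_re continuous_const).mem_nhds h1] with w hw0 hw1
    exact heq N w hw0 hw1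
  have hpole : ∀ l : ℕ, ∀ s : ℂ, s ≠ lam l →
      AnalyticAt ℂ (fun w : ℂ => β l / (w - lam l)) s := fun l s hs =>
    analyticAt_const.div (analyticAt_id.sub analyticAt_const) (sub_ne_zero.2 hs)
  refine ⟨fun s => mellinStrip ψ β lam (ν s) s, ?_, ?_, ?_⟩
  · intro s h0 hs
    refine AnalyticAt.congr ?_ (EventuallyEq.symm (hev (ν s) s h0 (hν s)))
    refine (h.analyticAt_mellin_cutRemainder _ h0 (hν s)).sub ?_
    exact Finset.analyticAt_fun_sum _ fun l _ => hpole l s (hs l)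
  · intro l
    have h0 : 0 < (lam l : ℂ).re := by simpa using h.pos l
    have h1 : (lam l : ℂ).re < lam (l + 1) := by simpa using h.strictMono (Nat.lt_succ_self l)
    refine ⟨fun s => mellin (cutRemainder ψ β lam (l + 1)) s
      - ∑ i ∈ Finset.range l, β i / (s - lam i), ?_, ?_⟩
    · refine (h.analyticAt_mellin_cutRemainder _ h0 h1).sub ?_
      refine Finset.analyticAt_fun_sum _ fun i hi => hpole i _ ?_
      exact_mod_cast (h.strictMono (Finset.mem_range.1 hi)).ne'
    · filter_upwards [(hev (l + 1) _ h0 h1).filter_mono nhdsWithin_le_nhds] with s hs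
      rw [hs, mellinStrip, Finset.sum_range_succ]
      ring
  · intro N s h0 h1 h2
    have := h.hasMellin_sub_partialExpansion N h0 h1 h2
    rw [← heq N s h0 h1] at this
    exact this

end HasPowerExpansion

end Mellin

/-! ### Continuous branches of the logarithm -/

section Log

/-- A continuous function on a preconnected set that exponentiates to `1` is constant. -/
theorem exists_eqOn_const_of_exp_eq_one {s : Set ℝ} (hs : IsPreconnected s) {D : ℝ → ℂ}
    (hD : ContinuousOn D s) (h1 : ∀ x ∈ s, Complex.exp (D x) = 1) : ∃ c, ∀ x ∈ s, D x = c := by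
  rcases s.eq_empty_or_nonempty with rfl | ⟨x₀, hx₀⟩
  · exact ⟨0, by simp⟩
  refine ⟨D x₀, fun x hx => ?_⟩
  have hre : ∀ y ∈ s, (D y).re = 0 := by
    intro y hy
    obtain ⟨m, hm⟩ := Complex.exp_eq_one_iff.1 (h1 y hy)
    rw [hm]; simp
  have hint : ∀ y ∈ s, ∃ m : ℤ, (D y).im / (2 * Real.pi) = m := by
    intro y hy
    obtain ⟨m, hm⟩ := Complex.exp_eq_one_iff.1 (h1 y hy)
    refine ⟨m, ?_⟩
    rw [hm]; simp
  have hc : ContinuousOn (fun y => (D y).im / (2 * Real.pi)) s :=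
    (Complex.continuous_im.comp_continuousOn hD).div_const _
  -- an integer-valued continuous function on a preconnected set is constant
  have him : (D x).im / (2 * Real.pi) = (D x₀).im / (2 * Real.pi) := by
    refine hs.constant_of_mapsTo (T := Set.range ((↑) : ℤ → ℝ))
      (Int.isClosedEmbedding_coe_real.isInducing.isDiscrete_range) hc ?_ hx hx₀
    intro y hy
    obtain ⟨m, hm⟩ := hint y hy
    exact ⟨m, hm.symm⟩
  refine Complex.ext (by rw [hre x hx, hre x₀ hx₀]) ?_
  have hpi : (2 * Real.pi) ≠ 0 := by positivity
  field_simp at him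
  exact him

/-- If a continuous `L` satisfies `exp L = h` near `0+`, where `h(x) / x^m` has a nonzero limit, then
`L` grows at most logarithmically. -/
theorem isBigO_of_exp_eq {h L : ℝ → ℂ} (hL : ContinuousOn L (Ioi 0))
    (hexp : ∀ x, 0 < x → Complex.exp (L x) = h x) {m : ℤ} {c : ℂ} (hc : c ≠ 0)
    (hlim : Tendsto (fun x : ℝ => h x / (x : ℂ) ^ m) (𝓝[>] 0) (𝓝 c)) {ε : ℝ} (hε : 0 < ε) :
    L =O[𝓝[>] 0] fun x : ℝ => x ^ (-ε) := by
  have hlim' : Tendsto (fun x : ℝ => h x / (x : ℂ) ^ m / c) (𝓝[>] 0) (𝓝 1) := by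
    simpa [hc] using hlim.div_const c
  obtain ⟨δ, hδ, hball⟩ : ∃ δ > 0, ∀ x ∈ Ioo (0 : ℝ) δ,
      h x / (x : ℂ) ^ m / c ∈ Metric.ball (1 : ℂ) 1 := by
    have := hlim'.eventually_mem (Metric.ball_mem_nhds (1 : ℂ) one_pos)
    obtain ⟨δ, hδ, hs⟩ := mem_nhdsGT_iff_exists_Ioo_subset.1 this
    exact ⟨δ, hδ, fun x hx => hs hx⟩
  have hhc : ContinuousOn h (Ioi 0) :=
    (Complex.continuous_exp.comp_continuousOn hL).congr fun x hx => (hexp x hx).symm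
  have hx0 : ∀ x : ℝ, 0 < x → (x : ℂ) ≠ 0 := fun x hx => by exact_mod_cast hx.ne'
  have hqc : ContinuousOn (fun x : ℝ => h x / (x : ℂ) ^ m / c) (Ioo 0 δ) := by
    refine ContinuousOn.div_const (ContinuousOn.div (hhc.mono fun x hx => hx.1) ?_ ?_) _
    · intro x hx
      exact (Complex.continuous_ofReal.continuousAt.zpow₀ m (Or.inl (hx0 x hx.1))).continuousWithinAt
    · exact fun x hx => zpow_ne_zero _ (hx0 x hx.1)
  have hslit : ∀ x ∈ Ioo (0 : ℝ) δ, h x / (x : ℂ) ^ m / c ∈ Complex.slitPlane := fun x hx =>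
    Complex.ball_one_subset_slitPlane (hball x hx)
  set q : ℝ → ℂ := fun x => Complex.log (h x / (x : ℂ) ^ m / c) with hq
  have hqlog : ContinuousOn q (Ioo 0 δ) := fun x hx => (hqc x hx).clog (hslit x hx)
  set D : ℝ → ℂ := fun x => L x - m * (Real.log x : ℂ) - q x - Complex.log c with hDdef
  have hDc : ContinuousOn D (Ioo 0 δ) := by
    refine ((ContinuousOn.sub (hL.mono fun x hx => hx.1) ?_).sub hqlog).sub continuousOn_const
    refine continuousOn_const.mul (Complex.continuous_ofReal.comp_continuousOn ?_)
    exact Real.continuousOn_log.mono fun x hx => ne_of_gt hx.1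
  have hD1 : ∀ x ∈ Ioo (0 : ℝ) δ, Complex.exp (D x) = 1 := by
    intro x hx
    have hh : h x ≠ 0 := by rw [← hexp x hx.1]; exact Complex.exp_ne_zero _
    have hxm : (x : ℂ) ^ m ≠ 0 := zpow_ne_zero _ (hx0 x hx.1)
    have hlogx : Complex.exp (m * (Real.log x : ℂ)) = (x : ℂ) ^ m := by
      rw [Complex.exp_int_mul, ← Complex.ofReal_exp, Real.exp_log hx.1]
    rw [hDdef]
    simp only [Complex.exp_sub, hexp x hx.1, hlogx, hq, Complex.exp_log hc]
    rw [Complex.exp_log (div_ne_zero (div_ne_zero hh hxm) hc)]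
    field_simp
  obtain ⟨C, hC⟩ := exists_eqOn_const_of_exp_eq_one isPreconnected_Ioo hDc hD1
  have hform : L =ᶠ[𝓝[>] 0] fun x => m * (Real.log x : ℂ) + (q x + (Complex.log c + C)) := by
    filter_upwards [Ioo_mem_nhdsGT hδ] with x hx
    have := hC x hx
    simp only [hDdef] at this
    linear_combination this
  refine hform.trans_isBigO ?_
  have hone : (fun _ : ℝ => (1 : ℂ)) =O[𝓝[>] 0] fun x : ℝ => x ^ (-ε) := by
    refine IsBigO.of_bound 1 ?_
    filter_upwards [Ioo_mem_nhdsGT one_pos] with x hx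
    rw [norm_one, one_mul, Real.norm_of_nonneg (Real.rpow_nonneg hx.1.le _)]
    exact Real.one_le_rpow_of_pos_of_le_one_of_nonpos hx.1 hx.2.le (by linarith)
  refine IsBigO.add ?_ ?_
  · refine IsBigO.const_mul_left ?_ _
    rw [← isBigO_norm_left]
    simp only [Complex.norm_real]
    rw [isBigO_norm_left]
    exact (isLittleO_log_rpow_nhdsGT_zero (by linarith)).isBigO
  · have hq0 : Tendsto (fun x => q x + (Complex.log c + C)) (𝓝[>] 0)
        (𝓝 (Complex.log 1 + (Complex.log c + C))) :=
      (hlim'.clog (by simp)).add tendsto_const_nhds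
    exact (hq0.isBigO_one ℂ).trans hone

/-- A continuous nonvanishing function on an open half-line that tends to `1` at infinity has a
continuous logarithm that tends to `0`. -/
theorem exists_log_Ioi {h : ℝ → ℂ} (hc : ContinuousOn h (Ioi 0)) (h0 : ∀ x, 0 < x → h x ≠ 0)
    (hlim : Tendsto h atTop (𝓝 1)) :
    ∃ L : ℝ → ℂ, ContinuousOn L (Ioi 0) ∧ (∀ x, 0 < x → Complex.exp (L x) = h x) ∧
      Tendsto L atTop (𝓝 0) := by
  have hsc : IsSimplyConnected (Ioi (0 : ℝ)) := by
    have := (convex_Ioi (0 : ℝ)).contractibleSpace ⟨1, mem_Ioi.2 one_pos⟩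
    exact SimplyConnectedSpace.ofContractible _
  obtain ⟨L, hL, hexp⟩ := Complex.exists_continuousOn_eqOn_exp_comp hsc isOpen_Ioi hc
    (by rintro ⟨x, hx, hx0⟩; exact h0 x hx hx0)
  obtain ⟨X, hX⟩ : ∃ X : ℝ, ∀ x, X ≤ x → h x ∈ Metric.ball (1 : ℂ) 1 :=
    (hlim.eventually_mem (Metric.ball_mem_nhds (1 : ℂ) one_pos)).exists_forall_of_atTop
  set Y := max X 1
  have hsub : Ioi Y ⊆ Ioi 0 := Ioi_subset_Ioi (zero_le_one.trans (le_max_right _ _))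
  have hslit : ∀ x ∈ Ioi Y, h x ∈ Complex.slitPlane := fun x hx =>
    Complex.ball_one_subset_slitPlane (hX x ((le_max_left X 1).trans (le_of_lt hx)))
  obtain ⟨C, hC⟩ := exists_eqOn_const_of_exp_eq_one (s := Ioi Y) isPreconnected_Ioi
    (D := fun x => L x - Complex.log (h x))
    ((hL.mono hsub).sub fun x hx => ((hc.mono hsub) x hx).clog (hslit x hx))
    (fun x hx => by
      have := hexp (hsub hx)
      simp only [Function.comp_apply] at this
      rw [Complex.exp_sub, this, Complex.exp_log (h0 x (hsub hx)), div_self (h0 x (hsub hx))])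
  have hexpC : Complex.exp C = 1 := by
    have hx : Y + 1 ∈ Ioi Y := by simp
    rw [← hC _ hx, Complex.exp_sub, Complex.exp_log (h0 _ (hsub hx))]
    have := hexp (hsub hx)
    simp only [Function.comp_apply] at this
    rw [this, div_self (h0 _ (hsub hx))]
  refine ⟨fun x => L x - C, hL.sub continuousOn_const, fun x hx => ?_, ?_⟩
  · rw [Complex.exp_sub, hexpC, div_one]; exact hexp hx
  · have : Tendsto (fun x => Complex.log (h x)) atTop (𝓝 0) := by
      simpa using hlim.clog (by simp)
    refine this.congr' ?_
    filter_upwards [eventually_gt_atTop Y] with x hx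
    rw [← hC x hx]; ring

theorem exists_isLogBranch {h : ℂ → ℂ} (hc : ContinuousOn (fun k : ℝ => h k) {0}ᶜ)
    (h0 : ∀ k : ℝ, k ≠ 0 → h k ≠ 0) (htop : Tendsto (fun k : ℝ => h k) atTop (𝓝 1))
    (hbot : Tendsto (fun k : ℝ => h k) atBot (𝓝 1)) : ∃ L, IsLogBranch h L := by
  obtain ⟨L₁, hL₁, he₁, ht₁⟩ := exists_log_Ioi (h := fun k : ℝ => h k)
    (hc.mono fun x hx => ne_of_gt hx) (fun x hx => h0 x hx.ne') htop
  obtain ⟨L₂, hL₂, he₂, ht₂⟩ := exists_log_Ioi (h := fun k : ℝ => h (-k : ℝ))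
    (hc.comp continuousOn_neg fun x hx => by
      simpa using ne_of_gt hx) (fun x hx => h0 (-x) (neg_ne_zero.2 hx.ne'))
    (hbot.comp tendsto_neg_atTop_atBot)
  refine ⟨fun x => if 0 < x then L₁ x else L₂ (-x), ?_, ?_, ?_, ?_⟩
  · intro x hx
    rcases lt_or_gt_of_ne (show x ≠ 0 from hx) with hx | hx
    · have hcont : ContinuousAt (fun x => L₂ (-x)) x :=
        ContinuousAt.comp (g := L₂) (hL₂.continuousAt (Ioi_mem_nhds (by linarith)))
          continuous_neg.continuousAt
      refine (hcont.congr ?_).continuousWithinAt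
      filter_upwards [Iio_mem_nhds hx] with y hy
      rw [if_neg (not_lt.2 (le_of_lt hy))]
    · refine ((hL₁.continuousAt (Ioi_mem_nhds hx)).congr ?_).continuousWithinAt
      filter_upwards [Ioi_mem_nhds hx] with y hy
      rw [if_pos (show 0 < y from hy)]
  · intro x hx
    rcases lt_or_gt_of_ne hx with hx | hx
    · rw [if_neg (not_lt.2 hx.le), he₂ (-x) (by linarith), neg_neg]
    · rw [if_pos hx, he₁ x hx]
  · refine ht₁.congr' ?_
    filter_upwards [eventually_gt_atTop 0] with x hx
    rw [if_pos hx]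
  · refine (ht₂.comp tendsto_neg_atBot_atTop).congr' ?_
    filter_upwards [eventually_lt_atBot 0] with x hx
    rw [if_neg (not_lt.2 hx.le)]; rfl

end Log

/-! ### The logarithm of an asymptotic power series -/

section LogSeries

open Polynomial

/-- If `l a_l = ∑_{j=1}^{l} j e_j a_{l-j}`, then `exp (-∑_{1 ≤ l ≤ N} e_l t^l) ∑_{l ≤ N} a_l t^l` is
`1 + O(t^{N+1})`: its derivative is `exp (-E) (P' - E' P)` and `P' - E' P` is divisible by `t^N`. -/
theorem exp_neg_mul_sum_sub_one_isBigO {a e : ℕ → ℂ} (ha : a 0 = 1)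
    (hrec : ∀ l : ℕ, ((l : ℂ) + 1) * a (l + 1)
      = ∑ j ∈ Finset.range (l + 1), ((j : ℂ) + 1) * e (j + 1) * a (l - j)) (N : ℕ) :
    (fun t : ℂ => Complex.exp (-∑ l ∈ Finset.range N, e (l + 1) * t ^ (l + 1))
      * (∑ l ∈ Finset.range (N + 1), a l * t ^ l) - 1) =O[𝓝 0] fun t => t ^ (N + 1) := by
  set P : ℂ[X] := ∑ l ∈ Finset.range (N + 1), C (a l) * X ^ l with hP
  set E : ℂ[X] := ∑ l ∈ Finset.range N, C (e (l + 1)) * X ^ (l + 1) with hE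
  have hPc : ∀ m ≤ N, P.coeff m = a m := by
    intro m hm
    rw [hP, finsetSum_coeff, Finset.sum_eq_single m]
    · simp
    · intro b _ hb; rw [coeff_C_mul_X_pow, if_neg hb.symm]
    · intro h; exact absurd (Finset.mem_range.2 (by omega)) h
  have hEc : ∀ m < N, E.coeff (m + 1) = e (m + 1) := by
    intro m hm
    rw [hE, finsetSum_coeff, Finset.sum_eq_single m]
    · simp
    · intro b _ hb; rw [coeff_C_mul_X_pow, if_neg (by omega)]
    · intro h; exact absurd (Finset.mem_range.2 (by omega)) h
  have hdvd : X ^ N ∣ derivative P - derivative E * P := by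
    rw [X_pow_dvd_iff]
    intro d hd
    rw [coeff_sub, coeff_derivative, coeff_mul, Finset.Nat.sum_antidiagonal_eq_sum_range_succ_mk,
      hPc (d + 1) hd, mul_comm, hrec d, sub_eq_zero]
    refine Finset.sum_congr rfl fun j hj => ?_
    have hj' := Finset.mem_range.1 hj
    rw [coeff_derivative, hEc j (by omega), hPc (d - j) (by omega)]
    ring
  obtain ⟨R, hR⟩ := hdvd
  set Q : ℂ → ℂ := fun t => Complex.exp (-E.eval t) * P.eval t with hQ
  have hQd : ∀ t, HasDerivAt Q (Complex.exp (-E.eval t) * (t ^ N * R.eval t)) t := by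
    intro t
    have h1 := ((E.hasDerivAt t).neg.cexp).mul (P.hasDerivAt t)
    refine h1.congr_deriv ?_
    have h2 : (derivative P).eval t - (derivative E).eval t * P.eval t = t ^ N * R.eval t := by
      rw [← eval_mul, ← eval_sub, hR]; simp
    rw [← h2]
    simp only [Pi.neg_apply]
    ring
  have hcont : Continuous fun t : ℂ => Complex.exp (-E.eval t) * R.eval t := by
    have := E.continuous; have := R.continuous
    fun_prop
  obtain ⟨K, hK⟩ := (isCompact_closedBall (0 : ℂ) 1).exists_bound_of_continuousOn
    hcont.continuousOn
  have hQ0 : Q 0 = 1 := by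
    simp only [hQ, ← coeff_zero_eq_eval_zero, hPc 0 (Nat.zero_le _), ha]
    have : E.coeff 0 = 0 := by
      rw [hE, finsetSum_coeff]
      refine Finset.sum_eq_zero fun i _ => ?_
      rw [coeff_C_mul_X_pow, if_neg (by omega)]
    rw [this]; simp
  have hmain : (fun t => Q t - 1) =O[𝓝 0] fun t => t ^ (N + 1) := by
    refine IsBigO.of_bound K ?_
    filter_upwards [Metric.closedBall_mem_nhds (0 : ℂ) one_pos] with t ht
    have ht1 : ‖t‖ ≤ 1 := by simpa using ht
    have := (convex_closedBall (0 : ℂ) ‖t‖).norm_image_sub_le_of_norm_hasDerivWithin_le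
      (f := Q) (C := K * ‖t‖ ^ N) (x := 0) (y := t) (fun w _ => (hQd w).hasDerivWithinAt)
      (fun w hw => by
        have hw' : ‖w‖ ≤ ‖t‖ := by simpa using hw
        have hk := hK w (by simpa using hw'.trans ht1)
        calc ‖Complex.exp (-E.eval w) * (w ^ N * R.eval w)‖
            = ‖Complex.exp (-E.eval w) * R.eval w‖ * ‖w‖ ^ N := by
              simp only [norm_mul, norm_pow]; ring
          _ ≤ K * ‖t‖ ^ N := by
              have hK0 : 0 ≤ K := (norm_nonneg _).trans hk
              gcongr) (by simp) (by simp)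
    rw [hQ0, sub_zero] at this
    rw [norm_pow, pow_succ, ← mul_assoc]
    exact this
  refine hmain.congr_left fun t => ?_
  simp [hQ, hE, hP, eval_finsetSum]

/-- Taking the logarithm of an asymptotic power series in a small parameter `t`. -/
theorem sub_sum_isBigO_of_exp_eq {a e : ℕ → ℂ} (ha : a 0 = 1)
    (hrec : ∀ l : ℕ, ((l : ℂ) + 1) * a (l + 1)
      = ∑ j ∈ Finset.range (l + 1), ((j : ℂ) + 1) * e (j + 1) * a (l - j)) (N : ℕ)
    {α : Type*} {F : Filter α} {t h L : α → ℂ} (ht : Tendsto t F (𝓝 0))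
    (hh : (fun x => h x - ∑ l ∈ Finset.range (N + 1), a l * t x ^ l) =O[F] fun x => t x ^ (N + 1))
    (hL : Tendsto L F (𝓝 0)) (hexp : ∀ᶠ x in F, Complex.exp (L x) = h x) :
    (fun x => L x - ∑ l ∈ Finset.range N, e (l + 1) * t x ^ (l + 1))
      =O[F] fun x => t x ^ (N + 1) := by
  set E : ℂ → ℂ := fun t => ∑ l ∈ Finset.range N, e (l + 1) * t ^ (l + 1) with hE
  have hEc : Continuous E := by simp only [hE]; fun_prop
  have hE0 : E 0 = 0 := by simp [hE]
  have hEt : Tendsto (fun x => E (t x)) F (𝓝 0) := by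
    have := (hEc.tendsto 0).comp ht
    rwa [hE0] at this
  have h1 : (fun x => Complex.exp (L x - E (t x)) - 1) =O[F] fun x => t x ^ (N + 1) := by
    have h2 := (exp_neg_mul_sum_sub_one_isBigO ha hrec N).comp_tendsto ht
    have hb : (fun x => Complex.exp (-E (t x))) =O[F] fun _ => (1 : ℂ) :=
      Tendsto.isBigO_one ℂ (hEt.neg.cexp)
    have h3 := hb.mul hh
    simp only [one_mul] at h3
    refine (h3.add h2).congr' ?_ EventuallyEq.rfl
    filter_upwards [hexp] with x hx
    simp only [Function.comp_apply, hE] at hx ⊢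
    rw [sub_eq_add_neg (L x), Complex.exp_add, hx]
    ring
  have hd : Tendsto (fun x => L x - E (t x)) F (𝓝 0) := by simpa using hL.sub hEt
  -- `w = O(exp w - 1)` as `w → 0`
  have hw : (fun w : ℂ => w) =O[𝓝 0] fun w => Complex.exp w - 1 := by
    have h4 := ((Complex.hasDerivAt_exp 0).isTheta_sub (by simp)).symm.isBigO
    simpa [Function.comp_def] using h4
  exact (hw.comp_tendsto hd).trans h1

end LogSeries

/-! ### Determinants of matrices with an asymptotic expansion -/

section DetExpansion

variable {n : ℕ} {α : Type*} {F : Filter α}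

/-- The coefficient of `t^m` in `det (∑ l, C l t^l)`. The multi-indices are nonnegative with sum `m`,
so bounding them by `m` is no restriction. -/
noncomputable def detCoeff (C : ℕ → Mat n) (m : ℕ) : ℂ :=
  ∑ σ : Equiv.Perm (Fin n), ((Equiv.Perm.sign σ : ℤ) : ℂ) *
    ∑ p ∈ (Fintype.piFinset fun _ : Fin n => Finset.range (m + 1)).filter
        (fun p => ∑ i, p i = m),
      ∏ i, C (p i) i (σ i)

/-- Shifting all indices by one turns `dCoeff`, whose indices start at `-1`, into `detCoeff`. -/
theorem dCoeff_eq_detCoeff (V : ℝ → Mat n) (A B : Mat n) (m : ℕ) :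
    dCoeff V A B ((m : ℤ) - n) = detCoeff (fun l => cCoeff V A B ((l : ℤ) - 1)) m := by
  unfold dCoeff detCoeff
  refine Finset.sum_congr rfl fun σ _ => ?_
  congr 1
  refine Finset.sum_nbij' (fun p i => (p i + 1).toNat) (fun p i => (p i : ℤ) - 1) ?_ ?_ ?_ ?_ ?_
  · intro p hp
    simp only [Finset.mem_filter, Fintype.mem_piFinset, Finset.mem_Icc, Finset.mem_range] at hp ⊢
    have hsum : ∑ i, (p i + 1) = m := by
      rw [Finset.sum_add_distrib, hp.2]
      simp
    refine ⟨fun i => ?_, ?_⟩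
    · have := Finset.single_le_sum (f := fun i => p i + 1)
        (fun j _ => by have := hp.1 j; omega) (Finset.mem_univ i)
      have := hp.1 i
      omega
    · have : ((∑ i, (p i + 1).toNat : ℕ) : ℤ) = m := by
        push_cast
        rw [← hsum]
        refine Finset.sum_congr rfl fun i _ => ?_
        have := hp.1 i
        omega
      exact_mod_cast this
  · intro p hp
    simp only [Finset.mem_filter, Fintype.mem_piFinset, Finset.mem_Icc, Finset.mem_range] at hp ⊢
    refine ⟨fun i => by have := hp.1 i; omega, ?_⟩
    rw [Finset.sum_sub_distrib, ← Nat.cast_sum, hp.2]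
    simp
  · intro p hp
    simp only [Finset.mem_filter, Fintype.mem_piFinset, Finset.mem_Icc] at hp
    funext i
    have := hp.1 i
    show (((p i + 1).toNat : ℕ) : ℤ) - 1 = p i
    omega
  · intro p hp
    funext i
    simp
  · intro p hp
    simp only [Finset.mem_filter, Fintype.mem_piFinset, Finset.mem_Icc] at hp
    refine Finset.prod_congr rfl fun i _ => ?_
    have := hp.1 i
    have h1 : (((p i + 1).toNat : ℕ) : ℤ) - 1 = p i := by omega
    simp only [h1]

theorem prod_sub_prod_isBigO {ι : Type*} (s : Finset ι) {f g : ι → α → ℂ} {τ : α → ℂ}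
    (hτ : τ =O[F] fun _ => (1 : ℂ)) (hg : ∀ i ∈ s, g i =O[F] fun _ => (1 : ℂ))
    (hfg : ∀ i ∈ s, (fun x => f i x - g i x) =O[F] τ) :
    (fun x => ∏ i ∈ s, f i x - ∏ i ∈ s, g i x) =O[F] τ := by
  classical
  induction s using Finset.induction_on with
  | empty => simpa using isBigO_zero τ F
  | insert a s ha ih =>
    have ih' := ih (fun i hi => hg i (Finset.mem_insert_of_mem hi))
      (fun i hi => hfg i (Finset.mem_insert_of_mem hi))
    have hprod : ∀ u : Finset ι, (∀ i ∈ u, g i =O[F] fun _ => (1 : ℂ)) →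
        (fun x => ∏ i ∈ u, g i x) =O[F] fun _ => (1 : ℂ) := by
      intro u
      induction u using Finset.induction_on with
      | empty => intro _; simpa using isBigO_refl (fun _ : α => (1 : ℂ)) F
      | insert b u hb ihu =>
        intro h
        have := (h b (Finset.mem_insert_self _ _)).mul
          (ihu fun i hi => h i (Finset.mem_insert_of_mem hi))
        simpa [Finset.prod_insert hb] using this
    have ha1 := hfg a (Finset.mem_insert_self _ _)
    have hfa : f a =O[F] fun _ => (1 : ℂ) := by
      have := (ha1.trans hτ).add (hg a (Finset.mem_insert_self _ _))
      simpa using this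
    have h1 := hfa.mul ih'
    have h2 := ha1.mul (hprod s fun i hi => hg i (Finset.mem_insert_of_mem hi))
    simp only [one_mul, mul_one] at h1 h2
    refine (h1.add h2).congr_left fun x => ?_
    rw [Finset.prod_insert ha, Finset.prod_insert ha]
    ring

theorem pow_isBigO_pow {t : α → ℂ} (ht : Tendsto t F (𝓝 0)) {a b : ℕ} (h : a ≤ b) :
    (fun x => t x ^ b) =O[F] fun x => t x ^ a := by
  obtain ⟨d, rfl⟩ := Nat.exists_eq_add_of_le h
  have h1 : (fun x => t x ^ d) =O[F] fun _ => (1 : ℂ) := (ht.pow d).isBigO_one ℂ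
  have := (isBigO_refl (fun x => t x ^ a) F).mul h1
  simpa [pow_add] using this

/-- The determinant of a matrix with an asymptotic expansion in powers of `t → 0`. -/
theorem det_sub_sum_isBigO (C : ℕ → Mat n) {t : α → ℂ} (ht : Tendsto t F (𝓝 0)) {M : α → Mat n}
    (N : ℕ) (hM : ∀ i j, (fun x => M x i j - ∑ l ∈ Finset.range (N + 1), C l i j * t x ^ l)
      =O[F] fun x => t x ^ (N + 1)) :
    (fun x => (M x).det - ∑ m ∈ Finset.range (N + 1), detCoeff C m * t x ^ m)
      =O[F] fun x => t x ^ (N + 1) := by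
  have hone : ∀ m : ℕ, (fun x => t x ^ m) =O[F] fun _ => (1 : ℂ) := fun m =>
    (ht.pow m).isBigO_one ℂ
  -- the product of the truncated entries, truncated again
  have hprod : ∀ σ : Equiv.Perm (Fin n),
      (fun x => ∏ i, (∑ l ∈ Finset.range (N + 1), C l i (σ i) * t x ^ l)
        - ∑ m ∈ Finset.range (N + 1), (∑ p ∈ (Fintype.piFinset fun _ : Fin n =>
            Finset.range (m + 1)).filter (fun p => ∑ i, p i = m), ∏ i, C (p i) i (σ i)) * t x ^ m)
        =O[F] fun x => t x ^ (N + 1) := by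
    intro σ
    set S := Fintype.piFinset fun _ : Fin n => Finset.range (N + 1) with hS
    have hfilter : ∀ m ∈ Finset.range (N + 1),
        (Fintype.piFinset fun _ : Fin n => Finset.range (m + 1)).filter (fun p => ∑ i, p i = m)
          = (S.filter fun p => ∑ i, p i < N + 1).filter (fun p => ∑ i, p i = m) := by
      intro m hm
      have hm' := Finset.mem_range.1 hm
      ext p
      simp only [hS, Finset.mem_filter, Fintype.mem_piFinset, Finset.mem_range]
      constructor
      · rintro ⟨h1, h2⟩
        exact ⟨⟨fun i => (h1 i).trans_le (by omega), by omega⟩, h2⟩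
      · rintro ⟨⟨h1, h2⟩, h3⟩
        refine ⟨fun i => ?_, h3⟩
        have := Finset.single_le_sum (f := p) (fun j _ => Nat.zero_le _) (Finset.mem_univ i)
        omega
    have hlow : ∀ x, ∑ m ∈ Finset.range (N + 1), (∑ p ∈ (Fintype.piFinset fun _ : Fin n =>
          Finset.range (m + 1)).filter (fun p => ∑ i, p i = m), ∏ i, C (p i) i (σ i)) * t x ^ m
        = ∑ p ∈ S.filter (fun p => ∑ i, p i < N + 1),
            (∏ i, C (p i) i (σ i)) * t x ^ (∑ i, p i) := by
      intro x
      rw [← Finset.sum_fiberwise_of_maps_to (s := S.filter fun p => ∑ i, p i < N + 1)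
        (t := Finset.range (N + 1)) (g := fun p => ∑ i, p i)
        (fun p hp => Finset.mem_range.2 (Finset.mem_filter.1 hp).2)]
      refine Finset.sum_congr rfl fun m hm => ?_
      rw [hfilter m hm, Finset.sum_mul]
      refine Finset.sum_congr rfl fun p hp => ?_
      rw [(Finset.mem_filter.1 hp).2]
    have hfull : ∀ x, ∏ i, (∑ l ∈ Finset.range (N + 1), C l i (σ i) * t x ^ l)
        = ∑ p ∈ S, (∏ i, C (p i) i (σ i)) * t x ^ (∑ i, p i) := by
      intro x
      rw [Finset.prod_univ_sum]
      refine Finset.sum_congr rfl fun p _ => ?_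
      rw [Finset.prod_mul_distrib, Finset.prod_pow_eq_pow_sum]
    have hdiff : ∀ x, ∏ i, (∑ l ∈ Finset.range (N + 1), C l i (σ i) * t x ^ l)
        - ∑ m ∈ Finset.range (N + 1), (∑ p ∈ (Fintype.piFinset fun _ : Fin n =>
            Finset.range (m + 1)).filter (fun p => ∑ i, p i = m), ∏ i, C (p i) i (σ i)) * t x ^ m
        = ∑ p ∈ S.filter (fun p => ¬ ∑ i, p i < N + 1),
            (∏ i, C (p i) i (σ i)) * t x ^ (∑ i, p i) := by
      intro x
      rw [hlow, hfull, ← Finset.sum_filter_add_sum_filter_not S (fun p => ∑ i, p i < N + 1)]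
      ring
    simp only [hdiff]
    refine IsBigO.fun_sum fun p hp => ?_
    refine IsBigO.const_mul_left (pow_isBigO_pow ht ?_) _
    exact not_lt.1 (Finset.mem_filter.1 hp).2
  have hentry : ∀ i j, (fun x => ∑ l ∈ Finset.range (N + 1), C l i j * t x ^ l)
      =O[F] fun _ => (1 : ℂ) := fun i j =>
    IsBigO.fun_sum fun l _ => (hone l).const_mul_left _
  have hσ : ∀ σ : Equiv.Perm (Fin n), (fun x => ∏ i, M x i (σ i)
      - ∑ m ∈ Finset.range (N + 1), (∑ p ∈ (Fintype.piFinset fun _ : Fin n =>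
            Finset.range (m + 1)).filter (fun p => ∑ i, p i = m), ∏ i, C (p i) i (σ i)) * t x ^ m)
        =O[F] fun x => t x ^ (N + 1) := by
    intro σ
    have h1 := prod_sub_prod_isBigO (F := F) Finset.univ (f := fun i x => M x i (σ i))
      (g := fun i x => ∑ l ∈ Finset.range (N + 1), C l i (σ i) * t x ^ l) (hone (N + 1))
      (fun i _ => hentry i (σ i)) (fun i _ => hM i (σ i))
    refine (h1.add (hprod σ)).congr_left fun x => ?_
    ring
  have hdet : ∀ x, (M x).det - ∑ m ∈ Finset.range (N + 1), detCoeff C m * t x ^ m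
      = ∑ σ : Equiv.Perm (Fin n), ((Equiv.Perm.sign σ : ℤ) : ℂ) * (∏ i, M x i (σ i)
        - ∑ m ∈ Finset.range (N + 1), (∑ p ∈ (Fintype.piFinset fun _ : Fin n =>
            Finset.range (m + 1)).filter (fun p => ∑ i, p i = m), ∏ i, C (p i) i (σ i))
              * t x ^ m) := by
    intro x
    -- the Leibniz formula of `detCoeff` permutes the columns, that of `Matrix.det` the rows
    rw [← Matrix.det_transpose, Matrix.det_apply']
    simp only [Matrix.transpose_apply, mul_sub, Finset.sum_sub_distrib]
    congr 1
    simp only [detCoeff, Finset.sum_mul, Finset.mul_sum]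
    rw [Finset.sum_comm]
    refine Finset.sum_congr rfl fun σ _ => Finset.sum_congr rfl fun m _ =>
      Finset.sum_congr rfl fun p _ => ?_
    ring
  simp only [hdet]
  exact IsBigO.fun_sum fun σ _ => (hσ σ).const_mul_left _

/-- If `g` has an asymptotic expansion in powers of `t → 0` and `g / t^q → c`, then the expansion
starts with `c t^q`, and `g / t^q` has the shifted expansion. -/
theorem expansion_div_pow [F.NeBot] {D : ℕ → ℂ} {t g : α → ℂ} (ht : Tendsto t F (𝓝 0))
    (ht0 : ∀ᶠ x in F, t x ≠ 0)
    (hg : ∀ N, (fun x => g x - ∑ m ∈ Finset.range (N + 1), D m * t x ^ m)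
      =O[F] fun x => t x ^ (N + 1)) {q : ℕ} {c : ℂ}
    (hc : Tendsto (fun x => g x / t x ^ q) F (𝓝 c)) :
    D q = c ∧ ∀ N, (fun x => g x / t x ^ q - ∑ l ∈ Finset.range (N + 1), D (q + l) * t x ^ l)
      =O[F] fun x => t x ^ (N + 1) := by
  have hlead : ∀ m, (∀ i < m, D i = 0) → Tendsto (fun x => g x / t x ^ m) F (𝓝 (D m)) := by
    intro m hm
    have h1 : (fun x => g x / t x ^ m - D m) =O[F] t := by
      have h2 := (hg m).mul (isBigO_refl (fun x => (t x ^ m)⁻¹) F)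
      refine h2.congr' ?_ ?_
      · filter_upwards [ht0] with x hx
        rw [Finset.sum_range_succ, Finset.sum_eq_zero fun i hi => by
          rw [hm i (Finset.mem_range.1 hi), zero_mul]]
        field_simp
        ring
      · filter_upwards [ht0] with x hx
        rw [pow_succ]
        field_simp
    have h3 := (h1.trans_tendsto ht).add_const (D m)
    simpa using h3
  have hzero : ∀ m, m < q → D m = 0 := by
    intro m
    induction m using Nat.strong_induction_on with
    | _ m ih =>
      intro hmq
      have h1 := hlead m fun i hi => ih i hi (hi.trans hmq)
      have h2 : Tendsto (fun x => g x / t x ^ q * t x ^ (q - m)) F (𝓝 (c * 0)) := by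
        refine hc.mul ?_
        have := ht.pow (q - m)
        rwa [zero_pow (by omega)] at this
      rw [mul_zero] at h2
      refine tendsto_nhds_unique h1 (h2.congr' ?_)
      filter_upwards [ht0] with x hx
      rw [show q = m + (q - m) by omega, pow_add]
      simp only [add_tsub_cancel_left]
      field_simp
  refine ⟨tendsto_nhds_unique (hlead q hzero) hc, fun N => ?_⟩
  have h2 := (hg (q + N)).mul (isBigO_refl (fun x => (t x ^ q)⁻¹) F)
  refine h2.congr' ?_ ?_
  · filter_upwards [ht0] with x hx
    rw [show q + N + 1 = q + (N + 1) by ring, Finset.sum_range_add, Finset.sum_eq_zero fun i hi => by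
        rw [hzero i (Finset.mem_range.1 hi), zero_mul], zero_add, sub_mul, div_eq_mul_inv,
      Finset.sum_mul]
    congr 1
    refine Finset.sum_congr rfl fun l _ => ?_
    rw [pow_add]
    field_simp
  · filter_upwards [ht0] with x hx
    rw [show q + N + 1 = q + (N + 1) by ring, pow_add]
    field_simp

end DetExpansion

/-! ### Determinants near a singular matrix -/

section DetDegenerate

variable {n : ℕ} {α : Type*} {F : Filter α}

/-- For a projection `E` onto the kernel of `P`, `det (1 - E + c E) = c ^ dim ker P`. -/
theorem det_one_sub_add_smul_proj (P E : Mat n) (hE : ∀ v, P *ᵥ v = 0 → E *ᵥ v = v)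
    (hPE : ∀ v, P *ᵥ (E *ᵥ v) = 0) (c : ℂ) :
    (1 - E + c • E).det = c ^ (n - P.rank) := by
  set f : (Fin n → ℂ) →ₗ[ℂ] (Fin n → ℂ) := Matrix.mulVecLin (1 - E + c • E) with hf
  set W := LinearMap.ker (Matrix.mulVecLin P) with hW
  have hfv : ∀ v, f v = v - E *ᵥ v + c • (E *ᵥ v) := by
    intro v
    rw [hf, Matrix.mulVecLin_apply, Matrix.add_mulVec, Matrix.sub_mulVec, Matrix.one_mulVec,
      Matrix.smul_mulVec]
  have hker : ∀ v ∈ W, f v = c • v := by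
    intro v hv
    have hv' : P *ᵥ v = 0 := by simpa [hW] using hv
    rw [hfv, hE v hv', sub_self, zero_add]
  have hle : W ≤ W.comap f := by
    intro v hv
    rw [Submodule.mem_comap, hker v hv]
    exact W.smul_mem c hv
  have hdet := LinearMap.det_eq_det_mul_det W f hle
  have h1 : LinearMap.restrict (p := W) (q := W) f hle = c • LinearMap.id := by
    ext1 v
    exact Subtype.ext (hker v v.2)
  have h2 : W.mapQ W f hle = LinearMap.id := by
    refine Submodule.linearMap_qext _ ?_
    refine LinearMap.ext fun v => ?_
    rw [LinearMap.comp_apply, Submodule.mkQ_apply, Submodule.mapQ_apply]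
    simp only [LinearMap.comp_apply, LinearMap.id_apply, Submodule.mkQ_apply]
    rw [Submodule.Quotient.eq, hfv]
    have hEW : E *ᵥ v ∈ W := by simpa [hW] using hPE v
    have : v - E *ᵥ v + c • (E *ᵥ v) - v = (c - 1) • (E *ᵥ v) := by
      rw [sub_smul, one_smul]; abel
    rw [this]
    exact W.smul_mem _ hEW
  have hrank : Module.finrank ℂ W = n - P.rank := by
    have := LinearMap.finrank_range_add_finrank_ker (Matrix.mulVecLin P)
    rw [Module.finrank_fin_fun, ← hW] at this
    rw [Matrix.rank]
    omega
  rw [h1, h2, LinearMap.det_smul, LinearMap.det_id, LinearMap.det_id, mul_one, mul_one, hrank] at hdet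
  rw [← hdet, hf, ← Matrix.toLin'_apply', LinearMap.det_toLin']

/-- Let `M → P`, and let `ε⁻¹ M v → T v` for `v ∈ ker P`, where `T` is injective on `ker P` and maps it
to vectors orthogonal to the range of `P`. Then `det M` is of exact order `ε ^ dim ker P`: if `E` is a
projection onto `ker P`, then `M (1 - E + ε⁻¹ E)` tends to `P + T E`, which is injective. -/
theorem exists_tendsto_det_div_pow {M : α → Mat n} {ε : α → ℂ} {P T : Mat n}
    (hε : ∀ᶠ x in F, ε x ≠ 0) (hM : Tendsto M F (𝓝 P))
    (hker : ∀ v, P *ᵥ v = 0 → Tendsto (fun x => (ε x)⁻¹ • (M x *ᵥ v)) F (𝓝 (T *ᵥ v)))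
    (hinj : ∀ v, P *ᵥ v = 0 → T *ᵥ v = 0 → v = 0)
    (horth : ∀ v w, P *ᵥ v = 0 → star (T *ᵥ v) ⬝ᵥ (P *ᵥ w) = 0) :
    ∃ c : ℂ, c ≠ 0 ∧ Tendsto (fun x => (M x).det / ε x ^ (n - P.rank)) F (𝓝 c) := by
  obtain ⟨E, hE, hPE⟩ : ∃ E : Mat n, (∀ v, P *ᵥ v = 0 → E *ᵥ v = v) ∧
      ∀ v, P *ᵥ (E *ᵥ v) = 0 := by
    set W := LinearMap.ker (Matrix.mulVecLin P) with hW
    obtain ⟨g, hg⟩ := LinearMap.exists_leftInverse_of_injective W.subtype W.ker_subtype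
    refine ⟨LinearMap.toMatrix' (W.subtype ∘ₗ g), fun v hv => ?_, fun v => ?_⟩
    · rw [← Matrix.toLin'_apply, Matrix.toLin'_toMatrix']
      have hvW : v ∈ W := by simpa [hW] using hv
      have := congrArg (fun φ => ((φ ⟨v, hvW⟩ : W) : Fin n → ℂ)) hg
      simpa using this
    · rw [← Matrix.toLin'_apply (LinearMap.toMatrix' _), Matrix.toLin'_toMatrix']
      have := LinearMap.mem_ker.1 (g v).2
      rwa [Matrix.mulVecLin_apply] at this
  refine ⟨(P + T * E).det, ?_, ?_⟩
  · intro h0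
    obtain ⟨v, hv, hv0⟩ := Matrix.exists_mulVec_eq_zero_iff.2 h0
    rw [Matrix.add_mulVec, ← Matrix.mulVec_mulVec] at hv0
    have ho := horth (E *ᵥ v) v (hPE v)
    have hPv : P *ᵥ v = -(T *ᵥ (E *ᵥ v)) := eq_neg_of_add_eq_zero_left hv0
    rw [hPv, dotProduct_neg, neg_eq_zero, dotProduct_star_self_eq_zero] at ho
    rw [ho, neg_zero] at hPv
    have hEv := hE v hPv
    rw [hEv] at ho
    exact hv (hinj v hPv ho)
  · have hX : Tendsto (fun x => M x * (1 - E + (ε x)⁻¹ • E)) F (𝓝 (P + T * E)) := by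
      have hcol : ∀ v, Tendsto (fun x => (M x * (1 - E + (ε x)⁻¹ • E)) *ᵥ v) F
          (𝓝 ((P + T * E) *ᵥ v)) := by
        intro v
        have h1 : Tendsto (fun x => M x *ᵥ (v - E *ᵥ v)) F (𝓝 (P *ᵥ (v - E *ᵥ v))) :=
          (Continuous.matrix_mulVec continuous_id continuous_const).continuousAt.tendsto.comp hM
        have h2 := h1.add (hker (E *ᵥ v) (hPE v))
        rw [Matrix.mulVec_sub, hPE v, sub_zero] at h2
        rw [Matrix.add_mulVec, ← Matrix.mulVec_mulVec]
        refine h2.congr fun x => ?_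
        rw [← Matrix.mulVec_mulVec, Matrix.add_mulVec, Matrix.sub_mulVec, Matrix.one_mulVec,
          Matrix.smul_mulVec, Matrix.mulVec_add, Matrix.mulVec_smul]
      refine tendsto_pi_nhds.2 fun i => tendsto_pi_nhds.2 fun j => ?_
      have := (tendsto_pi_nhds.1 (hcol (Pi.single j 1))) i
      simpa using this
    have hdet := ((Continuous.matrix_det continuous_id).tendsto (P + T * E)).comp hX
    refine hdet.congr' ?_
    filter_upwards [hε] with x hx
    simp only [Function.comp_apply, id]
    rw [Matrix.det_mul, det_one_sub_add_smul_proj P E hE hPE, inv_pow, div_eq_mul_inv]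

end DetDegenerate

/-! ### Tail integrals and a Gronwall inequality at infinity -/

section Tail

variable {E : Type*} [NormedAddCommGroup E] [NormedSpace ℝ E]

omit [NormedSpace ℝ E] in
theorem integrableOn_Ioi_of_nonneg {g : ℝ → E} (hg : IntegrableOn g (Ioi 0)) {x : ℝ} (hx : 0 ≤ x) :
    IntegrableOn g (Ioi x) :=
  hg.mono_set (Ioi_subset_Ioi hx)

theorem hasDerivAt_integral_Ioi [CompleteSpace E] {g : ℝ → E} (hg : IntegrableOn g (Ioi 0))
    (hc : ContinuousOn g (Ioi 0)) {x : ℝ} (hx : 0 < x) :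
    HasDerivAt (fun y => ∫ t in Ioi y, g t) (-g x) x := by
  have h1 : HasDerivAt (fun y => (∫ t in Ioi 0, g t) - ∫ t in (0 : ℝ)..y, g t) (-g x) x := by
    have h2 : IntervalIntegrable g volume 0 x :=
      (intervalIntegrable_iff_integrableOn_Ioc_of_le hx.le).2 (hg.mono_set Ioc_subset_Ioi_self)
    have h3 := intervalIntegral.integral_hasDerivAt_right h2
      (hc.stronglyMeasurableAtFilter isOpen_Ioi x hx) (hc.continuousAt (Ioi_mem_nhds hx))
    simpa using h3.const_sub (∫ t in Ioi 0, g t)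
  refine h1.congr_of_eventuallyEq ?_
  filter_upwards [Ioi_mem_nhds hx] with y hy
  rw [sub_eq_iff_eq_add'.2]
  exact (intervalIntegral.integral_interval_add_Ioi hg
    (integrableOn_Ioi_of_nonneg hg (le_of_lt hy))).symm

end Tail

section Weight

variable {R : Type*} [NormedRing R]

/-- The tail `∫_x^∞ (1 + t) ‖V(t)‖ dt` of the first moment of `V`. -/
noncomputable def momentTail (V : ℝ → R) (x : ℝ) : ℝ := ∫ t in Ioi x, (1 + t) * ‖V t‖

/-- Potentials that are continuous on `(0, ∞)` and have an integrable first moment. -/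
structure FiniteMoment (V : ℝ → R) : Prop where
  continuousOn : ContinuousOn V (Ioi 0)
  integrableOn : IntegrableOn (fun x : ℝ => (1 + x) * ‖V x‖) (Ioi 0)

namespace FiniteMoment

variable {V : ℝ → R} (hV : FiniteMoment V)
include hV

theorem momentTail_continuousOn : ContinuousOn (momentTail V) (Ici 0) :=
  hV.integrableOn.continuousOn_Ici_primitive_Ioi

omit hV in
theorem momentTail_nonneg {x : ℝ} (hx : 0 ≤ x) : 0 ≤ momentTail V x :=
  setIntegral_nonneg measurableSet_Ioi fun t ht =>
    mul_nonneg (by have : x < t := ht; linarith) (norm_nonneg _)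

theorem momentTail_anti {x y : ℝ} (hx : 0 ≤ x) (hxy : x ≤ y) : momentTail V y ≤ momentTail V x := by
  refine setIntegral_mono_set (integrableOn_Ioi_of_nonneg hV.integrableOn hx) ?_
    (Ioi_subset_Ioi hxy).eventuallyLE
  filter_upwards [ae_restrict_mem measurableSet_Ioi] with t ht
  exact mul_nonneg (by have : x < t := ht; linarith) (norm_nonneg _)

omit hV in
theorem momentTail_tendsto : Tendsto (momentTail V) atTop (𝓝 0) :=
  tendsto_integral_Ioi_zero tendsto_id

theorem continuousOn_weight : ContinuousOn (fun x : ℝ => (1 + x) * ‖V x‖) (Ioi 0) :=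
  ContinuousOn.mul (by fun_prop) hV.continuousOn.norm

theorem hasDerivAt_momentTail {x : ℝ} (hx : 0 < x) :
    HasDerivAt (momentTail V) (-((1 + x) * ‖V x‖)) x :=
  hasDerivAt_integral_Ioi hV.integrableOn hV.continuousOn_weight hx

theorem norm_integrableOn : IntegrableOn (fun x => ‖V x‖) (Ioi 0) := by
  refine Integrable.mono' hV.integrableOn
    (hV.continuousOn.norm.aestronglyMeasurable measurableSet_Ioi) ?_
  filter_upwards [ae_restrict_mem measurableSet_Ioi] with t ht
  rw [norm_norm]
  have : (0 : ℝ) < t := ht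
  nlinarith [norm_nonneg (V t)]

theorem integral_norm_le {x : ℝ} (hx : 0 ≤ x) :
    ∫ t in Ioi x, ‖V t‖ ≤ momentTail V x / (1 + x) := by
  rw [le_div_iff₀ (by linarith), mul_comm, ← integral_const_mul]
  refine setIntegral_mono_on ((integrableOn_Ioi_of_nonneg hV.norm_integrableOn hx).const_mul _)
    (integrableOn_Ioi_of_nonneg hV.integrableOn hx) measurableSet_Ioi fun t ht => ?_
  have : x < t := ht
  gcongr

/-- The weight `exp (2 ∫_x^∞ (1 + t) ‖V‖)` turns the Volterra kernel into a contraction. -/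
theorem integral_weight_exp {x : ℝ} (hx : 0 ≤ x) :
    IntegrableOn (fun t => (1 + t) * ‖V t‖ * Real.exp (2 * momentTail V t)) (Ioi x) ∧
      ∫ t in Ioi x, (1 + t) * ‖V t‖ * Real.exp (2 * momentTail V t)
        = (Real.exp (2 * momentTail V x) - 1) / 2 := by
  have hc : ContinuousOn (fun t => Real.exp (2 * momentTail V t)) (Ici 0) :=
    Real.continuous_exp.comp_continuousOn (continuousOn_const.mul hV.momentTail_continuousOn)
  have hi : IntegrableOn (fun t => (1 + t) * ‖V t‖ * Real.exp (2 * momentTail V t)) (Ioi x) := by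
    refine (integrableOn_Ioi_of_nonneg hV.integrableOn hx).mul_bdd (c := Real.exp (2 * momentTail V 0))
      ((hc.mono fun t ht => hx.trans (le_of_lt ht)).aestronglyMeasurable measurableSet_Ioi) ?_
    filter_upwards [ae_restrict_mem measurableSet_Ioi] with t ht
    rw [Real.norm_of_nonneg (Real.exp_pos _).le]
    have := hV.momentTail_anti le_rfl (hx.trans (le_of_lt ht))
    gcongr
  refine ⟨hi, ?_⟩
  have h := integral_Ioi_of_hasDerivAt_of_tendsto (a := x)
    (f := fun t => -(Real.exp (2 * momentTail V t) / 2))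
    (f' := fun t => (1 + t) * ‖V t‖ * Real.exp (2 * momentTail V t)) (m := -(1 / 2))
    (((hc x hx).mono (Ici_subset_Ici.2 hx)).div_const 2).neg (fun t ht => ?_) hi ?_
  · rw [h]; ring
  · have h1 := ((((hV.hasDerivAt_momentTail (hx.trans_lt ht)).const_mul 2).exp).div_const 2).neg
    refine h1.congr_deriv ?_
    ring
  · have h1 : Tendsto (fun t => Real.exp (2 * momentTail V t)) atTop (𝓝 (Real.exp (2 * 0))) :=
      (Real.continuous_exp.tendsto _).comp (momentTail_tendsto.const_mul 2)
    simpa using (h1.div_const 2).neg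

/-- Gronwall's inequality, integrated from infinity. -/
theorem gronwall {u : ℝ → ℝ} {Q M : ℝ} (hQ : 0 ≤ Q) (h0 : ∀ x, 0 < x → 0 ≤ u x)
    (hM : ∀ x, 0 < x → u x ≤ M)
    (hu : ∀ x, 0 < x → u x ≤ Q + ∫ t in Ioi x, (1 + t) * ‖V t‖ * u t) {x : ℝ} (hx : 0 < x) :
    u x ≤ 2 * Q * Real.exp (2 * momentTail V x) := by
  set v : Ioi (0 : ℝ) → ℝ := fun x => u x * Real.exp (-(2 * momentTail V x)) with hv
  have hM0 : 0 ≤ M := (h0 1 one_pos).trans (hM 1 one_pos)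
  have hbdd : BddAbove (range v) := by
    refine ⟨M, ?_⟩
    rintro _ ⟨⟨y, hy⟩, rfl⟩
    have h1 : Real.exp (-(2 * momentTail V y)) ≤ 1 :=
      Real.exp_le_one_iff.2 (by have := momentTail_nonneg (V := V) (le_of_lt hy); linarith)
    calc u y * Real.exp (-(2 * momentTail V y)) ≤ M * 1 := by
          refine mul_le_mul (hM y hy) h1 (Real.exp_pos _).le hM0
      _ = M := mul_one M
  -- the supremum `S` of `u exp (-2 momentTail)` satisfies `S ≤ Q + S / 2`
  set S := ⨆ y, v y with hS
  have hle : ∀ y, 0 < y → u y ≤ S * Real.exp (2 * momentTail V y) := by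
    intro y hy
    have h1 : v ⟨y, hy⟩ ≤ S := le_ciSup hbdd _
    simp only [hv] at h1
    rwa [Real.exp_neg, ← div_eq_mul_inv, div_le_iff₀ (Real.exp_pos _)] at h1
  have hS0 : 0 ≤ S := by
    have h1 := (h0 1 one_pos).trans (hle 1 one_pos)
    exact nonneg_of_mul_nonneg_left h1 (Real.exp_pos _)
  have : Nonempty (Ioi (0 : ℝ)) := ⟨⟨1, mem_Ioi.2 one_pos⟩⟩
  have hS2 : S ≤ Q + S / 2 := by
    refine ciSup_le ?_
    rintro ⟨y, hy⟩
    have hy0 : (0 : ℝ) < y := hy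
    have hw := hV.integral_weight_exp hy0.le
    have h1 : ∫ t in Ioi y, (1 + t) * ‖V t‖ * u t
        ≤ ∫ t in Ioi y, S * ((1 + t) * ‖V t‖ * Real.exp (2 * momentTail V t)) := by
      refine integral_mono_of_nonneg ?_ (hw.1.const_mul S) ?_
      · filter_upwards [ae_restrict_mem measurableSet_Ioi] with t ht
        have ht0 : 0 < t := hy0.trans ht
        exact mul_nonneg (by positivity) (h0 t ht0)
      · filter_upwards [ae_restrict_mem measurableSet_Ioi] with t ht
        have ht0 : 0 < t := hy0.trans ht
        have h2 := mul_le_mul_of_nonneg_left (hle t ht0)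
          (show 0 ≤ (1 + t) * ‖V t‖ by positivity)
        linarith
    rw [integral_const_mul, hw.2] at h1
    have h2 := hu y hy0
    have h3 : 1 ≤ Real.exp (2 * momentTail V y) :=
      Real.one_le_exp (by have := momentTail_nonneg (V := V) hy0.le; linarith)
    simp only [hv]
    rw [Real.exp_neg, ← div_eq_mul_inv, div_le_iff₀ (Real.exp_pos _)]
    nlinarith
  have hS3 : S ≤ 2 * Q := by linarith
  exact (hle x hx).trans (by gcongr)

end FiniteMoment

end Weight

/-! ### The Volterra equation of the Jost solution -/

/-- The kernel `∫_0^s e^{2iku} du` of the Volterra equation for `m = e^{-ikx} f`. -/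
noncomputable def kern (k : ℂ) (s : ℝ) : ℂ := ∫ u in (0 : ℝ)..s, Complex.exp (2 * Complex.I * k * u)

section Kern

theorem norm_exp_le_one {k : ℂ} (hk : 0 ≤ k.im) {u : ℝ} (hu : 0 ≤ u) :
    ‖Complex.exp (2 * Complex.I * k * u)‖ ≤ 1 := by
  rw [Complex.norm_exp]
  refine Real.exp_le_one_iff.2 ?_
  have : (2 * Complex.I * k * u).re = -(2 * k.im * u) := by simp
  rw [this]
  have := mul_nonneg hk hu
  linarith

theorem norm_kern_le {k : ℂ} (hk : 0 ≤ k.im) {s : ℝ} (hs : 0 ≤ s) : ‖kern k s‖ ≤ s := by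
  have := intervalIntegral.norm_integral_le_of_norm_le_const (a := (0 : ℝ)) (b := s) (C := 1)
    (f := fun u : ℝ => Complex.exp (2 * Complex.I * k * u)) (fun u hu => by
      rw [uIoc_of_le hs] at hu
      exact norm_exp_le_one hk hu.1.le)
  rw [kern]
  simpa [abs_of_nonneg hs] using this

theorem kern_of_ne {k : ℂ} (hk : k ≠ 0) (s : ℝ) :
    kern k s = (Complex.exp (2 * Complex.I * k * s) - 1) / (2 * Complex.I * k) := by
  rw [kern, integral_exp_mul_complex (by simp [hk])]
  simp

theorem kern_zero_left (s : ℝ) : kern 0 s = s := by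
  simp [kern]

theorem continuous_kern (k : ℂ) : Continuous (kern k) :=
  intervalIntegral.continuous_primitive (fun a b => Continuous.intervalIntegrable (by fun_prop) a b) 0

theorem norm_kern_le_inv {k : ℂ} (hk0 : k ≠ 0) (hk : 0 ≤ k.im) {s : ℝ} (hs : 0 ≤ s) :
    ‖kern k s‖ ≤ ‖k‖⁻¹ := by
  have hk' : 0 < ‖k‖ := norm_pos_iff.2 hk0
  rw [kern_of_ne hk0, norm_div]
  have h1 : ‖Complex.exp (2 * Complex.I * k * s) - 1‖ ≤ 2 := by
    refine (norm_sub_le _ _).trans ?_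
    have := norm_exp_le_one hk hs
    rw [norm_one]; linarith
  have h2 : ‖2 * Complex.I * k‖ = 2 * ‖k‖ := by simp
  rw [h2, div_le_iff₀ (by positivity)]
  field_simp
  exact h1

/-- Lipschitz dependence on `k`, the case of small `|k - k₀|` in the continuity of `m` in `k`. -/
theorem norm_exp_sub_exp_le (k k₀ u : ℝ) :
    ‖Complex.exp (2 * Complex.I * k * u) - Complex.exp (2 * Complex.I * k₀ * u)‖
      ≤ 2 * |k - k₀| * |u| := by
  have h1 : Complex.exp (2 * Complex.I * k * u) - Complex.exp (2 * Complex.I * k₀ * u)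
      = Complex.exp (((2 * k₀ * u : ℝ) : ℂ) * Complex.I)
        * (Complex.exp (Complex.I * ((2 * (k - k₀) * u : ℝ) : ℂ)) - 1) := by
    rw [mul_sub, ← Complex.exp_add, mul_one]
    push_cast
    congr 2 <;> ring
  rw [h1, norm_mul, Complex.norm_exp_ofReal_mul_I, one_mul]
  refine (Real.norm_exp_I_mul_ofReal_sub_one_le).trans ?_
  rw [Real.norm_eq_abs, abs_mul, abs_mul, abs_two]

theorem norm_kern_sub_le (k k₀ : ℝ) {s : ℝ} (hs : 0 ≤ s) :
    ‖kern k s - kern k₀ s‖ ≤ 2 * |k - k₀| * s ^ 2 := by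
  have hint : ∀ k : ℂ, IntervalIntegrable (fun u : ℝ => Complex.exp (2 * Complex.I * k * u))
      volume 0 s := fun k => Continuous.intervalIntegrable (by fun_prop) _ _
  rw [kern, kern, ← intervalIntegral.integral_sub (hint k) (hint k₀)]
  have := intervalIntegral.norm_integral_le_of_norm_le_const (a := (0 : ℝ)) (b := s)
    (C := 2 * |k - k₀| * s)
    (f := fun u : ℝ => Complex.exp (2 * Complex.I * k * u) - Complex.exp (2 * Complex.I * k₀ * u))
    (fun u hu => by
      rw [uIoc_of_le hs] at hu
      refine (norm_exp_sub_exp_le k k₀ u).trans ?_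
      rw [abs_of_pos hu.1]
      have := hu.2
      gcongr)
  rw [sub_zero, abs_of_nonneg hs] at this
  calc _ ≤ _ := this
    _ = _ := by ring

end Kern

section Source

variable {E : Type*} [NormedAddCommGroup E] [NormedSpace ℂ E]

/-- The solution of `g'' + 2ik g' = s` that vanishes at infinity, together with `g'`. For `V m` as the
source this is `m - 1`, where `m = e^{-ikx} f(k, x)`. -/
noncomputable def tailSol (k : ℂ) (s : ℝ → E) (x : ℝ) : E := ∫ t in Ioi x, kern k (t - x) • s t

/-- The derivative of `tailSol`. -/
noncomputable def tailSolDeriv (k : ℂ) (s : ℝ → E) (x : ℝ) : E :=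
  -∫ t in Ioi x, Complex.exp (2 * Complex.I * k * ((t - x : ℝ) : ℂ)) • s t

/-- Sources with an integrable first moment. -/
structure FiniteMomentSource (s : ℝ → E) : Prop where
  continuousOn : ContinuousOn s (Ioi 0)
  integrableOn : IntegrableOn (fun x : ℝ => (1 + x) * ‖s x‖) (Ioi 0)

theorem norm_tailSolDeriv_le {k : ℂ} (hk : 0 ≤ k.im) {s : ℝ → E} (hs : IntegrableOn s (Ioi 0))
    {x : ℝ} (hx : 0 ≤ x) : ‖tailSolDeriv k s x‖ ≤ ∫ t in Ioi x, ‖s t‖ := by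
  rw [tailSolDeriv, norm_neg]
  refine norm_integral_le_of_norm_le (integrableOn_Ioi_of_nonneg hs hx).norm ?_
  filter_upwards [ae_restrict_mem measurableSet_Ioi] with t ht
  rw [norm_smul]
  exact mul_le_of_le_one_left (norm_nonneg _)
    (norm_exp_le_one hk (by have : x < t := ht; linarith))

theorem norm_tailSol_le_inv {k : ℂ} (hk0 : k ≠ 0) (hk : 0 ≤ k.im) {s : ℝ → E}
    (hs : IntegrableOn s (Ioi 0)) {x : ℝ} (hx : 0 ≤ x) :
    ‖tailSol k s x‖ ≤ ‖k‖⁻¹ * ∫ t in Ioi x, ‖s t‖ := by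
  rw [tailSol, ← integral_const_mul]
  refine norm_integral_le_of_norm_le ((integrableOn_Ioi_of_nonneg hs hx).norm.const_mul _) ?_
  filter_upwards [ae_restrict_mem measurableSet_Ioi] with t ht
  rw [norm_smul]
  exact mul_le_mul_of_nonneg_right
    (norm_kern_le_inv hk0 hk (by have : x < t := ht; linarith)) (norm_nonneg _)

namespace FiniteMomentSource

variable {s : ℝ → E} (hs : FiniteMomentSource s)
include hs

omit [NormedSpace ℂ E] in
theorem source_integrableOn : IntegrableOn s (Ioi 0) := by
  refine Integrable.mono' hs.integrableOn (hs.continuousOn.aestronglyMeasurable measurableSet_Ioi) ?_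
  filter_upwards [ae_restrict_mem measurableSet_Ioi] with t ht
  have : (0 : ℝ) < t := ht
  nlinarith [norm_nonneg (s t)]

theorem norm_tailSol_le {k : ℂ} (hk : 0 ≤ k.im) {x : ℝ} (hx : 0 ≤ x) :
    ‖tailSol k s x‖ ≤ ∫ t in Ioi x, (1 + t) * ‖s t‖ := by
  rw [tailSol]
  refine norm_integral_le_of_norm_le (integrableOn_Ioi_of_nonneg hs.integrableOn hx) ?_
  filter_upwards [ae_restrict_mem measurableSet_Ioi] with t ht
  have ht' : x < t := ht
  rw [norm_smul]
  refine mul_le_mul_of_nonneg_right ?_ (norm_nonneg _)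
  exact (norm_kern_le hk (by linarith)).trans (by linarith)

theorem kern_smul_integrableOn {k : ℂ} (hk : 0 ≤ k.im) {x : ℝ} (hx : 0 ≤ x) :
    IntegrableOn (fun t => kern k (t - x) • s t) (Ioi x) := by
  refine Integrable.mono' (integrableOn_Ioi_of_nonneg hs.integrableOn hx) ?_ ?_
  · refine ContinuousOn.aestronglyMeasurable ?_ measurableSet_Ioi
    exact ContinuousOn.smul ((continuous_kern k).comp (by fun_prop)).continuousOn
      (hs.continuousOn.mono (Ioi_subset_Ioi hx))
  · filter_upwards [ae_restrict_mem measurableSet_Ioi] with t ht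
    have ht' : x < t := ht
    rw [norm_smul]
    refine mul_le_mul_of_nonneg_right ?_ (norm_nonneg _)
    exact (norm_kern_le hk (by linarith)).trans (by linarith)

theorem exp_smul_integrableOn {k : ℂ} (hk : 0 ≤ k.im) :
    IntegrableOn (fun t : ℝ => Complex.exp (2 * Complex.I * k * t) • s t) (Ioi 0) := by
  refine Integrable.mono' hs.source_integrableOn.norm ?_ ?_
  · refine ContinuousOn.aestronglyMeasurable ?_ measurableSet_Ioi
    exact ContinuousOn.smul (by fun_prop) hs.continuousOn
  · filter_upwards [ae_restrict_mem measurableSet_Ioi] with t ht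
    have ht' : 0 < t := ht
    rw [norm_smul]
    exact mul_le_of_le_one_left (norm_nonneg _) (norm_exp_le_one hk ht'.le)

omit hs in
theorem tailSolDeriv_eq (k : ℂ) (x : ℝ) : tailSolDeriv k s x
    = -(Complex.exp (-(2 * Complex.I * k * x)) •
        ∫ t in Ioi x, Complex.exp (2 * Complex.I * k * t) • s t) := by
  rw [tailSolDeriv, ← integral_smul]
  congr 1
  refine setIntegral_congr_fun measurableSet_Ioi fun t _ => ?_
  rw [smul_smul, ← Complex.exp_add]
  congr 2
  push_cast
  ring

theorem tailSolDeriv_continuousOn {k : ℂ} (hk : 0 ≤ k.im) :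
    ContinuousOn (tailSolDeriv k s) (Ici 0) := by
  have h1 := (hs.exp_smul_integrableOn hk).continuousOn_Ici_primitive_Ioi
  refine ContinuousOn.congr (f := fun x : ℝ => -(Complex.exp (-(2 * Complex.I * k * x)) •
        ∫ t in Ioi x, Complex.exp (2 * Complex.I * k * t) • s t)) ?_ fun x _ => tailSolDeriv_eq k x
  exact (ContinuousOn.smul (by fun_prop) h1).neg

omit hs in
theorem exp_sub_smul_integrableOn {k : ℂ} (hk : 0 ≤ k.im) (hsi : IntegrableOn s (Ioi 0)) {x : ℝ}
    (hx : 0 ≤ x) :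
    IntegrableOn (fun t : ℝ => Complex.exp (2 * Complex.I * k * ((t - x : ℝ) : ℂ)) • s t)
      (Ioi x) := by
  have hsi' := integrableOn_Ioi_of_nonneg hsi hx
  refine Integrable.mono' hsi'.norm ?_ ?_
  · exact AEStronglyMeasurable.smul (Continuous.aestronglyMeasurable (by fun_prop))
      hsi'.aestronglyMeasurable
  · filter_upwards [ae_restrict_mem measurableSet_Ioi] with t ht
    have ht' : x < t := ht
    rw [norm_smul]
    exact mul_le_of_le_one_left (norm_nonneg _) (norm_exp_le_one hk (by linarith))

omit hs in
theorem tailSol_of_ne {k : ℂ} (hk0 : k ≠ 0) (hk : 0 ≤ k.im) (hsi : IntegrableOn s (Ioi 0)) {x : ℝ}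
    (hx : 0 ≤ x) :
    tailSol k s x = (2 * Complex.I * k)⁻¹ • (-tailSolDeriv k s x - ∫ t in Ioi x, s t) := by
  rw [tailSol, tailSolDeriv, neg_neg, ← integral_sub (exp_sub_smul_integrableOn hk hsi hx)
    (integrableOn_Ioi_of_nonneg hsi hx), ← integral_smul]
  refine setIntegral_congr_fun measurableSet_Ioi fun t _ => ?_
  rw [kern_of_ne hk0, div_eq_inv_mul, mul_smul, sub_smul, one_smul]

omit hs in
theorem tailSol_of_ne_add {k : ℂ} (hk0 : k ≠ 0) (hk : 0 ≤ k.im) {s₁ s₂ : ℝ → E}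
    (h₁ : IntegrableOn s₁ (Ioi 0)) (h₂ : IntegrableOn s₂ (Ioi 0)) {x : ℝ} (hx : 0 ≤ x) :
    tailSol k (fun t => s₁ t + s₂ t) x = tailSol k s₁ x + tailSol k s₂ x := by
  have h₁₂ : IntegrableOn (fun t => s₁ t + s₂ t) (Ioi 0) := h₁.add h₂
  rw [tailSol_of_ne hk0 hk h₁₂ hx, tailSol_of_ne hk0 hk h₁ hx, tailSol_of_ne hk0 hk h₂ hx,
    tailSolDeriv, tailSolDeriv, tailSolDeriv,
    integral_add (integrableOn_Ioi_of_nonneg h₁ hx) (integrableOn_Ioi_of_nonneg h₂ hx)]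
  simp only [smul_add]
  rw [integral_add (exp_sub_smul_integrableOn hk h₁ hx) (exp_sub_smul_integrableOn hk h₂ hx)]
  module

theorem id_smul_integrableOn : IntegrableOn (fun t : ℝ => (t : ℂ) • s t) (Ioi 0) := by
  refine Integrable.mono' hs.integrableOn
    (ContinuousOn.aestronglyMeasurable (ContinuousOn.smul (by fun_prop) hs.continuousOn)
      measurableSet_Ioi) ?_
  filter_upwards [ae_restrict_mem measurableSet_Ioi] with t ht
  have ht' : 0 < t := ht
  rw [norm_smul, Complex.norm_real, Real.norm_of_nonneg ht'.le]
  nlinarith [norm_nonneg (s t)]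

theorem tailSol_zero {x : ℝ} (hx : 0 ≤ x) :
    tailSol 0 s x = (∫ t in Ioi x, (t : ℂ) • s t) - (x : ℂ) • ∫ t in Ioi x, s t := by
  rw [tailSol, ← integral_smul, ← integral_sub]
  · refine setIntegral_congr_fun measurableSet_Ioi fun t _ => ?_
    simp only [kern_zero_left]
    rw [Complex.ofReal_sub, sub_smul]
  · exact integrableOn_Ioi_of_nonneg hs.id_smul_integrableOn hx
  · exact (integrableOn_Ioi_of_nonneg hs.source_integrableOn hx).smul _

theorem tailSol_continuousOn {k : ℂ} (hk : 0 ≤ k.im) : ContinuousOn (tailSol k s) (Ici 0) := by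
  have h1 := hs.source_integrableOn.continuousOn_Ici_primitive_Ioi
  rcases eq_or_ne k 0 with rfl | hk0
  · have h2 := hs.id_smul_integrableOn.continuousOn_Ici_primitive_Ioi
    exact (h2.sub (ContinuousOn.smul (by fun_prop) h1)).congr fun x hx => hs.tailSol_zero hx
  · exact (((hs.tailSolDeriv_continuousOn hk).neg.sub h1).const_smul (2 * Complex.I * k)⁻¹).congr
      fun x hx => tailSol_of_ne hk0 hk hs.source_integrableOn hx

variable [CompleteSpace E]

theorem hasDerivAt_tailSolDeriv {k : ℂ} (hk : 0 ≤ k.im) {x : ℝ} (hx : 0 < x) :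
    HasDerivAt (tailSolDeriv k s) (s x - (2 * Complex.I * k) • tailSolDeriv k s x) x := by
  have h1 := hasDerivAt_integral_Ioi (hs.exp_smul_integrableOn hk)
    (ContinuousOn.smul (by fun_prop) hs.continuousOn) hx
  have h2 : HasDerivAt (fun x : ℝ => Complex.exp (-(2 * Complex.I * k * x)))
      (Complex.exp (-(2 * Complex.I * k * x)) * -(2 * Complex.I * k * 1)) x :=
    ((Complex.ofRealCLM.hasDerivAt.const_mul (2 * Complex.I * k)).neg).cexp
  have h3 := (h2.smul h1).neg
  have h4 : tailSolDeriv k s = fun x : ℝ => -(Complex.exp (-(2 * Complex.I * k * x)) •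
        ∫ t in Ioi x, Complex.exp (2 * Complex.I * k * t) • s t) := funext (tailSolDeriv_eq k)
  rw [h4]
  refine h3.congr_deriv ?_
  have hcancel : Complex.exp (-(2 * Complex.I * k * x)) * Complex.exp (2 * Complex.I * k * x) = 1 := by
    rw [← Complex.exp_add, neg_add_cancel, Complex.exp_zero]
  rw [smul_neg, smul_smul, hcancel]
  module

theorem hasDerivAt_tailSol {k : ℂ} (hk : 0 ≤ k.im) {x : ℝ} (hx : 0 < x) :
    HasDerivAt (tailSol k s) (tailSolDeriv k s x) x := by
  have hs1 := hasDerivAt_integral_Ioi hs.source_integrableOn hs.continuousOn hx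
  rcases eq_or_ne k 0 with rfl | hk0
  · have h1 := hasDerivAt_integral_Ioi hs.id_smul_integrableOn
      (ContinuousOn.smul (by fun_prop) hs.continuousOn) hx
    have h2 : HasDerivAt (fun x : ℝ => (x : ℂ)) 1 x := Complex.ofRealCLM.hasDerivAt
    have h3 := h1.sub (h2.smul hs1)
    refine (h3.congr_deriv ?_).congr_of_eventuallyEq ?_
    · rw [tailSolDeriv]
      simp
    · filter_upwards [Ioi_mem_nhds hx] with y hy
      exact hs.tailSol_zero (le_of_lt hy)
  · have hk2 : 2 * Complex.I * k ≠ 0 := by simp [hk0]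
    have h3 := (((hs.hasDerivAt_tailSolDeriv hk hx).neg.sub hs1).const_smul (2 * Complex.I * k)⁻¹)
    refine (h3.congr_deriv ?_).congr_of_eventuallyEq ?_
    · rw [neg_sub, sub_neg_eq_add, sub_add_cancel, smul_smul, inv_mul_cancel₀ hk2, one_smul]
    · filter_upwards [Ioi_mem_nhds hx] with y hy
      exact tailSol_of_ne hk0 hk hs.source_integrableOn (le_of_lt hy)

omit hs in
/-- Every solution of `g'' + 2ik g' = s`, `k ≠ 0`, with `g → q` and `g' → 0` at infinity is
`q + tailSol k s`. -/
theorem eq_add_tailSol {k : ℂ} (hk0 : k ≠ 0) (hk : 0 ≤ k.im)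
    (hsi : IntegrableOn s (Ioi 0)) {g g' : ℝ → E} {q : E}
    (hg : ∀ x, 0 < x → HasDerivAt g (g' x) x)
    (hg' : ∀ x, 0 < x → HasDerivAt g' (s x - (2 * Complex.I * k) • g' x) x)
    (hq : Tendsto g atTop (𝓝 q)) (hq' : Tendsto g' atTop (𝓝 0)) {x : ℝ} (hx : 0 < x) :
    g x = q + tailSol k s x ∧ g' x = tailSolDeriv k s x := by
  have hk2 : 2 * Complex.I * k ≠ 0 := by simp [hk0]
  have hesi := exp_sub_smul_integrableOn hk hsi hx.le
  have hD : g' x = tailSolDeriv k s x := by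
    have hder : ∀ y, 0 < y → HasDerivAt
        (fun t : ℝ => Complex.exp (2 * Complex.I * k * ((t - x : ℝ) : ℂ)) • g' t)
        (Complex.exp (2 * Complex.I * k * ((y - x : ℝ) : ℂ)) • s y) y := by
      intro y hy
      have h0 : HasDerivAt (fun t : ℝ => ((t - x : ℝ) : ℂ)) 1 y := by
        simpa using ((hasDerivAt_id y).sub_const x).ofReal_comp
      have h1 := ((h0.const_mul (2 * Complex.I * k)).cexp).smul (hg' y hy)
      refine h1.congr_deriv ?_
      rw [smul_sub, smul_smul, mul_one]
      abel
    have h := integral_Ioi_of_hasDerivAt_of_tendsto (a := x) (m := (0 : E))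
      (f := fun t : ℝ => Complex.exp (2 * Complex.I * k * ((t - x : ℝ) : ℂ)) • g' t)
      (hder x hx).continuousAt.continuousWithinAt (fun y hy => hder y (hx.trans hy)) hesi ?_
    · rw [tailSolDeriv, h]
      simp
    · rw [tendsto_zero_iff_norm_tendsto_zero]
      refine squeeze_zero' (Eventually.of_forall fun _ => norm_nonneg _) ?_ (by simpa using hq'.norm)
      filter_upwards [eventually_ge_atTop x] with t ht
      rw [norm_smul]
      exact mul_le_of_le_one_left (norm_nonneg _) (norm_exp_le_one hk (by linarith))
  refine ⟨?_, hD⟩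
  -- `g + g' / (2ik)` has derivative `s / (2ik)`
  have h := integral_Ioi_of_hasDerivAt_of_tendsto (a := x) (m := (2 * Complex.I * k) • q + 0)
      (f := fun t : ℝ => (2 * Complex.I * k) • g t + g' t) (f' := s)
      (((hg x hx).const_smul (2 * Complex.I * k)).add (hg' x hx)).continuousAt.continuousWithinAt
      (fun y hy => ?_) (integrableOn_Ioi_of_nonneg hsi hx.le)
      ((hq.const_smul _).add hq')
  · rw [tailSol_of_ne hk0 hk hsi hx.le, h, ← hD, add_zero]
    rw [show -g' x - ((2 * Complex.I * k) • q - ((2 * Complex.I * k) • g x + g' x))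
      = (2 * Complex.I * k) • (g x - q) by rw [smul_sub]; abel, smul_smul, inv_mul_cancel₀ hk2,
      one_smul]
    abel
  · refine (((hg y (hx.trans hy)).const_smul (2 * Complex.I * k)).add
      (hg' y (hx.trans hy))).congr_deriv ?_
    abel

end FiniteMomentSource

end Source

/-! ### The bounded solution of the Volterra equation -/

section Volterra

variable {R : Type*} [NormedRing R] [NormedAlgebra ℂ R]

/-- `m(x) = e^{-ikx} f(k, x)`, `x ≥ 0`, as the bounded solution of a Volterra equation. -/
structure IsVolterraSol (V : ℝ → R) (k : ℂ) (m : ℝ → R) : Prop where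
  continuousOn : ContinuousOn m (Ici 0)
  bounded : ∃ M, ∀ x, 0 ≤ x → ‖m x‖ ≤ M
  eq : ∀ x, 0 ≤ x → m x = 1 + tailSol k (fun t => V t * m t) x

variable {V : ℝ → R} (hV : FiniteMoment V)

namespace FiniteMoment

include hV

omit [NormedAlgebra ℂ R] in
theorem mul_source {m : ℝ → R} (hc : ContinuousOn m (Ioi 0)) {M : ℝ}
    (hM : ∀ x, 0 < x → ‖m x‖ ≤ M) : FiniteMomentSource fun t => V t * m t := by
  refine ⟨hV.continuousOn.mul hc, ?_⟩
  refine Integrable.mono' (hV.integrableOn.mul_const M)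
    (ContinuousOn.aestronglyMeasurable (ContinuousOn.mul (by fun_prop) (hV.continuousOn.mul hc).norm)
      measurableSet_Ioi) ?_
  filter_upwards [ae_restrict_mem measurableSet_Ioi] with t ht
  have ht' : 0 < t := ht
  rw [Real.norm_of_nonneg (by positivity), mul_assoc]
  refine mul_le_mul_of_nonneg_left ?_ (by linarith)
  exact (norm_mul_le _ _).trans (mul_le_mul_of_nonneg_left (hM t ht') (norm_nonneg _))

variable [CompleteSpace R]

theorem exists_isVolterraSol {k : ℂ} (hk : 0 ≤ k.im) : ∃ m, IsVolterraSol V k m := by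
  set w : ℝ → ℝ := fun x => momentTail V (max x 0) with hw
  have hwc : Continuous w := by
    have := hV.momentTail_continuousOn.comp_continuous (f := fun x : ℝ => max x 0) (by fun_prop)
      (fun x => le_max_right x 0)
    exact this
  have hwpos : ∀ {x : ℝ}, 0 ≤ x → w x = momentTail V x := fun hx => by simp [hw, max_eq_left hx]
  -- the solution is `exp (2 w) u` with a bounded continuous `u`, the fixed point of a contraction
  set src : (BoundedContinuousFunction ℝ R) → ℝ → R := fun u t =>
    V t * (((Real.exp (2 * w t) : ℝ) : ℂ) • u t) with hsrc
  have hexp : ∀ {t : ℝ}, 0 < t → Real.exp (2 * w t) ≤ Real.exp (2 * momentTail V 0) := by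
    intro t ht
    rw [hwpos ht.le]
    have := hV.momentTail_anti le_rfl ht.le
    gcongr
  have hsource : ∀ u, FiniteMomentSource (src u) := by
    intro u
    refine hV.mul_source (M := Real.exp (2 * momentTail V 0) * ‖u‖) ?_ fun t ht => ?_
    · exact Continuous.continuousOn (by fun_prop)
    · rw [norm_smul, Complex.norm_real, Real.norm_of_nonneg (Real.exp_pos _).le]
      exact mul_le_mul (hexp ht) (u.norm_coe_le_norm t) (norm_nonneg _) (Real.exp_pos _).le
  have hbound : ∀ (s : ℝ → R) (D : ℝ), FiniteMomentSource s → 0 ≤ D →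
      (∀ t, 0 < t → ‖s t‖ ≤ ‖V t‖ * (Real.exp (2 * w t) * D)) → ∀ x, 0 ≤ x →
      Real.exp (-(2 * w x)) * ‖tailSol k s x‖ ≤ D / 2 := by
    intro s D hs hD hsD x hx
    have hwe := hV.integral_weight_exp hx
    have h1 : ‖tailSol k s x‖ ≤ (Real.exp (2 * momentTail V x) - 1) / 2 * D := by
      refine (hs.norm_tailSol_le hk hx).trans ?_
      rw [← hwe.2, ← integral_mul_const]
      refine setIntegral_mono_on (integrableOn_Ioi_of_nonneg hs.integrableOn hx)
        (hwe.1.mul_const D) measurableSet_Ioi fun t ht => ?_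
      have ht0 : 0 < t := lt_of_le_of_lt hx ht
      have h2 := mul_le_mul_of_nonneg_left (hsD t ht0) (show 0 ≤ 1 + t by linarith)
      rw [hwpos ht0.le] at h2
      linarith
    rw [hwpos hx, Real.exp_neg, inv_mul_le_iff₀ (Real.exp_pos _)]
    nlinarith [Real.exp_pos (2 * momentTail V x)]
  have hTc : ∀ u, Continuous fun x : ℝ => ((Real.exp (-(2 * w x)) : ℝ) : ℂ) •
      ((1 : R) + tailSol k (src u) (max x 0)) := by
    intro u
    have h1 : Continuous fun x : ℝ => tailSol k (src u) (max x 0) :=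
      ((hsource u).tailSol_continuousOn hk).comp_continuous (by fun_prop) (fun x => le_max_right x 0)
    fun_prop
  have hwmax : ∀ x, w x = w (max x 0) := fun x => by simp [hw]
  have hsrcb : ∀ u t, 0 < t → ‖src u t‖ ≤ ‖V t‖ * (Real.exp (2 * w t) * ‖u‖) := by
    intro u t _
    refine (norm_mul_le _ _).trans (mul_le_mul_of_nonneg_left ?_ (norm_nonneg _))
    rw [norm_smul, Complex.norm_real, Real.norm_of_nonneg (Real.exp_pos _).le]
    exact mul_le_mul_of_nonneg_left (u.norm_coe_le_norm t) (Real.exp_pos _).le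
  let T : (BoundedContinuousFunction ℝ R) → (BoundedContinuousFunction ℝ R) := fun u =>
    BoundedContinuousFunction.ofNormedAddCommGroup _ (hTc u) (‖(1 : R)‖ + ‖u‖ / 2) (by
      intro x
      rw [norm_smul, Complex.norm_real, Real.norm_of_nonneg (Real.exp_pos _).le]
      have h1 := hbound (src u) ‖u‖ (hsource u) (norm_nonneg _) (hsrcb u) (max x 0)
        (le_max_right x 0)
      rw [← hwmax] at h1
      have h2 : Real.exp (-(2 * w x)) ≤ 1 := Real.exp_le_one_iff.2 (by
        have := momentTail_nonneg (V := V) (le_max_right x 0)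
        simp only [hw]; linarith)
      calc _ ≤ Real.exp (-(2 * w x)) * (‖(1 : R)‖ + ‖tailSol k (src u) (max x 0)‖) := by
            gcongr; exact norm_add_le _ _
        _ ≤ _ := by nlinarith [norm_nonneg (1 : R)])
  have hTapp : ∀ u x, T u x = ((Real.exp (-(2 * w x)) : ℝ) : ℂ) •
      ((1 : R) + tailSol k (src u) (max x 0)) := fun u x => rfl
  have hcontr : ContractingWith (1 / 2) T := by
    refine ⟨by norm_num, LipschitzWith.of_dist_le_mul fun u v => ?_⟩
    rw [BoundedContinuousFunction.dist_le (by positivity)]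
    intro x
    rw [dist_eq_norm, hTapp, hTapp, ← smul_sub, add_sub_add_left_eq_sub, norm_smul,
      Complex.norm_real, Real.norm_of_nonneg (Real.exp_pos _).le]
    have hsub : tailSol k (src u) (max x 0) - tailSol k (src v) (max x 0)
        = tailSol k (src (u - v)) (max x 0) := by
      rw [tailSol, tailSol, tailSol, ← integral_sub
        ((hsource u).kern_smul_integrableOn hk (le_max_right x 0))
        ((hsource v).kern_smul_integrableOn hk (le_max_right x 0))]
      refine setIntegral_congr_fun measurableSet_Ioi fun t _ => ?_
      rw [← smul_sub, hsrc]
      simp only [BoundedContinuousFunction.coe_sub, Pi.sub_apply]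
      rw [← mul_sub, ← smul_sub]
    rw [hsub, hwmax]
    have h1 := hbound (src (u - v)) ‖u - v‖ (hsource _) (norm_nonneg _) (hsrcb _) (max x 0)
      (le_max_right x 0)
    rw [dist_eq_norm]
    refine h1.trans_eq ?_
    simp
    ring
  set u := hcontr.fixedPoint T with hu
  have hfix : T u = u := hcontr.fixedPoint_isFixedPt
  refine ⟨fun x => ((Real.exp (2 * w x) : ℝ) : ℂ) • u x, ?_, ⟨Real.exp (2 * momentTail V 0) * ‖u‖, ?_⟩,
    ?_⟩
  · exact Continuous.continuousOn (by fun_prop)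
  · intro x hx
    rw [norm_smul, Complex.norm_real, Real.norm_of_nonneg (Real.exp_pos _).le, hwpos hx]
    have := hV.momentTail_anti le_rfl hx
    have := u.norm_coe_le_norm x
    gcongr
  · intro x hx
    have h1 : u x = T u x := by rw [hfix]
    show ((Real.exp (2 * w x) : ℝ) : ℂ) • u x = 1 + tailSol k (src u) x
    rw [h1, hTapp, smul_smul, ← Complex.ofReal_mul, ← Real.exp_add, add_neg_cancel, Real.exp_zero,
      max_eq_left hx, Complex.ofReal_one, one_smul]

end FiniteMoment

open Classical in
/-- `m(k, x) = e^{-ikx} f(k, x)` for `Im k ≥ 0`, the point `k = 0` included. Only the values on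
`[0, ∞)` are determined. -/
noncomputable def volterraSol (V : ℝ → R) (k : ℂ) : ℝ → R :=
  if h : ∃ m, IsVolterraSol V k m then h.choose else 0

/-- The derivative of `m(k, x)`. -/
noncomputable def volterraSolDeriv (V : ℝ → R) (k : ℂ) : ℝ → R :=
  tailSolDeriv k fun t => V t * volterraSol V k t

namespace FiniteMoment

variable [CompleteSpace R]
include hV

theorem isVolterraSol {k : ℂ} (hk : 0 ≤ k.im) : IsVolterraSol V k (volterraSol V k) := by
  rw [volterraSol, dif_pos (hV.exists_isVolterraSol hk)]
  exact (hV.exists_isVolterraSol hk).choose_spec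

theorem volterraSol_source {k : ℂ} (hk : 0 ≤ k.im) :
    FiniteMomentSource fun t => V t * volterraSol V k t := by
  obtain ⟨M, hM⟩ := (hV.isVolterraSol hk).bounded
  exact hV.mul_source ((hV.isVolterraSol hk).continuousOn.mono Ioi_subset_Ici_self)
    fun x hx => hM x hx.le

omit [CompleteSpace R] in
/-- A bounded `d` with `‖d(x)‖ ≤ Q + ‖tailSol (V d)‖` is bounded by a multiple of `Q` that does not
depend on `k`. -/
theorem norm_le_of_volterra {k : ℂ} (hk : 0 ≤ k.im) {d : ℝ → R} {Q M : ℝ} (hQ : 0 ≤ Q)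
    (hc : ContinuousOn d (Ioi 0)) (hM : ∀ x, 0 < x → ‖d x‖ ≤ M)
    (hd : ∀ x, 0 < x → ‖d x‖ ≤ Q + ‖tailSol k (fun t => V t * d t) x‖) {x : ℝ} (hx : 0 < x) :
    ‖d x‖ ≤ 2 * Q * Real.exp (2 * momentTail V 0) := by
  have h1 := hV.gronwall (u := fun x => ‖d x‖) hQ (fun _ _ => norm_nonneg _) hM (fun y hy => ?_) hx
  · refine h1.trans ?_
    have := hV.momentTail_anti le_rfl hx.le
    gcongr
  · refine (hd y hy).trans (add_le_add le_rfl ?_)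
    have hs := hV.mul_source hc hM
    refine (hs.norm_tailSol_le hk hy.le).trans ?_
    refine integral_mono_of_nonneg ?_ ((integrableOn_Ioi_of_nonneg (hV.integrableOn.mul_const M)
      hy.le).mono' ?_ ?_) ?_
    · filter_upwards [ae_restrict_mem measurableSet_Ioi] with t ht
      have ht0 : 0 < t := hy.trans ht
      positivity
    · exact ((hV.continuousOn_weight.mul hc.norm).mono
        (Ioi_subset_Ioi hy.le)).aestronglyMeasurable measurableSet_Ioi
    · filter_upwards [ae_restrict_mem measurableSet_Ioi] with t ht
      have ht0 : 0 < t := hy.trans ht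
      rw [Real.norm_of_nonneg (by positivity)]
      have := hM t ht0
      gcongr
    · filter_upwards [ae_restrict_mem measurableSet_Ioi] with t ht
      have ht0 : 0 < t := hy.trans ht
      rw [mul_assoc]
      have := norm_mul_le (V t) (d t)
      gcongr

variable (R) in
omit hV [NormedAlgebra ℂ R] [CompleteSpace R] in
theorem bound_nonneg : 0 ≤ 2 * ‖(1 : R)‖ * Real.exp (2 * momentTail V 0) := by positivity

theorem norm_volterraSol_le {k : ℂ} (hk : 0 ≤ k.im) {x : ℝ} (hx : 0 ≤ x) :
    ‖volterraSol V k x‖ ≤ 2 * ‖(1 : R)‖ * Real.exp (2 * momentTail V 0) := by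
  have hm := hV.isVolterraSol hk
  obtain ⟨M, hM⟩ := hm.bounded
  have h1 : ∀ y, 0 < y → ‖volterraSol V k y‖ ≤ 2 * ‖(1 : R)‖ * Real.exp (2 * momentTail V 0) := by
    intro y hy
    refine hV.norm_le_of_volterra hk (norm_nonneg _) (hm.continuousOn.mono Ioi_subset_Ici_self)
      (fun x hx => hM x hx.le) (fun x hx => ?_) hy
    conv_lhs => rw [hm.eq x hx.le]
    exact norm_add_le _ _
  rcases hx.eq_or_lt with rfl | hx
  · have h2 : Tendsto (volterraSol V k) (𝓝[>] 0) (𝓝 (volterraSol V k 0)) :=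
      (hm.continuousOn 0 self_mem_Ici).mono_left (nhdsWithin_mono _ Ioi_subset_Ici_self)
    refine le_of_tendsto h2.norm ?_
    filter_upwards [self_mem_nhdsWithin] with y hy
    exact h1 y hy
  · exact h1 x hx

theorem integral_norm_source_le {k : ℂ} (hk : 0 ≤ k.im) {x : ℝ} (hx : 0 ≤ x) :
    ∫ t in Ioi x, ‖V t * volterraSol V k t‖
      ≤ 2 * ‖(1 : R)‖ * Real.exp (2 * momentTail V 0) * (momentTail V x / (1 + x)) := by
  refine le_trans ?_ (mul_le_mul_of_nonneg_left (hV.integral_norm_le hx) (bound_nonneg R))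
  rw [← integral_const_mul]
  refine setIntegral_mono_on
    (integrableOn_Ioi_of_nonneg (hV.volterraSol_source hk).source_integrableOn hx).norm
    ((integrableOn_Ioi_of_nonneg hV.norm_integrableOn hx).const_mul _) measurableSet_Ioi
    fun t ht => ?_
  rw [mul_comm _ ‖V t‖]
  exact (norm_mul_le _ _).trans (mul_le_mul_of_nonneg_left
    (hV.norm_volterraSol_le hk (hx.trans (le_of_lt ht))) (norm_nonneg _))

theorem norm_volterraSolDeriv_le {k : ℂ} (hk : 0 ≤ k.im) {x : ℝ} (hx : 0 ≤ x) :
    ‖volterraSolDeriv V k x‖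
      ≤ 2 * ‖(1 : R)‖ * Real.exp (2 * momentTail V 0) * (momentTail V x / (1 + x)) :=
  (norm_tailSolDeriv_le hk (hV.volterraSol_source hk).source_integrableOn hx).trans
    (hV.integral_norm_source_le hk hx)

theorem norm_volterraSol_sub_one_le {k : ℂ} (hk : 0 ≤ k.im) {x : ℝ} (hx : 0 ≤ x) :
    ‖volterraSol V k x - 1‖ ≤ 2 * ‖(1 : R)‖ * Real.exp (2 * momentTail V 0) * momentTail V x := by
  rw [(hV.isVolterraSol hk).eq x hx, add_sub_cancel_left]
  refine ((hV.volterraSol_source hk).norm_tailSol_le hk hx).trans ?_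
  rw [show momentTail V x = ∫ t in Ioi x, (1 + t) * ‖V t‖ from rfl, ← integral_const_mul]
  refine setIntegral_mono_on
    (integrableOn_Ioi_of_nonneg (hV.volterraSol_source hk).integrableOn hx)
    ((integrableOn_Ioi_of_nonneg hV.integrableOn hx).const_mul _) measurableSet_Ioi
    fun t ht => ?_
  have ht0 : 0 < t := lt_of_le_of_lt hx ht
  have h1 := (norm_mul_le (V t) (volterraSol V k t)).trans (mul_le_mul_of_nonneg_left
    (hV.norm_volterraSol_le hk ht0.le) (norm_nonneg _))
  have h2 := mul_le_mul_of_nonneg_left h1 (show 0 ≤ 1 + t by linarith)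
  refine h2.trans_eq ?_
  ring

theorem norm_volterraSol_sub_one_le_inv {k : ℂ} (hk0 : k ≠ 0) (hk : 0 ≤ k.im) {x : ℝ} (hx : 0 ≤ x) :
    ‖volterraSol V k x - 1‖ ≤ ‖k‖⁻¹ *
      (2 * ‖(1 : R)‖ * Real.exp (2 * momentTail V 0) * (momentTail V x / (1 + x))) := by
  rw [(hV.isVolterraSol hk).eq x hx, add_sub_cancel_left]
  exact (norm_tailSol_le_inv hk0 hk (hV.volterraSol_source hk).source_integrableOn hx).trans
    (mul_le_mul_of_nonneg_left (hV.integral_norm_source_le hk hx) (by positivity))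

theorem hasDerivAt_volterraSol {k : ℂ} (hk : 0 ≤ k.im) {x : ℝ} (hx : 0 < x) :
    HasDerivAt (volterraSol V k) (volterraSolDeriv V k x) x := by
  refine (((hV.volterraSol_source hk).hasDerivAt_tailSol hk hx).const_add 1).congr_of_eventuallyEq ?_
  filter_upwards [Ioi_mem_nhds hx] with y hy
  exact (hV.isVolterraSol hk).eq y (le_of_lt hy)

theorem hasDerivAt_volterraSolDeriv {k : ℂ} (hk : 0 ≤ k.im) {x : ℝ} (hx : 0 < x) :
    HasDerivAt (volterraSolDeriv V k)
      (V x * volterraSol V k x - (2 * Complex.I * k) • volterraSolDeriv V k x) x :=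
  (hV.volterraSol_source hk).hasDerivAt_tailSolDeriv hk hx

theorem volterraSolDeriv_continuousOn {k : ℂ} (hk : 0 ≤ k.im) :
    ContinuousOn (volterraSolDeriv V k) (Ici 0) :=
  (hV.volterraSol_source hk).tailSolDeriv_continuousOn hk

theorem volterraSol_tendsto {k : ℂ} (hk : 0 ≤ k.im) :
    Tendsto (volterraSol V k) atTop (𝓝 1) := by
  rw [tendsto_iff_norm_sub_tendsto_zero]
  have h1 := (momentTail_tendsto (V := V)).const_mul
    (2 * ‖(1 : R)‖ * Real.exp (2 * momentTail V 0))
  rw [mul_zero] at h1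
  refine squeeze_zero' (Eventually.of_forall fun _ => norm_nonneg _) ?_ h1
  filter_upwards [eventually_ge_atTop 0] with x hx
  exact hV.norm_volterraSol_sub_one_le hk hx

theorem volterraSolDeriv_tendsto {k : ℂ} (hk : 0 ≤ k.im) :
    Tendsto (volterraSolDeriv V k) atTop (𝓝 0) := by
  rw [tendsto_zero_iff_norm_tendsto_zero]
  have h1 := (momentTail_tendsto (V := V)).const_mul
    (2 * ‖(1 : R)‖ * Real.exp (2 * momentTail V 0))
  rw [mul_zero] at h1
  refine squeeze_zero' (Eventually.of_forall fun _ => norm_nonneg _) ?_ h1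
  filter_upwards [eventually_ge_atTop 0] with x hx
  refine (hV.norm_volterraSolDeriv_le hk hx).trans ?_
  refine mul_le_mul_of_nonneg_left ?_ (bound_nonneg R)
  exact div_le_self (momentTail_nonneg hx) (by linarith)

omit [NormedAlgebra ℂ R] [CompleteSpace R] hV in
theorem momentTail_div_isLittleO :
    (fun x : ℝ => momentTail V x / (1 + x)) =o[atTop] fun x : ℝ => 1 / x := by
  have h1 : (fun x : ℝ => momentTail V x * (1 + x)⁻¹) =o[atTop] fun x : ℝ => (1 : ℝ) * (1 / x) := by
    refine IsLittleO.mul_isBigO ((isLittleO_one_iff ℝ).2 momentTail_tendsto) ?_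
    refine IsBigO.of_bound 1 ?_
    filter_upwards [eventually_gt_atTop 0] with x hx
    rw [Real.norm_of_nonneg (by positivity), Real.norm_of_nonneg (by positivity), one_mul, one_div]
    gcongr
    linarith
  simpa [div_eq_mul_inv] using h1

theorem volterraSol_sub_one_isLittleO {k : ℂ} (hk0 : k ≠ 0) (hk : 0 ≤ k.im) :
    (fun x => volterraSol V k x - 1) =o[atTop] fun x : ℝ => 1 / x := by
  refine IsBigO.trans_isLittleO (IsBigO.of_bound
    (‖k‖⁻¹ * (2 * ‖(1 : R)‖ * Real.exp (2 * momentTail V 0))) ?_)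
    (momentTail_div_isLittleO (V := V))
  filter_upwards [eventually_ge_atTop 0] with x hx
  rw [Real.norm_of_nonneg (div_nonneg (momentTail_nonneg hx) (by linarith)), mul_assoc]
  exact hV.norm_volterraSol_sub_one_le_inv hk0 hk hx

theorem volterraSolDeriv_isLittleO {k : ℂ} (hk : 0 ≤ k.im) :
    volterraSolDeriv V k =o[atTop] fun x : ℝ => 1 / x := by
  refine IsBigO.trans_isLittleO (IsBigO.of_bound
    (2 * ‖(1 : R)‖ * Real.exp (2 * momentTail V 0)) ?_)
    (momentTail_div_isLittleO (V := V))
  filter_upwards [eventually_ge_atTop 0] with x hx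
  rw [Real.norm_of_nonneg (div_nonneg (momentTail_nonneg hx) (by linarith))]
  exact hV.norm_volterraSolDeriv_le hk hx

/-- Uniqueness for the differential equation of `m`. -/
theorem eq_volterraSol {k : ℂ} (hk0 : k ≠ 0) (hk : 0 ≤ k.im) {g g' : ℝ → R}
    (hgc : ContinuousOn g (Ici 0)) (hg : ∀ x, 0 < x → HasDerivAt g (g' x) x)
    (hg' : ∀ x, 0 < x → HasDerivAt g' (V x * g x - (2 * Complex.I * k) • g' x) x)
    (hq : Tendsto g atTop (𝓝 1)) (hq' : Tendsto g' atTop (𝓝 0)) {x : ℝ} (hx : 0 < x) :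
    g x = volterraSol V k x ∧ g' x = volterraSolDeriv V k x := by
  have hm := hV.isVolterraSol hk
  obtain ⟨M, hM⟩ : ∃ M, ∀ x, 0 < x → ‖g x‖ ≤ M := by
    obtain ⟨X, hX⟩ := (hq.norm.eventually_le_const (lt_add_one ‖(1 : R)‖)).exists_forall_of_atTop
    obtain ⟨C, hC⟩ := (isCompact_Icc (a := (0 : ℝ)) (b := X)).exists_bound_of_continuousOn
      (hgc.mono Icc_subset_Ici_self)
    refine ⟨max C (‖(1 : R)‖ + 1), fun y hy => ?_⟩
    rcases le_total y X with h | h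
    · exact (hC y ⟨hy.le, h⟩).trans (le_max_left _ _)
    · exact (hX y h).trans (le_max_right _ _)
  have hs := hV.mul_source (hgc.mono Ioi_subset_Ici_self) hM
  have hgeq : ∀ y, 0 < y → g y = 1 + tailSol k (fun t => V t * g t) y := fun y hy =>
    (FiniteMomentSource.eq_add_tailSol hk0 hk hs.source_integrableOn hg hg' hq hq' hy).1
  obtain ⟨M', hM'⟩ := hm.bounded
  have hmain : ∀ y, 0 < y → g y = volterraSol V k y := by
    intro y hy
    have h1 := hV.norm_le_of_volterra (d := fun x => g x - volterraSol V k x) (Q := 0) (M := M + M')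
      hk le_rfl ((hgc.sub hm.continuousOn).mono Ioi_subset_Ici_self)
      (fun x hx => (norm_sub_le _ _).trans (add_le_add (hM x hx) (hM' x hx.le)))
      (fun x hx => by
        rw [zero_add]
        refine le_of_eq (congrArg _ ?_)
        rw [hgeq x hx, hm.eq x hx.le, add_sub_add_left_eq_sub, tailSol, tailSol, tailSol,
          ← integral_sub (hs.kern_smul_integrableOn hk hx.le)
            ((hV.volterraSol_source hk).kern_smul_integrableOn hk hx.le)]
        refine setIntegral_congr_fun measurableSet_Ioi fun t _ => ?_
        rw [← smul_sub, ← mul_sub]) hy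
    rw [mul_zero, zero_mul] at h1
    exact sub_eq_zero.1 (norm_le_zero_iff.1 h1)
  refine ⟨hmain x hx, ?_⟩
  rw [(FiniteMomentSource.eq_add_tailSol hk0 hk hs.source_integrableOn hg hg' hq hq' hx).2,
    volterraSolDeriv, tailSolDeriv, tailSolDeriv]
  congr 1
  refine setIntegral_congr_fun measurableSet_Ioi fun t ht => ?_
  rw [hmain t (hx.trans ht)]

end FiniteMoment

end Volterra

/-! ### Functions on `[0, ∞)` up to the endpoint -/

section OneSided

variable {E : Type*} [NormedAddCommGroup E] [NormedSpace ℝ E]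

/-- A derivative on `(0, ∞)` that is continuous up to `0` is the one-sided derivative at `0`. -/
theorem hasDerivWithinAt_Ici_zero {f f' : ℝ → E} (hf : ContinuousOn f (Ici 0))
    (hf' : ContinuousOn f' (Ici 0)) (h : ∀ x, 0 < x → HasDerivAt f (f' x) x) {x : ℝ} (hx : 0 ≤ x) :
    HasDerivWithinAt f (f' x) (Ici 0) x := by
  rcases hx.eq_or_lt with rfl | hx
  · refine hasDerivWithinAt_Ici_of_tendsto_deriv (s := Ioi 0)
      (fun y hy => (h y hy).differentiableAt.differentiableWithinAt)
      ((hf 0 self_mem_Ici).mono Ioi_subset_Ici_self) self_mem_nhdsWithin ?_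
    have h1 : Tendsto f' (𝓝[>] 0) (𝓝 (f' 0)) :=
      (hf' 0 self_mem_Ici).mono_left (nhdsWithin_mono _ Ioi_subset_Ici_self)
    refine h1.congr' ?_
    filter_upwards [self_mem_nhdsWithin] with y hy
    exact (h y hy).deriv.symm
  · exact (h x hx).hasDerivWithinAt

theorem derivWithin_Ici_zero {f f' : ℝ → E} (hf : ContinuousOn f (Ici 0))
    (hf' : ContinuousOn f' (Ici 0)) (h : ∀ x, 0 < x → HasDerivAt f (f' x) x) {x : ℝ} (hx : 0 ≤ x) :
    derivWithin f (Ici 0) x = f' x :=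
  (hasDerivWithinAt_Ici_zero hf hf' h hx).derivWithin (uniqueDiffOn_Ici 0 x hx)

theorem contDiffOn_Ici_zero {f f' : ℝ → E} (hf : ContinuousOn f (Ici 0))
    (hf' : ContinuousOn f' (Ici 0)) (h : ∀ x, 0 < x → HasDerivAt f (f' x) x) :
    ContDiffOn ℝ 1 f (Ici 0) := by
  rw [contDiffOn_one_iff_derivWithin (uniqueDiffOn_Ici 0)]
  exact ⟨fun x hx => (hasDerivWithinAt_Ici_zero hf hf' h hx).differentiableWithinAt,
    hf'.congr fun x hx => derivWithin_Ici_zero hf hf' h hx⟩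

omit [NormedSpace ℝ E] in
theorem eq_at_zero_of_eqOn {f g : ℝ → E} (hf : ContinuousOn f (Ici 0)) (hg : ContinuousOn g (Ici 0))
    (h : ∀ x, 0 < x → f x = g x) : f 0 = g 0 := by
  have h1 : Tendsto f (𝓝[>] 0) (𝓝 (f 0)) :=
    (hf 0 self_mem_Ici).mono_left (nhdsWithin_mono _ Ioi_subset_Ici_self)
  have h2 : Tendsto g (𝓝[>] 0) (𝓝 (g 0)) :=
    (hg 0 self_mem_Ici).mono_left (nhdsWithin_mono _ Ioi_subset_Ici_self)
  refine tendsto_nhds_unique h1 (h2.congr' ?_)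
  filter_upwards [self_mem_nhdsWithin] with x hx
  exact (h x hx).symm

end OneSided

/-! ### The Jost solution and the Jost matrix -/

theorem hasDerivAt_cexp_mul (c : ℂ) (x : ℝ) :
    HasDerivAt (fun x : ℝ => Complex.exp (c * x)) (Complex.exp (c * x) * c) x := by
  have := ((Complex.ofRealCLM.hasDerivAt (x := x)).const_mul c).cexp
  simpa using this

section Jost

variable {R : Type*} [NormedRing R] [NormedAlgebra ℂ R]

/-- The function `e^{ikx} m(k, x)`, which is the Jost solution. -/
noncomputable def expSol (V : ℝ → R) (k : ℂ) (x : ℝ) : R :=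
  Complex.exp (Complex.I * k * x) • volterraSol V k x

/-- The derivative of `expSol`. -/
noncomputable def expSolDeriv (V : ℝ → R) (k : ℂ) (x : ℝ) : R :=
  Complex.exp (Complex.I * k * x) • ((Complex.I * k) • volterraSol V k x + volterraSolDeriv V k x)

theorem exp_smul_expSol (V : ℝ → R) (k : ℂ) (x : ℝ) :
    Complex.exp (-(Complex.I * k * x)) • expSol V k x = volterraSol V k x := by
  rw [expSol, smul_smul, ← Complex.exp_add, neg_add_cancel, Complex.exp_zero, one_smul]

theorem exp_smul_expSolDeriv (V : ℝ → R) (k : ℂ) (x : ℝ) :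
    Complex.exp (-(Complex.I * k * x)) • expSolDeriv V k x
      = (Complex.I * k) • volterraSol V k x + volterraSolDeriv V k x := by
  rw [expSolDeriv, smul_smul, ← Complex.exp_add, neg_add_cancel, Complex.exp_zero, one_smul]

theorem sq_eq_neg_I_mul_sq (k : ℂ) : k ^ 2 = -((Complex.I * k) * (Complex.I * k)) := by
  linear_combination k ^ 2 * Complex.I_mul_I

variable [CompleteSpace R] {V : ℝ → R} (hV : FiniteMoment V)

namespace FiniteMoment
include hV

theorem expSol_continuousOn {k : ℂ} (hk : 0 ≤ k.im) : ContinuousOn (expSol V k) (Ici 0) :=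
  ContinuousOn.smul (Continuous.continuousOn (by fun_prop)) (hV.isVolterraSol hk).continuousOn

theorem expSolDeriv_continuousOn {k : ℂ} (hk : 0 ≤ k.im) : ContinuousOn (expSolDeriv V k) (Ici 0) :=
  ContinuousOn.smul (Continuous.continuousOn (by fun_prop))
    (((hV.isVolterraSol hk).continuousOn.const_smul _).add (hV.volterraSolDeriv_continuousOn hk))

theorem hasDerivAt_expSol {k : ℂ} (hk : 0 ≤ k.im) {x : ℝ} (hx : 0 < x) :
    HasDerivAt (expSol V k) (expSolDeriv V k x) x := by
  refine ((hasDerivAt_cexp_mul (Complex.I * k) x).smul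
    (hV.hasDerivAt_volterraSol hk hx)).congr_deriv ?_
  simp only [expSolDeriv]
  module

theorem hasDerivAt_expSolDeriv {k : ℂ} (hk : 0 ≤ k.im) {x : ℝ} (hx : 0 < x) :
    HasDerivAt (expSolDeriv V k) (V x * expSol V k x - k ^ 2 • expSol V k x) x := by
  have h1 := (hasDerivAt_cexp_mul (Complex.I * k) x).smul
    (((hV.hasDerivAt_volterraSol hk hx).const_smul (Complex.I * k)).add
      (hV.hasDerivAt_volterraSolDeriv hk hx))
  refine h1.congr_deriv ?_
  simp only [expSol, mul_smul_comm, Pi.add_apply, Pi.smul_apply]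
  rw [sq_eq_neg_I_mul_sq]
  module

theorem expSol_asymptotics {k : ℂ} (hk0 : k ≠ 0) (hk : 0 ≤ k.im) :
    (fun x : ℝ => Complex.exp (-(Complex.I * k * x)) • expSol V k x - 1)
      =o[atTop] fun x : ℝ => 1 / x := by
  simp only [exp_smul_expSol]
  exact hV.volterraSol_sub_one_isLittleO hk0 hk

theorem expSolDeriv_asymptotics {k : ℂ} (hk0 : k ≠ 0) (hk : 0 ≤ k.im) :
    (fun x : ℝ => Complex.exp (-(Complex.I * k * x)) • expSolDeriv V k x - (Complex.I * k) • (1 : R))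
      =o[atTop] fun x : ℝ => 1 / x := by
  simp only [exp_smul_expSolDeriv]
  have h1 := ((hV.volterraSol_sub_one_isLittleO hk0 hk).const_smul_left (Complex.I * k)).add
    (hV.volterraSolDeriv_isLittleO hk)
  refine h1.congr_left fun x => ?_
  simp only [Pi.smul_apply, smul_sub]
  abel

/-- A solution of the Schrödinger equation with the asymptotics of the Jost solution is
`e^{ikx} m(k, x)` on `[0, ∞)`. -/
theorem eq_expSol {k : ℂ} (hk0 : k ≠ 0) (hk : 0 ≤ k.im) {f f' : ℝ → R}
    (hfc : ContinuousOn f (Ici 0)) (hfd : ∀ x, 0 < x → HasDerivAt f (f' x) x)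
    (hfd' : ∀ x, 0 < x → HasDerivAt f' (V x * f x - k ^ 2 • f x) x)
    (has : (fun x : ℝ => Complex.exp (-(Complex.I * k * x)) • f x - 1) =o[atTop] fun x : ℝ => 1 / x)
    (has' : (fun x : ℝ => Complex.exp (-(Complex.I * k * x)) • f' x - (Complex.I * k) • (1 : R))
      =o[atTop] fun x : ℝ => 1 / x) {x : ℝ} (hx : 0 ≤ x) : f x = expSol V k x := by
  set g : ℝ → R := fun x => Complex.exp (-(Complex.I * k) * x) • f x with hg
  set g' : ℝ → R := fun x => Complex.exp (-(Complex.I * k) * x) • (f' x - (Complex.I * k) • f x)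
    with hg'
  have hgc : ContinuousOn g (Ici 0) :=
    ContinuousOn.smul (Continuous.continuousOn (by fun_prop)) hfc
  have hzero : Tendsto (fun x : ℝ => 1 / x) atTop (𝓝 0) := by
    simpa using tendsto_inv_atTop_zero (𝕜 := ℝ)
  have hq0 : Tendsto (fun x => g x - 1) atTop (𝓝 0) := by
    refine (has.trans_tendsto hzero).congr fun x => ?_
    simp only [hg, neg_mul]
  have hq : Tendsto g atTop (𝓝 1) := by simpa using hq0.add_const 1
  have hq' : Tendsto g' atTop (𝓝 0) := by
    have h1 := (has'.trans_tendsto hzero).sub (hq0.const_smul (Complex.I * k))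
    rw [smul_zero, sub_zero] at h1
    refine h1.congr fun x => ?_
    simp only [hg, hg', neg_mul]
    module
  have hmain : ∀ x, 0 < x → g x = volterraSol V k x := fun x hx =>
    (hV.eq_volterraSol hk0 hk hgc (g' := g') (fun y hy => by
      refine ((hasDerivAt_cexp_mul (-(Complex.I * k)) y).smul (hfd y hy)).congr_deriv ?_
      simp only [hg']
      module) (fun y hy => by
      refine ((hasDerivAt_cexp_mul (-(Complex.I * k)) y).smul
        ((hfd' y hy).sub ((hfd y hy).const_smul (Complex.I * k)))).congr_deriv ?_
      simp only [hg, hg', mul_smul_comm, Pi.sub_apply, Pi.smul_apply]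
      rw [sq_eq_neg_I_mul_sq]
      module) hq hq' hx).1
  have hfg : ∀ x, f x = Complex.exp (Complex.I * k * x) • g x := by
    intro x
    rw [hg]
    simp only
    rw [smul_smul, ← Complex.exp_add, neg_mul, add_neg_cancel, Complex.exp_zero, one_smul]
  rw [hfg, expSol]
  rcases hx.eq_or_lt with rfl | hx
  · rw [eq_at_zero_of_eqOn hgc (hV.isVolterraSol hk).continuousOn hmain]
  · rw [hmain x hx]

end FiniteMoment

end Jost

section JostMatrix

variable {n : ℕ} {V : ℝ → Mat n} (hV : FiniteMoment V)

namespace FiniteMoment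
include hV

theorem isJostSolution {k : ℂ} (hk0 : k ≠ 0) (hk : 0 ≤ k.im) :
    IsJostSolution V k (expSol V k) := by
  have hd : ∀ x, 0 < x → deriv (expSol V k) x = expSolDeriv V k x := fun x hx =>
    (hV.hasDerivAt_expSol hk hx).deriv
  refine ⟨contDiffOn_Ici_zero (hV.expSol_continuousOn hk) (hV.expSolDeriv_continuousOn hk)
    fun x hx => hV.hasDerivAt_expSol hk hx, fun x hx => ?_, hV.expSol_asymptotics hk0 hk, ?_⟩
  · refine (hV.hasDerivAt_expSolDeriv hk hx).congr_of_eventuallyEq ?_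
    filter_upwards [Ioi_mem_nhds hx] with y hy
    exact hd y hy
  · refine (hV.expSolDeriv_asymptotics hk0 hk).congr' ?_ EventuallyEq.rfl
    filter_upwards [eventually_gt_atTop 0] with x hx
    rw [hd x hx]

/-- Every Jost solution is `e^{ikx} m(k, x)` on `[0, ∞)`. -/
theorem eq_of_isJostSolution {k : ℂ} (hk0 : k ≠ 0) (hk : 0 ≤ k.im) {f : ℝ → Mat n}
    (hf : IsJostSolution V k f) {x : ℝ} (hx : 0 ≤ x) : f x = expSol V k x :=
  hV.eq_expSol hk0 hk hf.contDiffOn.continuousOn (fun x hx =>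
    ((hf.contDiffOn.differentiableOn one_ne_zero x hx.le).differentiableAt
      (Ici_mem_nhds hx)).hasDerivAt) hf.equation hf.asymptotics hf.asymptotics_deriv hx

theorem jost_eq {k : ℂ} (hk0 : k ≠ 0) (hk : 0 ≤ k.im) {x : ℝ} (hx : 0 ≤ x) :
    jost V k x = expSol V k x := by
  have hex : ∃ f, IsJostSolution V k f := ⟨_, hV.isJostSolution hk0 hk⟩
  rw [jost, dif_pos hex]
  exact hV.eq_of_isJostSolution hk0 hk hex.choose_spec hx

theorem jost_zero {k : ℂ} (hk0 : k ≠ 0) (hk : 0 ≤ k.im) : jost V k 0 = volterraSol V k 0 := by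
  rw [hV.jost_eq hk0 hk le_rfl]
  simp [expSol]

theorem derivWithin_jost_zero {k : ℂ} (hk0 : k ≠ 0) (hk : 0 ≤ k.im) :
    derivWithin (jost V k) (Ici (0 : ℝ)) 0
      = (Complex.I * k) • volterraSol V k 0 + volterraSolDeriv V k 0 := by
  have heq : EqOn (jost V k) (expSol V k) (Ici (0 : ℝ)) := fun x hx => hV.jost_eq hk0 hk hx
  rw [derivWithin_congr heq (heq self_mem_Ici),
    derivWithin_Ici_zero (hV.expSol_continuousOn hk) (hV.expSolDeriv_continuousOn hk)
      (fun x hx => hV.hasDerivAt_expSol hk hx) le_rfl]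
  simp [expSolDeriv]

/-- The Jost matrix in terms of `m(-k*, 0)` and `m'(-k*, 0)`. -/
theorem jostMatrix_eq (A B : Mat n) {k : ℂ} (hk0 : k ≠ 0) (hk : 0 ≤ k.im) :
    jostMatrix V A B k = (volterraSol V (-(starRingEnd ℂ k)) 0)ᴴ * B
      - ((Complex.I * k) • (volterraSol V (-(starRingEnd ℂ k)) 0)ᴴ
        + (volterraSolDeriv V (-(starRingEnd ℂ k)) 0)ᴴ) * A := by
  have h0 : -(starRingEnd ℂ k) ≠ 0 := by simpa using hk0
  have h1 : 0 ≤ (-(starRingEnd ℂ k)).im := by simpa using hk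
  rw [jostMatrix, hV.jost_zero h0 h1, hV.derivWithin_jost_zero h0 h1, Matrix.conjTranspose_add,
    Matrix.conjTranspose_smul]
  congr 4
  simp

end FiniteMoment

end JostMatrix

/-! ### Continuity in real `k` -/

section Continuity

variable {R : Type*} [NormedRing R] [NormedAlgebra ℂ R] [CompleteSpace R]
variable {V : ℝ → R} (hV : FiniteMoment V)

namespace FiniteMoment
include hV

/-- `m(k, x)` is continuous in `k ∈ ℝ`, the point `k = 0` included, uniformly in `x`. -/
theorem exists_volterraSol_sub_le (k₀ : ℝ) : ∃ q : ℝ → ℝ, Tendsto q (𝓝 k₀) (𝓝 0) ∧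
    ∀ k : ℝ, ∀ x, 0 ≤ x → ‖volterraSol V k x - volterraSol V k₀ x‖ ≤ q k := by
  have him : ∀ k : ℝ, 0 ≤ (k : ℂ).im := fun k => by simp
  set K := 2 * ‖(1 : R)‖ * Real.exp (2 * momentTail V 0)
  set w : ℝ → ℝ → ℝ := fun k t => min (2 * |k - k₀| * t ^ 2) (2 * (1 + t)) * (‖V t‖ * K) with hw
  have hw0 : ∀ k t, 0 < t → 0 ≤ w k t := by
    intro k t ht
    have := bound_nonneg R (V := V)
    have : 0 ≤ min (2 * |k - k₀| * t ^ 2) (2 * (1 + t)) := le_min (by positivity) (by positivity)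
    positivity
  have hwle : ∀ k t, 0 < t → w k t ≤ 2 * K * ((1 + t) * ‖V t‖) := by
    intro k t ht
    have := bound_nonneg R (V := V)
    have h1 : min (2 * |k - k₀| * t ^ 2) (2 * (1 + t)) ≤ 2 * (1 + t) := min_le_right _ _
    calc w k t ≤ 2 * (1 + t) * (‖V t‖ * K) := mul_le_mul_of_nonneg_right h1 (by positivity)
      _ = _ := by ring
  have hwm : ∀ k, AEStronglyMeasurable (w k) (volume.restrict (Ioi 0)) := fun k =>
    ContinuousOn.aestronglyMeasurable (ContinuousOn.mul (Continuous.continuousOn (by fun_prop))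
      (hV.continuousOn.norm.mul continuousOn_const)) measurableSet_Ioi
  have hwi : ∀ k, IntegrableOn (w k) (Ioi 0) := by
    intro k
    refine Integrable.mono' (hV.integrableOn.const_mul (2 * K)) (hwm k) ?_
    filter_upwards [ae_restrict_mem measurableSet_Ioi] with t ht
    rw [Real.norm_of_nonneg (hw0 k t ht)]
    exact hwle k t ht
  have hlim : Tendsto (fun k => ∫ t in Ioi 0, w k t) (𝓝 k₀) (𝓝 0) := by
    have h1 := tendsto_integral_filter_of_dominated_convergence (l := 𝓝 k₀)
      (μ := volume.restrict (Ioi (0 : ℝ))) (F := w) (f := fun _ => (0 : ℝ))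
      (fun t => 2 * K * ((1 + t) * ‖V t‖)) (Eventually.of_forall hwm)
      (Eventually.of_forall fun k => by
        filter_upwards [ae_restrict_mem measurableSet_Ioi] with t ht
        rw [Real.norm_of_nonneg (hw0 k t ht)]
        exact hwle k t ht) (hV.integrableOn.const_mul (2 * K)) (by
        filter_upwards [ae_restrict_mem measurableSet_Ioi] with t ht
        have ht' : (0 : ℝ) < t := ht
        have hc : Continuous fun k => w k t := by
          simp only [hw]
          fun_prop
        have h2 := hc.tendsto k₀
        have h3 : w k₀ t = 0 := by
          simp only [hw, sub_self, abs_zero, mul_zero, zero_mul]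
          rw [min_eq_left (by positivity), zero_mul]
        rwa [h3] at h2)
    simpa using h1
  refine ⟨fun k => 2 * (∫ t in Ioi 0, w k t) * Real.exp (2 * momentTail V 0), ?_, ?_⟩
  · simpa using (hlim.const_mul 2).mul_const (Real.exp (2 * momentTail V 0))
  intro k
  have hm := hV.isVolterraSol (him k)
  have hm₀ := hV.isVolterraSol (him k₀)
  have hpos : ∀ x, 0 < x → ‖volterraSol V k x - volterraSol V k₀ x‖
      ≤ 2 * (∫ t in Ioi 0, w k t) * Real.exp (2 * momentTail V 0) := by
    intro x hx
    refine hV.norm_le_of_volterra (him k) (M := K + K)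
      (d := fun x => volterraSol V k x - volterraSol V k₀ x)
      (setIntegral_nonneg measurableSet_Ioi fun t ht => hw0 k t ht)
      ((hm.continuousOn.sub hm₀.continuousOn).mono Ioi_subset_Ici_self)
      (fun x hx => (norm_sub_le _ _).trans (add_le_add (hV.norm_volterraSol_le (him k) hx.le)
        (hV.norm_volterraSol_le (him k₀) hx.le))) (fun y hy => ?_) hx
    have hi := (hV.volterraSol_source (him k)).kern_smul_integrableOn (him k) hy.le
    have hi₀ := (hV.volterraSol_source (him k₀)).kern_smul_integrableOn (him k₀) hy.le
    have hi₁ := (hV.volterraSol_source (him k₀)).kern_smul_integrableOn (him k) hy.le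
    have h1 : volterraSol V k y - volterraSol V k₀ y
        = (∫ t in Ioi y, (kern k (t - y) - kern k₀ (t - y)) • (V t * volterraSol V k₀ t))
          + tailSol k (fun t => V t * (volterraSol V k t - volterraSol V k₀ t)) y := by
      rw [hm.eq y hy.le, hm₀.eq y hy.le, add_sub_add_left_eq_sub, tailSol, tailSol, tailSol]
      simp only [mul_sub, sub_smul, smul_sub]
      rw [integral_sub hi₁ hi₀, integral_sub hi hi₁]
      abel
    rw [h1]
    refine (norm_add_le _ _).trans (add_le_add ?_ le_rfl)
    refine (norm_integral_le_of_norm_le (g := w k) (integrableOn_Ioi_of_nonneg (hwi k) hy.le) ?_).trans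
      (setIntegral_mono_set (hwi k) ?_ (Ioi_subset_Ioi hy.le).eventuallyLE)
    · filter_upwards [ae_restrict_mem measurableSet_Ioi] with t ht
      have ht' : y < t := ht
      rw [norm_smul]
      refine mul_le_mul ?_ ?_ (norm_nonneg _) (le_min (by positivity) (by linarith))
      · refine le_min ?_ ?_
        · refine (norm_kern_sub_le k k₀ (by linarith)).trans ?_
          have : (t - y) ^ 2 ≤ t ^ 2 := by nlinarith
          gcongr
        · refine (norm_sub_le _ _).trans ?_
          have h2 := norm_kern_le (him k) (s := t - y) (by linarith)
          have h3 := norm_kern_le (him k₀) (s := t - y) (by linarith)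
          linarith
      · exact (norm_mul_le _ _).trans (mul_le_mul_of_nonneg_left
          (hV.norm_volterraSol_le (him k₀) (by linarith)) (norm_nonneg _))
    · filter_upwards [ae_restrict_mem measurableSet_Ioi] with t ht
      exact hw0 k t ht
  intro x hx
  rcases hx.eq_or_lt with rfl | hx
  · have h2 : Tendsto (fun x => volterraSol V k x - volterraSol V k₀ x) (𝓝[>] 0)
        (𝓝 (volterraSol V k 0 - volterraSol V k₀ 0)) :=
      ((hm.continuousOn.sub hm₀.continuousOn) 0 self_mem_Ici).mono_left
        (nhdsWithin_mono _ Ioi_subset_Ici_self)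
    refine le_of_tendsto h2.norm ?_
    filter_upwards [self_mem_nhdsWithin] with y hy
    exact hpos y hy
  · exact hpos x hx

theorem continuous_volterraSol {x : ℝ} (hx : 0 ≤ x) : Continuous fun k : ℝ => volterraSol V k x := by
  rw [continuous_iff_continuousAt]
  intro k₀
  obtain ⟨q, hq, hqle⟩ := hV.exists_volterraSol_sub_le k₀
  rw [ContinuousAt, tendsto_iff_norm_sub_tendsto_zero]
  exact squeeze_zero (fun _ => norm_nonneg _) (fun k => hqle k x hx) hq

theorem continuous_volterraSolDeriv {x : ℝ} (hx : 0 ≤ x) :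
    Continuous fun k : ℝ => volterraSolDeriv V k x := by
  have him : ∀ k : ℝ, 0 ≤ (k : ℂ).im := fun k => by simp
  simp only [volterraSolDeriv, tailSolDeriv]
  refine Continuous.neg ?_
  refine continuous_of_dominated (bound := fun t => ‖V t‖ *
    (2 * ‖(1 : R)‖ * Real.exp (2 * momentTail V 0))) (fun k => ?_) (fun k => ?_) ?_ ?_
  · exact (FiniteMomentSource.exp_sub_smul_integrableOn (him k)
      (hV.volterraSol_source (him k)).source_integrableOn hx).aestronglyMeasurable
  · filter_upwards [ae_restrict_mem measurableSet_Ioi] with t ht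
    have ht' : x < t := ht
    rw [norm_smul]
    refine (mul_le_of_le_one_left (norm_nonneg _) (norm_exp_le_one (him k) (by linarith))).trans ?_
    exact (norm_mul_le _ _).trans (mul_le_mul_of_nonneg_left
      (hV.norm_volterraSol_le (him k) (by linarith)) (norm_nonneg _))
  · exact (integrableOn_Ioi_of_nonneg hV.norm_integrableOn hx).mul_const _
  · filter_upwards [ae_restrict_mem measurableSet_Ioi] with t ht
    have ht' : x < t := ht
    have := hV.continuous_volterraSol (show 0 ≤ t by linarith)
    fun_prop

end FiniteMoment

end Continuity

/-! ### Symbols on the half-line -/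

section Symbol

variable {R : Type*} [NormedRing R] [NormedAlgebra ℂ R]

/-- Smooth functions on `(0, ∞)` whose `j`-th derivative is `O((1 + x)^(-α - j))` for all `j`. -/
structure IsSymbol (α : ℝ) (g : ℝ → R) : Prop where
  contDiffOn : ContDiffOn ℝ ∞ g (Ioi 0)
  bound : ∀ j : ℕ, ∃ C : ℝ, ∀ x : ℝ, 0 < x → ‖iteratedDeriv j g x‖ ≤ C * (1 + x) ^ (-α - (j : ℝ))

namespace IsSymbol

variable {α β : ℝ} {g h : ℝ → R}

theorem mono (hg : IsSymbol α g) (hβ : β ≤ α) : IsSymbol β g := by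
  refine ⟨hg.contDiffOn, fun j => ?_⟩
  obtain ⟨C, hC⟩ := hg.bound j
  refine ⟨C, fun x hx => (hC x hx).trans ?_⟩
  have hC0 : 0 ≤ C := by
    have h1 := (norm_nonneg _).trans (hC x hx)
    exact nonneg_of_mul_nonneg_left h1 (Real.rpow_pos_of_pos (by linarith) _)
  refine mul_le_mul_of_nonneg_left ?_ hC0
  exact Real.rpow_le_rpow_of_exponent_le (by linarith) (by linarith)

theorem congr (hg : IsSymbol α g) (h1 : ∀ x, 0 < x → h x = g x) : IsSymbol α h := by
  refine ⟨hg.contDiffOn.congr h1, fun j => ?_⟩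
  obtain ⟨C, hC⟩ := hg.bound j
  refine ⟨C, fun x hx => ?_⟩
  have h2 : h =ᶠ[𝓝 x] g := by
    filter_upwards [Ioi_mem_nhds hx] with y hy using h1 y hy
  rw [h2.iteratedDeriv_eq j]
  exact hC x hx

theorem const (c : R) : IsSymbol 0 fun _ : ℝ => c := by
  refine ⟨contDiffOn_const, fun j => ⟨‖c‖, fun x hx => ?_⟩⟩
  rw [iteratedDeriv_const]
  split_ifs with hj
  · simp [hj]
  · rw [norm_zero]
    have : 0 < 1 + x := by linarith
    positivity

theorem zero (α : ℝ) : IsSymbol α fun _ : ℝ => (0 : R) := by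
  refine ⟨contDiffOn_const, fun j => ⟨0, fun x hx => ?_⟩⟩
  rw [iteratedDeriv_const]
  split_ifs <;> simp

theorem deriv (hg : IsSymbol α g) : IsSymbol (α + 1) (deriv g) := by
  refine ⟨hg.contDiffOn.deriv_of_isOpen isOpen_Ioi (by simp), fun j => ?_⟩
  obtain ⟨C, hC⟩ := hg.bound (j + 1)
  refine ⟨C, fun x hx => ?_⟩
  rw [← iteratedDeriv_succ']
  refine (hC x hx).trans_eq ?_
  congr 2
  push_cast
  ring

theorem sub (hg : IsSymbol α g) (hh : IsSymbol α h) : IsSymbol α fun x => g x - h x := by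
  refine ⟨hg.contDiffOn.sub hh.contDiffOn, fun j => ?_⟩
  obtain ⟨C, hC⟩ := hg.bound j
  obtain ⟨D, hD⟩ := hh.bound j
  refine ⟨C + D, fun x hx => ?_⟩
  rw [iteratedDeriv_fun_sub
    ((hg.contDiffOn.contDiffAt (Ioi_mem_nhds hx)).of_le (by exact_mod_cast le_top))
    ((hh.contDiffOn.contDiffAt (Ioi_mem_nhds hx)).of_le (by exact_mod_cast le_top)), add_mul]
  exact (norm_sub_le _ _).trans (add_le_add (hC x hx) (hD x hx))

theorem neg (hg : IsSymbol α g) : IsSymbol α fun x => -g x := by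
  simpa using (zero α).sub hg

theorem mul (hg : IsSymbol α g) (hh : IsSymbol β h) : IsSymbol (α + β) fun x => g x * h x := by
  refine ⟨hg.contDiffOn.mul hh.contDiffOn, fun j => ?_⟩
  choose C hC using hg.bound
  choose D hD using hh.bound
  refine ⟨∑ i ∈ Finset.range (j + 1), (j.choose i : ℝ) * C i * D (j - i), fun x hx => ?_⟩
  have hnorm : ∀ (i : ℕ) (u : ℝ → R), ‖iteratedFDerivWithin ℝ i u (Ioi 0) x‖ = ‖iteratedDeriv i u x‖ := by
    intro i u
    rw [norm_iteratedFDerivWithin_eq_norm_iteratedDerivWithin,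
      iteratedDerivWithin_of_isOpen isOpen_Ioi hx]
  have h1 := norm_iteratedFDerivWithin_mul_le (𝕜 := ℝ) (N := ∞) hg.contDiffOn hh.contDiffOn
    (uniqueDiffOn_Ioi 0) (mem_Ioi.2 hx) (n := j) (by exact_mod_cast le_top)
  simp only [hnorm] at h1
  refine h1.trans ?_
  rw [Finset.sum_mul]
  refine Finset.sum_le_sum fun i hi => ?_
  have hij : i ≤ j := Nat.lt_succ_iff.1 (Finset.mem_range.1 hi)
  have hx1 : 0 < 1 + x := by linarith
  have hpow : (1 + x) ^ (-(α + β) - (j : ℝ))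
      = (1 + x) ^ (-α - (i : ℝ)) * (1 + x) ^ (-β - ((j - i : ℕ) : ℝ)) := by
    rw [← Real.rpow_add hx1, Nat.cast_sub hij]
    congr 1
    ring
  rw [hpow]
  have h2 := mul_le_mul (hC i x hx) (hD (j - i) x hx) (norm_nonneg _)
    ((norm_nonneg _).trans (hC i x hx))
  calc _ = (j.choose i : ℝ) * (‖iteratedDeriv i g x‖ * ‖iteratedDeriv (j - i) h x‖) := by ring
    _ ≤ (j.choose i : ℝ) * _ := mul_le_mul_of_nonneg_left h2 (Nat.cast_nonneg _)
    _ = _ := by ring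

theorem exists_norm_le (hg : IsSymbol α g) : ∃ C, ∀ x, 0 < x → ‖g x‖ ≤ C * (1 + x) ^ (-α) := by
  obtain ⟨C, hC⟩ := hg.bound 0
  refine ⟨C, fun x hx => ?_⟩
  simpa using hC x hx

theorem exists_norm_le_const (hg : IsSymbol α g) (hα : 0 ≤ α) : ∃ C, ∀ x, 0 < x → ‖g x‖ ≤ C := by
  simpa using (hg.mono hα).exists_norm_le

theorem tendsto_zero (hg : IsSymbol α g) (hα : 0 < α) : Tendsto g atTop (𝓝 0) := by
  obtain ⟨C, hC⟩ := hg.exists_norm_le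
  have h1 : Tendsto (fun x : ℝ => C * (1 + x) ^ (-α)) atTop (𝓝 (C * 0)) :=
    ((tendsto_rpow_neg_atTop hα).comp (tendsto_atTop_add_const_left _ _ tendsto_id)).const_mul C
  rw [mul_zero] at h1
  rw [tendsto_zero_iff_norm_tendsto_zero]
  refine squeeze_zero' (Eventually.of_forall fun _ => norm_nonneg _) ?_ h1
  filter_upwards [eventually_gt_atTop 0] with x hx using hC x hx

theorem hasDerivAt (hg : IsSymbol α g) {x : ℝ} (hx : 0 < x) : HasDerivAt g (_root_.deriv g x) x :=
  ((hg.contDiffOn.contDiffAt (Ioi_mem_nhds hx)).differentiableAt (by simp)).hasDerivAt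

omit [NormedRing R] [NormedAlgebra ℂ R] in
theorem integral_rpow_tail (hα : 0 < α) {x : ℝ} (hx : 0 ≤ x) :
    IntegrableOn (fun t : ℝ => (1 + t) ^ (-(α + 1))) (Ioi x) ∧
      ∫ t in Ioi x, (1 + t) ^ (-(α + 1)) = (1 + x) ^ (-α) / α := by
  have hi : IntegrableOn (fun t : ℝ => (1 + t) ^ (-(α + 1))) (Ioi x) := by
    simpa only [add_comm] using
      integrableOn_add_rpow_Ioi_of_lt (a := -(α + 1)) (c := x) (m := 1) (by linarith) (by linarith)
  refine ⟨hi, ?_⟩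
  have hd : ∀ t : ℝ, 0 ≤ t → HasDerivAt (fun t : ℝ => -((1 + t) ^ (-α) / α)) ((1 + t) ^ (-(α + 1))) t := by
    intro t ht
    have h1 := ((((hasDerivAt_id t).const_add 1).rpow_const (p := -α)
      (Or.inl (by simp only [id]; linarith))).div_const α).neg
    refine h1.congr_deriv ?_
    simp only [id]
    rw [show -α - 1 = -(α + 1) by ring]
    field_simp
  have h2 := integral_Ioi_of_hasDerivAt_of_tendsto' (a := x) (m := -(0 / α))
    (fun t ht => hd t (hx.trans ht)) hi
    ((((tendsto_rpow_neg_atTop hα).comp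
      (tendsto_atTop_add_const_left _ _ tendsto_id)).div_const α).neg)
  rw [h2]
  ring

theorem integrableOn (hg : IsSymbol α g) (hα : 1 < α) : IntegrableOn g (Ioi 0) := by
  obtain ⟨C, hC⟩ := hg.exists_norm_le
  have h1 := (integral_rpow_tail (α := α - 1) (by linarith) le_rfl).1.const_mul C
  refine Integrable.mono' h1 (hg.contDiffOn.continuousOn.aestronglyMeasurable measurableSet_Ioi) ?_
  filter_upwards [ae_restrict_mem measurableSet_Ioi] with t ht
  simpa using hC t ht

theorem integral_tail [CompleteSpace R] (hg : IsSymbol (α + 1) g) (hα : 0 < α) :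
    IsSymbol α fun x => ∫ t in Ioi x, g t := by
  have hi := hg.integrableOn (by linarith)
  have hd : ∀ x, 0 < x → HasDerivAt (fun x => ∫ t in Ioi x, g t) (-g x) x := fun x hx =>
    hasDerivAt_integral_Ioi hi hg.contDiffOn.continuousOn hx
  have hdeq : ∀ x, 0 < x → _root_.deriv (fun x => ∫ t in Ioi x, g t) x = -g x := fun x hx =>
    (hd x hx).deriv
  refine ⟨?_, fun j => ?_⟩
  · rw [contDiffOn_infty_iff_deriv_of_isOpen isOpen_Ioi]
    exact ⟨fun x hx => (hd x hx).differentiableAt.differentiableWithinAt,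
      hg.neg.contDiffOn.congr hdeq⟩
  · rcases j with _ | j
    · obtain ⟨C, hC⟩ := hg.exists_norm_le
      refine ⟨C / α, fun x hx => ?_⟩
      have h1 := integral_rpow_tail hα hx.le
      rw [iteratedDeriv_zero, Nat.cast_zero, sub_zero, div_mul_eq_mul_div, mul_div_assoc, ← h1.2,
        ← integral_const_mul]
      refine norm_integral_le_of_norm_le (h1.1.const_mul C) ?_
      filter_upwards [ae_restrict_mem measurableSet_Ioi] with t ht
      exact hC t (hx.trans ht)
    · obtain ⟨C, hC⟩ := (hg.neg.congr hdeq).bound j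
      refine ⟨C, fun x hx => ?_⟩
      rw [iteratedDeriv_succ']
      refine (hC x hx).trans_eq ?_
      congr 2
      push_cast
      ring

/-- A symbol of nonnegative order extends continuously to `[0, ∞)`. -/
theorem exists_continuousOn_extension [CompleteSpace R] (hg : IsSymbol α g) (hα : 0 ≤ α) :
    ∃ G : ℝ → R, ContinuousOn G (Ici 0) ∧ ∀ x, 0 < x → G x = g x := by
  obtain ⟨C, hC⟩ := hg.deriv.exists_norm_le_const (by linarith)
  have hlip : LipschitzOnWith (Real.toNNReal C) g (Ioi 0) :=
    (convex_Ioi (0 : ℝ)).lipschitzOnWith_of_nnnorm_hasDerivWithin_le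
      (fun x hx => (hg.hasDerivAt hx).hasDerivWithinAt) (fun x hx => by
        rw [← NNReal.coe_le_coe, coe_nnnorm]
        exact (hC x hx).trans (Real.le_coe_toNNReal C))
  have hcauchy : Cauchy (map g (𝓝[>] (0 : ℝ))) :=
    Cauchy.map_of_le (cauchy_nhds.mono nhdsWithin_le_nhds) hlip.uniformContinuousOn
      (le_principal_iff.2 self_mem_nhdsWithin)
  obtain ⟨l, hl⟩ := CompleteSpace.complete hcauchy
  refine ⟨Function.update g 0 l, ?_, fun x hx => Function.update_of_ne hx.ne' _ _⟩
  intro x hx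
  rcases (show (0 : ℝ) ≤ x from hx).eq_or_lt with rfl | hx
  · rw [continuousWithinAt_update_same,
      show Ici (0 : ℝ) \ {0} = Ioi 0 by ext y; simp [lt_iff_le_and_ne, eq_comm]]
    exact hl
  · refine ContinuousAt.continuousWithinAt ?_
    exact (continuousAt_update_of_ne hx.ne').2 (hg.hasDerivAt hx).continuousAt

end IsSymbol

end Symbol

/-! ### High-energy expansion of the Jost solution -/

section HighEnergy

variable {R : Type*} [NormedRing R] [NormedAlgebra ℂ R]

/-- The coefficients `b l` of the expansion of `m` in powers of `1/(2ik)`, with their derivatives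
`b' l`. The recursion `b_{l+1} = -b_l' - ∫_x^∞ V b_l` appears as the differential equation
`b_l'' = V b_l - b_{l+1}'`. -/
structure IsJostExpansion (V : ℝ → R) (b b' : ℕ → ℝ → R) : Prop where
  zero : ∀ x, 0 ≤ x → b 0 x = 1
  zero_deriv : ∀ x, 0 ≤ x → b' 0 x = 0
  continuousOn : ∀ l, ContinuousOn (b l) (Ici 0)
  continuousOn_deriv : ∀ l, ContinuousOn (b' l) (Ici 0)
  hasDerivAt : ∀ l x, 0 < x → HasDerivAt (b l) (b' l x) x
  hasDerivAt_deriv : ∀ l x, 0 < x → HasDerivAt (b' l) (V x * b l x - b' (l + 1) x) x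
  bounded : ∀ l, ∃ C, ∀ x, 0 < x → ‖b l x‖ ≤ C
  tendsto : ∀ l, Tendsto (b (l + 1)) atTop (𝓝 0)
  tendsto_deriv : ∀ l, Tendsto (b' l) atTop (𝓝 0)
  integrableOn_deriv : ∀ l, IntegrableOn (b' l) (Ioi 0)

variable [CompleteSpace R] {V : ℝ → R}

/-- The remainder `m - ∑_{l ≤ N} b_l t^l`, `t = 1/(2ik)`, solves the equation of `m` with the small
source `t^N b_{N+1}'`, so the Volterra equation bounds it by its leading omitted order. -/
theorem FiniteMoment.exists_remainder_le (hV : FiniteMoment V) {b b' : ℕ → ℝ → R}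
    (hb : IsJostExpansion V b b') (N : ℕ) : ∃ C, ∀ k : ℂ, 0 ≤ k.im → 1 ≤ ‖k‖ →
      ‖volterraSol V k 0 - ∑ l ∈ Finset.range (N + 1), ((2 * Complex.I * k)⁻¹) ^ l • b l 0‖
        ≤ C * ‖(2 * Complex.I * k)⁻¹‖ ^ (N + 1) ∧
      ‖volterraSolDeriv V k 0 - ∑ l ∈ Finset.range (N + 1), ((2 * Complex.I * k)⁻¹) ^ l • b' l 0‖
        ≤ C * ‖(2 * Complex.I * k)⁻¹‖ ^ N := by
  set I₁ := ∫ t in Ioi (0 : ℝ), ‖b' (N + 1) t‖ with hI₁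
  set IV := ∫ t in Ioi (0 : ℝ), ‖V t‖ with hIV
  set W := Real.exp (2 * momentTail V 0) with hW
  have hI₁0 : 0 ≤ I₁ := integral_nonneg fun _ => norm_nonneg _
  have hIV0 : 0 ≤ IV := integral_nonneg fun _ => norm_nonneg _
  have hW0 : 0 < W := Real.exp_pos _
  refine ⟨4 * I₁ * W + (I₁ + IV * (4 * I₁ * W)), fun k hk hk1 => ?_⟩
  have hk0 : k ≠ 0 := by rintro rfl; simp at hk1; linarith
  set t := (2 * Complex.I * k)⁻¹ with ht
  have ht2 : 2 * Complex.I * k ≠ 0 := by simp [hk0]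
  have htn : ‖k‖⁻¹ = 2 * ‖t‖ := by
    rw [ht, norm_inv]
    simp
    ring
  have ht1 : ‖t‖ ≤ 1 := by
    have : ‖k‖⁻¹ ≤ 1 := inv_le_one_of_one_le₀ hk1
    have := norm_nonneg t
    linarith
  have hm := hV.isVolterraSol hk
  set r : ℝ → R := fun x => volterraSol V k x - ∑ l ∈ Finset.range (N + 1), t ^ l • b l x with hr
  set r' : ℝ → R := fun x => volterraSolDeriv V k x - ∑ l ∈ Finset.range (N + 1), t ^ l • b' l x
    with hr'
  have hrc : ContinuousOn r (Ici 0) := hm.continuousOn.sub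
    (continuousOn_finsetSum _ fun l _ => (hb.continuousOn l).const_smul (t ^ l))
  have hrc' : ContinuousOn r' (Ici 0) := (hV.volterraSolDeriv_continuousOn hk).sub
    (continuousOn_finsetSum _ fun l _ => (hb.continuousOn_deriv l).const_smul (t ^ l))
  obtain ⟨M, hM⟩ : ∃ M, ∀ x, 0 < x → ‖r x‖ ≤ M := by
    obtain ⟨M₀, hM₀⟩ := hm.bounded
    choose C hC using hb.bounded
    refine ⟨M₀ + ∑ l ∈ Finset.range (N + 1), ‖t ^ l‖ * C l, fun x hx => ?_⟩
    refine (norm_sub_le _ _).trans (add_le_add (hM₀ x hx.le) ((norm_sum_le _ _).trans ?_))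
    refine Finset.sum_le_sum fun l _ => ?_
    rw [norm_smul]
    exact mul_le_mul_of_nonneg_left (hC l x hx) (norm_nonneg _)
  have hd : ∀ x, 0 < x → HasDerivAt r (r' x) x := fun x hx =>
    (hV.hasDerivAt_volterraSol hk hx).sub
      (HasDerivAt.fun_sum fun l _ => (hb.hasDerivAt l x hx).const_smul (t ^ l))
  have hd' : ∀ x, 0 < x → HasDerivAt r'
      (V x * r x + t ^ N • b' (N + 1) x - (2 * Complex.I * k) • r' x) x := by
    intro x hx
    refine ((hV.hasDerivAt_volterraSolDeriv hk hx).sub (HasDerivAt.fun_sum fun l _ =>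
      (hb.hasDerivAt_deriv l x hx).const_smul (t ^ l))).congr_deriv ?_
    -- the recursion of the `b l` telescopes
    have htel : ∑ l ∈ Finset.range (N + 1), t ^ l • b' (l + 1) x
        = t ^ N • b' (N + 1) x
          + (2 * Complex.I * k) • ∑ l ∈ Finset.range (N + 1), t ^ l • b' l x := by
      rw [Finset.sum_range_succ, Finset.sum_range_succ' (fun l => t ^ l • b' l x),
        hb.zero_deriv x hx.le, smul_zero, add_zero, add_comm, Finset.smul_sum]
      congr 1
      refine Finset.sum_congr rfl fun l _ => ?_
      rw [smul_smul, pow_succ', ← mul_assoc, ht, mul_inv_cancel₀ ht2, one_mul]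
    simp only [hr, hr', smul_sub, Finset.sum_sub_distrib, mul_sub, Finset.mul_sum, mul_smul_comm]
    rw [htel]
    abel
  have hr0 : Tendsto r atTop (𝓝 0) := by
    have h1 : Tendsto (fun x => ∑ l ∈ Finset.range (N + 1), t ^ l • b l x) atTop (𝓝 1) := by
      simp only [Finset.sum_range_succ' _ N, pow_zero, one_smul]
      have h2 : Tendsto (fun x => ∑ l ∈ Finset.range N, t ^ (l + 1) • b (l + 1) x) atTop (𝓝 0) := by
        have := tendsto_finsetSum (Finset.range N)
          fun l (_ : l ∈ Finset.range N) => (hb.tendsto l).const_smul (t ^ (l + 1))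
        simpa using this
      have h3 : Tendsto (b 0) atTop (𝓝 1) := by
        refine tendsto_const_nhds.congr' ?_
        filter_upwards [eventually_ge_atTop 0] with x hx using (hb.zero x hx).symm
      simpa using h2.add h3
    simpa using (hV.volterraSol_tendsto hk).sub h1
  have hr0' : Tendsto r' atTop (𝓝 0) := by
    have := tendsto_finsetSum (Finset.range (N + 1))
          fun l (_ : l ∈ Finset.range (N + 1)) => (hb.tendsto_deriv l).const_smul (t ^ l)
    simpa using (hV.volterraSolDeriv_tendsto hk).sub this
  have hVr := hV.mul_source (hrc.mono Ioi_subset_Ici_self) hM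
  have hbi : IntegrableOn (fun x => t ^ N • b' (N + 1) x) (Ioi 0) :=
    Integrable.smul (t ^ N) (hb.integrableOn_deriv (N + 1))
  have hsi : IntegrableOn (fun x => V x * r x + t ^ N • b' (N + 1) x) (Ioi 0) :=
    hVr.source_integrableOn.add hbi
  have hsol := fun x (hx : 0 < x) =>
    FiniteMomentSource.eq_add_tailSol hk0 hk hsi hd hd' hr0 hr0' hx
  have hbint : ∀ x, 0 ≤ x → ∫ y in Ioi x, ‖t ^ N • b' (N + 1) y‖ ≤ ‖t‖ ^ N * I₁ := by
    intro x hx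
    simp only [norm_smul, norm_pow]
    rw [integral_const_mul]
    refine mul_le_mul_of_nonneg_left ?_ (by positivity)
    exact setIntegral_mono_set (hb.integrableOn_deriv (N + 1)).norm
      (ae_of_all _ fun _ => norm_nonneg _) (Ioi_subset_Ioi hx).eventuallyLE
  have hQ : 0 ≤ 2 * ‖t‖ * (‖t‖ ^ N * I₁) := by positivity
  have hbound : ∀ x, 0 < x → ‖r x‖ ≤ 4 * I₁ * W * ‖t‖ ^ (N + 1) := by
    intro x hx
    refine (hV.norm_le_of_volterra hk hQ (hrc.mono Ioi_subset_Ici_self) hM (fun y hy => ?_)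
      hx).trans_eq (by ring)
    have hadd : tailSol k (fun x => V x * r x + t ^ N • b' (N + 1) x) y
        = tailSol k (fun x => V x * r x) y + tailSol k (fun x => t ^ N • b' (N + 1) x) y := by
      rw [FiniteMomentSource.tailSol_of_ne_add hk0 hk hVr.source_integrableOn hbi hy.le]
    rw [(hsol y hy).1, zero_add, hadd, add_comm]
    refine (norm_add_le _ _).trans (add_le_add ?_ le_rfl)
    refine (norm_tailSol_le_inv hk0 hk hbi hy.le).trans ?_
    rw [htn]
    exact mul_le_mul_of_nonneg_left (hbint y hy.le) (by positivity)
  have hbound' : ∀ x, 0 < x → ‖r' x‖ ≤ (I₁ + IV * (4 * I₁ * W)) * ‖t‖ ^ N := by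
    intro x hx
    rw [(hsol x hx).2]
    refine (norm_tailSolDeriv_le hk hsi hx.le).trans ?_
    have hint : IntegrableOn (fun y => ‖V y‖ * (4 * I₁ * W * ‖t‖ ^ (N + 1))
        + ‖t ^ N • b' (N + 1) y‖) (Ioi x) :=
      integrableOn_Ioi_of_nonneg ((hV.norm_integrableOn.mul_const _).add hbi.norm) hx.le
    calc ∫ y in Ioi x, ‖V y * r y + t ^ N • b' (N + 1) y‖
        ≤ ∫ y in Ioi x, (‖V y‖ * (4 * I₁ * W * ‖t‖ ^ (N + 1)) + ‖t ^ N • b' (N + 1) y‖) := by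
          refine setIntegral_mono_on (integrableOn_Ioi_of_nonneg hsi hx.le).norm hint
            measurableSet_Ioi fun y hy => ?_
          refine (norm_add_le _ _).trans (add_le_add ((norm_mul_le _ _).trans ?_) le_rfl)
          exact mul_le_mul_of_nonneg_left (hbound y (hx.trans hy)) (norm_nonneg _)
      _ = (∫ y in Ioi x, ‖V y‖) * (4 * I₁ * W * ‖t‖ ^ (N + 1))
          + ∫ y in Ioi x, ‖t ^ N • b' (N + 1) y‖ := by
          rw [integral_add ((integrableOn_Ioi_of_nonneg hV.norm_integrableOn hx.le).mul_const _)
            (integrableOn_Ioi_of_nonneg hbi hx.le).norm, integral_mul_const]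
      _ ≤ IV * (4 * I₁ * W * ‖t‖ ^ N) + ‖t‖ ^ N * I₁ := by
          refine add_le_add ?_ (hbint x hx.le)
          have h1 : ∫ y in Ioi x, ‖V y‖ ≤ IV :=
            setIntegral_mono_set hV.norm_integrableOn (ae_of_all _ fun _ => norm_nonneg _)
              (Ioi_subset_Ioi hx.le).eventuallyLE
          have h2 : ‖t‖ ^ (N + 1) ≤ ‖t‖ ^ N :=
            pow_le_pow_of_le_one (norm_nonneg _) ht1 (Nat.le_succ N)
          have h3 : 0 ≤ 4 * I₁ * W := by positivity
          exact mul_le_mul h1 (mul_le_mul_of_nonneg_left h2 h3) (by positivity) hIV0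
      _ = _ := by ring
  have hlim : ∀ {u : ℝ → R} {c : ℝ}, ContinuousOn u (Ici 0) → (∀ x, 0 < x → ‖u x‖ ≤ c) →
      ‖u 0‖ ≤ c := by
    intro u c hu hc
    have h2 : Tendsto u (𝓝[>] 0) (𝓝 (u 0)) :=
      (hu 0 self_mem_Ici).mono_left (nhdsWithin_mono _ Ioi_subset_Ici_self)
    refine le_of_tendsto h2.norm ?_
    filter_upwards [self_mem_nhdsWithin] with y hy using hc y hy
  have hp1 : 0 ≤ 4 * I₁ * W := by positivity
  have hp2 : 0 ≤ I₁ + IV * (4 * I₁ * W) := by positivity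
  refine ⟨(hlim hrc hbound).trans ?_, (hlim hrc' hbound').trans ?_⟩
  · refine mul_le_mul_of_nonneg_right ?_ (by positivity)
    linarith
  · refine mul_le_mul_of_nonneg_right ?_ (by positivity)
    linarith

end HighEnergy

/-! ### The coefficients `b_l` -/

section Coefficients

variable {n : ℕ} {V : ℝ → Mat n}

theorem SymbolDecay.exists_isSymbol (hdecay : SymbolDecay V) (hsmooth : ContDiffOn ℝ ∞ V (Ioi 0)) :
    ∃ δ : ℝ, 0 < δ ∧ IsSymbol (δ + 1) V := by
  obtain ⟨ρ, h1, -, h2⟩ := hdecay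
  refine ⟨ρ - 1, by linarith, hsmooth, ?_⟩
  simpa using h2

/-- `b_l` is a symbol of order `0` with `b_l' = O((1 + x)^(-1-δ))`, and is `C¹` up to `0`. -/
theorem bCoeff_isSymbol {δ : ℝ} (hδ : 0 < δ) (hs : IsSymbol (δ + 1) V) (hV : FiniteMoment V) (l : ℕ) :
    IsSymbol 0 (bCoeff V l) ∧ IsSymbol (δ + 1) (deriv (bCoeff V l)) ∧
      ContinuousOn (bCoeff V l) (Ici 0) ∧
      ContinuousOn (derivWithin (bCoeff V l) (Ici 0)) (Ici 0) := by
  have hderiv : ∀ {b : ℝ → Mat n}, ContinuousOn b (Ici 0) → IsSymbol 0 b →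
      IsSymbol (δ + 1) (deriv b) → ContinuousOn (derivWithin b (Ici 0)) (Ici 0) := by
    intro b hc hb hb'
    obtain ⟨G, hG, hGeq⟩ := hb'.exists_continuousOn_extension (by linarith)
    refine hG.congr fun x hx => derivWithin_Ici_zero hc hG (fun y hy => ?_) hx
    rw [hGeq y hy]
    exact hb.hasDerivAt hy
  induction l with
  | zero =>
    have h1 : IsSymbol 0 (bCoeff V 0) := IsSymbol.const (1 : Mat n)
    have h2 : IsSymbol (δ + 1) (deriv (bCoeff V 0)) := by
      refine (IsSymbol.zero (δ + 1)).congr fun x _ => ?_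
      exact deriv_const x (1 : Mat n)
    have h3 : ContinuousOn (bCoeff V 0) (Ici 0) := continuousOn_const
    exact ⟨h1, h2, h3, hderiv h3 h1 h2⟩
  | succ l ih =>
    obtain ⟨h1, h2, h3, h4⟩ := ih
    obtain ⟨C, hC⟩ := h1.exists_norm_le_const le_rfl
    have hsrc := hV.mul_source (h3.mono Ioi_subset_Ici_self) hC
    have hint : IsSymbol δ fun x => ∫ y in Ioi x, V y * bCoeff V l y := by
      have := hs.mul h1
      rw [add_zero] at this
      exact this.integral_tail hδ
    have hb : IsSymbol δ (bCoeff V (l + 1)) := by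
      refine ((h2.mono (by linarith : δ ≤ δ + 1)).neg.sub hint).congr fun x hx => ?_
      simp only [bCoeff]
      rw [derivWithin_of_mem_nhds (Ici_mem_nhds hx)]
    have hc : ContinuousOn (bCoeff V (l + 1)) (Ici 0) :=
      h4.neg.sub hsrc.source_integrableOn.continuousOn_Ici_primitive_Ioi
    exact ⟨hb.mono hδ.le, hb.deriv, hc, hderiv hc (hb.mono hδ.le) hb.deriv⟩

theorem isJostExpansion_bCoeff {δ : ℝ} (hδ : 0 < δ) (hs : IsSymbol (δ + 1) V)
    (hV : FiniteMoment V) :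
    IsJostExpansion V (bCoeff V) fun l => derivWithin (bCoeff V l) (Ici 0) := by
  have hb := fun l => bCoeff_isSymbol hδ hs hV l
  have heq : ∀ l x, 0 < x → derivWithin (bCoeff V l) (Ici 0) x
      = deriv (bCoeff V l) x := fun l x hx => derivWithin_of_mem_nhds (Ici_mem_nhds hx)
  have hsym : ∀ l, IsSymbol (δ + 1) (derivWithin (bCoeff V l) (Ici 0)) := fun l =>
    (hb l).2.1.congr (heq l)
  have hmul : ∀ l, IsSymbol (δ + 1) fun x => V x * bCoeff V l x := fun l => by
    simpa using hs.mul (hb l).1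
  refine ⟨fun x _ => rfl, fun x _ => ?_, fun l => (hb l).2.2.1, fun l => (hb l).2.2.2,
    fun l x hx => ?_, fun l x hx => ?_, fun l => (hb l).1.exists_norm_le_const le_rfl,
    fun l => ?_, fun l => (hsym l).tendsto_zero (by linarith),
    fun l => (hsym l).integrableOn (by linarith)⟩
  · exact congrFun (derivWithin_const (Ici 0) (1 : Mat n)) x
  · rw [heq l x hx]
    exact (hb l).1.hasDerivAt hx
  · -- differentiate the recursion `b_{l+1} = -b_l' - ∫ V b_l`
    have h1 := (hsym l).hasDerivAt hx
    refine h1.congr_deriv ?_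
    have h2 := hasDerivAt_integral_Ioi ((hmul l).integrableOn (by linarith))
      (hmul l).contDiffOn.continuousOn hx
    have h3 : HasDerivAt (bCoeff V (l + 1)) _ x := h1.neg.sub h2
    rw [heq (l + 1) x hx, h3.deriv]
    abel
  · have : IsSymbol δ (bCoeff V (l + 1)) :=
      ((hsym l).mono (by linarith : δ ≤ δ + 1)).neg.sub ((hmul l).integral_tail hδ)
    exact this.tendsto_zero hδ

end Coefficients

/-! ### High-energy expansion of the Jost matrix -/

section JostExpansion

variable {n : ℕ} {V : ℝ → Mat n} (A B : Mat n)

/-- The filter `|k| → ∞`, `Im k ≥ 0`. -/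
noncomputable abbrev highEnergy : Filter ℂ := Bornology.cobounded ℂ ⊓ 𝓟 {k : ℂ | 0 ≤ k.im}

theorem tendsto_ofReal_highEnergy_atTop : Tendsto (fun x : ℝ => (x : ℂ)) atTop highEnergy := by
  refine tendsto_inf.2 ⟨?_, tendsto_principal.2 (by simp)⟩
  rw [← tendsto_norm_atTop_iff_cobounded]
  simpa using tendsto_abs_atTop_atTop

theorem tendsto_neg_ofReal_highEnergy_atTop :
    Tendsto (fun x : ℝ => ((-x : ℝ) : ℂ)) atTop highEnergy := by
  refine tendsto_inf.2 ⟨?_, tendsto_principal.2 (by simp)⟩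
  rw [← tendsto_norm_atTop_iff_cobounded]
  simpa using tendsto_abs_atTop_atTop

instance : highEnergy.NeBot := tendsto_ofReal_highEnergy_atTop.neBot

theorem eventually_highEnergy : ∀ᶠ k in highEnergy, 0 ≤ k.im ∧ 1 ≤ ‖k‖ := by
  have h1 : ∀ᶠ k : ℂ in highEnergy, 0 ≤ k.im := mem_inf_of_right (mem_principal_self _)
  have h2 : ∀ᶠ k : ℂ in highEnergy, 1 ≤ ‖k‖ :=
    (tendsto_norm_cobounded_atTop.mono_left inf_le_left).eventually_ge_atTop 1
  exact h1.and h2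

theorem eventually_highEnergy_ne : ∀ᶠ k in highEnergy, k ≠ 0 := by
  filter_upwards [eventually_highEnergy] with k hk h
  rw [h, norm_zero] at hk
  linarith [hk.2]

/-- The expansion variable `t = 1/(2ik)`. -/
noncomputable def invTwoI (k : ℂ) : ℂ := (2 * Complex.I * k)⁻¹

theorem invTwoI_ne {k : ℂ} (hk : k ≠ 0) : invTwoI k ≠ 0 := by simp [invTwoI, hk]

theorem tendsto_invTwoI : Tendsto invTwoI highEnergy (𝓝 0) := by
  have h1 : Tendsto (fun k : ℂ => k⁻¹) highEnergy (𝓝 0) := tendsto_inv₀_cobounded.mono_left inf_le_left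
  have h2 := h1.const_mul (2⁻¹ * Complex.I⁻¹)
  rw [mul_zero] at h2
  refine h2.congr fun k => ?_
  rw [invTwoI, mul_inv, mul_inv]

/-- Collecting powers of `t = 1/(2ik)` in `t J(k) = t m† B - (1/2) m† A - t m'† A`, with `p l`, `p' l`
the coefficients of `m†` and `m'†`. -/
theorem sum_expansion_eq (p p' : ℕ → Mat n) (hp : p 0 = 1) (t : ℂ) (C : ℕ → Mat n)
    (hC0 : C 0 = -((1 / 2 : ℂ) • A))
    (hC : ∀ l, C (l + 1) = p l * B - ((1 / 2 : ℂ) • p (l + 1) + p' l) * A) (N : ℕ) :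
    t • ((∑ l ∈ Finset.range (N + 1), t ^ l • p l) * B)
        - (1 / 2 : ℂ) • ((∑ l ∈ Finset.range (N + 1), t ^ l • p l) * A)
        - t • ((∑ l ∈ Finset.range (N + 1), t ^ l • p' l) * A)
      = ∑ l ∈ Finset.range (N + 1), t ^ l • C l + t ^ (N + 1) • (p N * B - p' N * A) := by
  induction N with
  | zero =>
    simp only [zero_add, Finset.sum_range_one, pow_zero, one_smul, hp, one_mul, hC0, pow_one]
    module
  | succ N ih =>
    rw [Finset.sum_range_succ (fun l => t ^ l • p l), Finset.sum_range_succ (fun l => t ^ l • p' l),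
      Finset.sum_range_succ (fun l => t ^ l • C l), ← sub_eq_zero]
    rw [← sub_eq_zero] at ih
    rw [← ih, hC]
    simp only [add_mul, smul_mul_assoc]
    module

variable {A B}

/-- `J(k) / (2ik)` has the expansion `∑_{l ≥ 0} c_{l-1} / (2ik)^l`. -/
theorem FiniteMoment.jostMatrix_expansion (hV : FiniteMoment V)
    (hb : IsJostExpansion V (bCoeff V) fun l => derivWithin (bCoeff V l) (Ici 0)) (N : ℕ) :
    (fun k => invTwoI k • jostMatrix V A B k
        - ∑ l ∈ Finset.range (N + 1), invTwoI k ^ l • cCoeff V A B ((l : ℤ) - 1))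
      =O[highEnergy] fun k => invTwoI k ^ (N + 1) := by
  obtain ⟨K, hK⟩ := hV.exists_remainder_le hb N
  set D := (bCoeff V N 0)ᴴ * B - (derivWithin (bCoeff V N) (Ici 0) 0)ᴴ * A with hD
  refine IsBigO.of_bound (‖D‖ + K * ‖B‖ + 1 / 2 * (K * ‖A‖) + K * ‖A‖) ?_
  filter_upwards [eventually_highEnergy, tendsto_invTwoI.norm.eventually_le_const
    (by simp : ‖(0 : ℂ)‖ < 1)] with k hk ht1
  have hk0 : k ≠ 0 := by rintro rfl; simp at hk; linarith
  set k' := -(starRingEnd ℂ k) with hk'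
  have him : 0 ≤ k'.im := by simpa [hk'] using hk.1
  have hnk : 1 ≤ ‖k'‖ := by simpa [hk'] using hk.2
  set t := invTwoI k with ht
  have htc : star ((2 * Complex.I * k')⁻¹) = t := by
    simp [ht, invTwoI, hk']
  have htn : ‖(2 * Complex.I * k')⁻¹‖ = ‖t‖ := by rw [← htc, norm_star]
  obtain ⟨h1, h2⟩ := hK k' him hnk
  rw [htn] at h1 h2
  set E₁ := volterraSol V k' 0
    - ∑ l ∈ Finset.range (N + 1), ((2 * Complex.I * k')⁻¹) ^ l • bCoeff V l 0 with hE₁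
  set E₂ := volterraSolDeriv V k' 0 - ∑ l ∈ Finset.range (N + 1),
    ((2 * Complex.I * k')⁻¹) ^ l • derivWithin (bCoeff V l) (Ici 0) 0 with hE₂
  have hm : (volterraSol V k' 0)ᴴ
      = ∑ l ∈ Finset.range (N + 1), t ^ l • (bCoeff V l 0)ᴴ + E₁ᴴ := by
    rw [hE₁, Matrix.conjTranspose_sub, Matrix.conjTranspose_sum]
    simp only [Matrix.conjTranspose_smul, star_pow, htc]
    abel
  have hm' : (volterraSolDeriv V k' 0)ᴴ
      = ∑ l ∈ Finset.range (N + 1), t ^ l • (derivWithin (bCoeff V l) (Ici 0) 0)ᴴ + E₂ᴴ := by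
    rw [hE₂, Matrix.conjTranspose_sub, Matrix.conjTranspose_sum]
    simp only [Matrix.conjTranspose_smul, star_pow, htc]
    abel
  have hsum := sum_expansion_eq A B (fun l => (bCoeff V l 0)ᴴ)
    (fun l => (derivWithin (bCoeff V l) (Ici 0) 0)ᴴ) (by simp [bCoeff]) t
    (fun l => cCoeff V A B ((l : ℤ) - 1)) rfl
    (fun l => by
      have : (((l + 1 : ℕ) : ℤ) - 1) = Int.ofNat l := by simp
      rw [this, cCoeff]) N
  have htk : t * (Complex.I * k) = 1 / 2 := by
    rw [ht, invTwoI]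
    field_simp
  have hJ : t • jostMatrix V A B k
      - ∑ l ∈ Finset.range (N + 1), t ^ l • cCoeff V A B ((l : ℤ) - 1)
      = t ^ (N + 1) • D + t • (E₁ᴴ * B) - (1 / 2 : ℂ) • (E₁ᴴ * A) - t • (E₂ᴴ * A) := by
    set S := ∑ l ∈ Finset.range (N + 1), t ^ l • (bCoeff V l 0)ᴴ
    set S' := ∑ l ∈ Finset.range (N + 1), t ^ l • (derivWithin (bCoeff V l) (Ici 0) 0)ᴴ
    have h3 : t • jostMatrix V A B k
        = t • ((S + E₁ᴴ) * B) - (1 / 2 : ℂ) • ((S + E₁ᴴ) * A) - t • ((S' + E₂ᴴ) * A) := by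
      rw [hV.jostMatrix_eq A B hk0 hk.1, ← hk', hm, hm', smul_sub, add_mul _ _ A, smul_add,
        smul_mul_assoc, smul_smul, htk, sub_add_eq_sub_sub]
    rw [h3, eq_sub_of_add_eq hsum.symm, add_mul, add_mul, add_mul]
    module
  rw [hJ]
  have ht0 : 0 ≤ ‖t‖ := norm_nonneg _
  have hn₁ : ‖E₁ᴴ‖ = ‖E₁‖ := Matrix.l2_opNorm_conjTranspose _
  have hn₂ : ‖E₂ᴴ‖ = ‖E₂‖ := Matrix.l2_opNorm_conjTranspose _
  have e1 : ‖t ^ (N + 1) • D‖ ≤ ‖D‖ * ‖t‖ ^ (N + 1) := by rw [norm_smul, norm_pow, mul_comm]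
  have e2 : ‖t • (E₁ᴴ * B)‖ ≤ K * ‖B‖ * ‖t‖ ^ (N + 1) := by
    rw [norm_smul]
    calc ‖t‖ * ‖E₁ᴴ * B‖ ≤ 1 * (K * ‖t‖ ^ (N + 1) * ‖B‖) := by
          refine mul_le_mul ht1 ((Matrix.l2_opNorm_mul _ _).trans ?_) (norm_nonneg _) zero_le_one
          rw [hn₁]
          exact mul_le_mul_of_nonneg_right h1 (norm_nonneg _)
      _ = _ := by ring
  have e3 : ‖(1 / 2 : ℂ) • (E₁ᴴ * A)‖ ≤ 1 / 2 * (K * ‖A‖) * ‖t‖ ^ (N + 1) := by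
    rw [norm_smul]
    calc ‖(1 / 2 : ℂ)‖ * ‖E₁ᴴ * A‖ ≤ 1 / 2 * (K * ‖t‖ ^ (N + 1) * ‖A‖) := by
          refine mul_le_mul (by simp) ((Matrix.l2_opNorm_mul _ _).trans ?_) (norm_nonneg _)
            (by norm_num)
          rw [hn₁]
          exact mul_le_mul_of_nonneg_right h1 (norm_nonneg _)
      _ = _ := by ring
  have e4 : ‖t • (E₂ᴴ * A)‖ ≤ K * ‖A‖ * ‖t‖ ^ (N + 1) := by
    rw [norm_smul]
    calc ‖t‖ * ‖E₂ᴴ * A‖ ≤ ‖t‖ * (K * ‖t‖ ^ N * ‖A‖) := by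
          refine mul_le_mul_of_nonneg_left ((Matrix.l2_opNorm_mul _ _).trans ?_) ht0
          rw [hn₂]
          exact mul_le_mul_of_nonneg_right h2 (norm_nonneg _)
      _ = _ := by ring
  rw [norm_pow, add_mul, add_mul, add_mul]
  exact (norm_sub_le _ _).trans (add_le_add ((norm_sub_le _ _).trans
    (add_le_add ((norm_add_le _ _).trans (add_le_add e1 e2)) e3)) e4)

theorem FiniteMoment.det_jostMatrix_expansion (hV : FiniteMoment V)
    (hb : IsJostExpansion V (bCoeff V) fun l => derivWithin (bCoeff V l) (Ici 0)) (N : ℕ) :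
    (fun k => invTwoI k ^ n * (jostMatrix V A B k).det - ∑ m ∈ Finset.range (N + 1),
        detCoeff (fun l => cCoeff V A B ((l : ℤ) - 1)) m * invTwoI k ^ m)
      =O[highEnergy] fun k => invTwoI k ^ (N + 1) := by
  have h1 := det_sub_sum_isBigO (fun l => cCoeff V A B ((l : ℤ) - 1)) tendsto_invTwoI
    (M := fun k => invTwoI k • jostMatrix V A B k) N fun i j => ?_
  · simpa [Matrix.det_smul] using h1
  · have h2 := ((Matrix.entryLinearMap ℂ ℂ i j).toContinuousLinearMap.isBigO_comp _ highEnergy).trans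
      (hV.jostMatrix_expansion (A := A) (B := B) hb N)
    simpa [Matrix.sum_apply, mul_comm] using h2

/-! ### The leading constant -/

theorem eq_zero_of_mulVec_eq_zero (hAB : (Aᴴ * A + Bᴴ * B).PosDef) {v : Fin n → ℂ}
    (hv : A *ᵥ v = 0) (hv' : B *ᵥ v = 0) : v = 0 := by
  have h1 : (Aᴴ * A + Bᴴ * B) *ᵥ v = 0 := by
    rw [Matrix.add_mulVec, ← Matrix.mulVec_mulVec, ← Matrix.mulVec_mulVec, hv, hv']
    simp
  by_contra h
  have h2 := hAB.dotProduct_mulVec_pos h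
  rw [h1] at h2
  simp at h2

theorem star_mulVec_dotProduct_eq_zero (hA : -(Bᴴ * A) + Aᴴ * B = 0) {v : Fin n → ℂ}
    (hv : A *ᵥ v = 0) (w : Fin n → ℂ) : star (B *ᵥ v) ⬝ᵥ (A *ᵥ w) = 0 := by
  have h1 : Bᴴ * A = Aᴴ * B := by
    rw [← sub_eq_zero, ← neg_eq_zero, ← hA]; abel
  rw [Matrix.star_mulVec, ← Matrix.dotProduct_mulVec, Matrix.mulVec_mulVec, h1,
    ← Matrix.mulVec_mulVec, Matrix.dotProduct_mulVec, ← Matrix.star_mulVec, hv]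
  simp

/-- `J(k) / (-ik)` tends to `A`, while `J(k) v → B v` for `v ∈ ker A`, so `det J(k)` has the exact order
`k ^ rank A`. The boundary condition makes `B` injective on `ker A`, with values orthogonal to the
range of `A`. -/
theorem FiniteMoment.exists_tendsto_det_div_pow_nonDirichlet (hV : FiniteMoment V)
    (hb : IsJostExpansion V (bCoeff V) fun l => derivWithin (bCoeff V l) (Ici 0))
    (hA : -(Bᴴ * A) + Aᴴ * B = 0) (hAB : (Aᴴ * A + Bᴴ * B).PosDef) :
    ∃ c : ℂ, c ≠ 0 ∧ Tendsto (fun k => (jostMatrix V A B k).det / k ^ nonDirichlet A) highEnergy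
      (𝓝 c) := by
  have hlim : Tendsto (fun k => invTwoI k • jostMatrix V A B k) highEnergy
      (𝓝 (-((1 / 2 : ℂ) • A))) := by
    have h1 := (hV.jostMatrix_expansion (A := A) (B := B) hb 0).trans_tendsto
      (by simpa using tendsto_invTwoI)
    simp only [zero_add, Finset.sum_range_one, pow_zero, one_smul] at h1
    have h2 := h1.add_const (cCoeff V A B ((0 : ℕ) - 1 : ℤ))
    have h3 : cCoeff V A B ((0 : ℕ) - 1 : ℤ) = -((1 / 2 : ℂ) • A) := rfl
    simpa only [sub_add_cancel, zero_add, h3] using h2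
  have hm : Tendsto (fun k => volterraSol V (-(starRingEnd ℂ k)) 0) highEnergy (𝓝 1) := by
    obtain ⟨K, hK⟩ := hV.exists_remainder_le hb 0
    rw [tendsto_iff_norm_sub_tendsto_zero]
    have h1 : Tendsto (fun k => K * ‖invTwoI k‖) highEnergy (𝓝 0) := by
      simpa using tendsto_invTwoI.norm.const_mul K
    refine squeeze_zero' (Eventually.of_forall fun _ => norm_nonneg _) ?_ h1
    filter_upwards [eventually_highEnergy] with k hk
    have h2 := (hK (-(starRingEnd ℂ k)) (by simpa using hk.1) (by simpa using hk.2)).1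
    simpa [bCoeff, invTwoI] using h2
  -- `-2 * invTwoI k = 1 / (-ik)`
  have hε : ∀ᶠ k in highEnergy, -2 * invTwoI k ≠ 0 := by
    filter_upwards [eventually_highEnergy_ne] with k hk
    exact mul_ne_zero (by norm_num) (invTwoI_ne hk)
  have hM : Tendsto (fun k => (-2 * invTwoI k) • jostMatrix V A B k) highEnergy (𝓝 A) := by
    have := hlim.const_smul (-2 : ℂ)
    simpa [smul_smul] using this
  have hker : ∀ v, A *ᵥ v = 0 → Tendsto (fun k => (-2 * invTwoI k)⁻¹ •
      (((-2 * invTwoI k) • jostMatrix V A B k) *ᵥ v)) highEnergy (𝓝 (B *ᵥ v)) := by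
    intro v hv
    have h1 : Tendsto (fun k => (volterraSol V (-(starRingEnd ℂ k)) 0)ᴴ *ᵥ (B *ᵥ v)) highEnergy
        (𝓝 ((1 : Mat n)ᴴ *ᵥ (B *ᵥ v))) := by
      have hcont : Continuous fun X : Mat n => Xᴴ *ᵥ (B *ᵥ v) := by fun_prop
      exact (hcont.tendsto _).comp hm
    rw [Matrix.conjTranspose_one, Matrix.one_mulVec] at h1
    refine h1.congr' ?_
    filter_upwards [eventually_highEnergy_ne, eventually_highEnergy, hε] with k hk hk' hε
    rw [Matrix.smul_mulVec, smul_smul, inv_mul_cancel₀ hε, one_smul,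
      hV.jostMatrix_eq A B hk hk'.1, Matrix.sub_mulVec, ← Matrix.mulVec_mulVec,
      ← Matrix.mulVec_mulVec, hv, Matrix.mulVec_zero, sub_zero]
  obtain ⟨c, hc0, hc⟩ := exists_tendsto_det_div_pow hε hM hker
    (fun v hv hv' => eq_zero_of_mulVec_eq_zero hAB hv hv')
    (fun v w hv => star_mulVec_dotProduct_eq_zero hA hv w)
  refine ⟨c * (-Complex.I) ^ nonDirichlet A, mul_ne_zero hc0 (pow_ne_zero _ (by simp)), ?_⟩
  refine (hc.mul_const _).congr' ?_
  filter_upwards [eventually_highEnergy_ne, hε] with k hk hε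
  have hr : A.rank ≤ n := by simpa using A.rank_le_card_width
  have h1 : (-2 * invTwoI k) ^ n = (-2 * invTwoI k) ^ (n - A.rank) * (-2 * invTwoI k) ^ A.rank := by
    rw [← pow_add, Nat.sub_add_cancel hr]
  have h2 : (-2 * invTwoI k) * (-Complex.I) = k⁻¹ := by
    rw [invTwoI, mul_inv, mul_inv, Complex.inv_I]
    field_simp
    simp
  rw [Matrix.det_smul, Fintype.card_fin, h1, nonDirichlet, mul_assoc, mul_div_cancel_left₀ _
    (pow_ne_zero _ hε), mul_right_comm, ← mul_pow, h2, inv_pow, div_eq_inv_mul]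

theorem FiniteMoment.leadingConst_spec (hV : FiniteMoment V)
    (hb : IsJostExpansion V (bCoeff V) fun l => derivWithin (bCoeff V l) (Ici 0))
    (hA : -(Bᴴ * A) + Aᴴ * B = 0) (hAB : (Aᴴ * A + Bᴴ * B).PosDef) :
    leadingConst V A B ≠ 0 ∧ Tendsto (fun k => (jostMatrix V A B k).det / k ^ nonDirichlet A)
      highEnergy (𝓝 (leadingConst V A B)) := by
  obtain ⟨c, hc0, hc⟩ := hV.exists_tendsto_det_div_pow_nonDirichlet hb hA hAB
  have h1 : leadingConst V A B = c := hc.limUnder_eq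
  rw [h1]
  exact ⟨hc0, hc⟩

/-- The coefficients of the expansion of `h` in powers of `1/(2ik)`. -/
noncomputable def normCoeff (V : ℝ → Mat n) (A B : Mat n) (l : ℕ) : ℂ :=
  (2 * Complex.I) ^ nonDirichlet A / leadingConst V A B * dCoeff V A B ((l : ℤ) - nonDirichlet A)

/-- The expansion of `det J(k) / (2ik)^n` starts at the power `n - r`, since `det J(k) ~ c₂ k^r`. -/
theorem FiniteMoment.normalizedDet_expansion (hV : FiniteMoment V)
    (hb : IsJostExpansion V (bCoeff V) fun l => derivWithin (bCoeff V l) (Ici 0))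
    (hA : -(Bᴴ * A) + Aᴴ * B = 0) (hAB : (Aᴴ * A + Bᴴ * B).PosDef) :
    normCoeff V A B 0 = 1 ∧ ∀ N, (fun k => normalizedDet V A B k
        - ∑ l ∈ Finset.range (N + 1), normCoeff V A B l * invTwoI k ^ l)
      =O[highEnergy] fun k => invTwoI k ^ (N + 1) := by
  obtain ⟨hc0, hc⟩ := hV.leadingConst_spec hb hA hAB
  set c := leadingConst V A B with hcdef
  set r := nonDirichlet A with hr
  have hrn : r ≤ n := by
    have := A.rank_le_card_width
    simpa [hr, nonDirichlet] using this
  have hI : ((2 * Complex.I) ^ r : ℂ) ≠ 0 := pow_ne_zero _ (by simp)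
  have hne : ∀ᶠ k in highEnergy, invTwoI k ≠ 0 := by
    filter_upwards [eventually_highEnergy_ne] with k hk using invTwoI_ne hk
  have hdiv : ∀ k : ℂ, k ≠ 0 → invTwoI k ^ n * (jostMatrix V A B k).det / invTwoI k ^ (n - r)
      = ((2 * Complex.I) ^ r)⁻¹ * ((jostMatrix V A B k).det / k ^ r) := by
    intro k hk
    have h1 : invTwoI k ^ n = invTwoI k ^ (n - r) * invTwoI k ^ r := by
      rw [← pow_add, Nat.sub_add_cancel hrn]
    rw [h1, mul_assoc, mul_div_cancel_left₀ _ (pow_ne_zero _ (invTwoI_ne hk)), invTwoI, inv_pow,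
      mul_pow, mul_inv]
    ring
  have hlim : Tendsto (fun k => invTwoI k ^ n * (jostMatrix V A B k).det / invTwoI k ^ (n - r))
      highEnergy (𝓝 (((2 * Complex.I) ^ r)⁻¹ * c)) := by
    refine (hc.const_mul _).congr' ?_
    filter_upwards [eventually_highEnergy_ne] with k hk using (hdiv k hk).symm
  obtain ⟨h1, h2⟩ := expansion_div_pow tendsto_invTwoI hne
    (fun N => hV.det_jostMatrix_expansion (A := A) (B := B) hb N) hlim
  have hcoeff : ∀ l, normCoeff V A B l = (2 * Complex.I) ^ r / c
      * detCoeff (fun l => cCoeff V A B ((l : ℤ) - 1)) (n - r + l) := by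
    intro l
    rw [normCoeff, ← dCoeff_eq_detCoeff]
    congr 2
    push_cast [Nat.cast_sub hrn]
    ring
  refine ⟨?_, fun N => ?_⟩
  · rw [hcoeff, add_zero, h1]
    field_simp
  · refine ((h2 N).const_mul_left ((2 * Complex.I) ^ r / c)).congr' ?_ EventuallyEq.rfl
    filter_upwards [eventually_highEnergy_ne] with k hk
    rw [mul_sub, Finset.mul_sum, hdiv k hk, normalizedDet, ← hcdef, ← hr]
    congr 1
    · field_simp
    · exact Finset.sum_congr rfl fun l _ => by rw [hcoeff]; ring

/-- The recursion defining `e_l` is the one of the coefficients of a logarithm. -/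
theorem normCoeff_recursion (V : ℝ → Mat n) (A B : Mat n) (h0 : normCoeff V A B 0 = 1) (l : ℕ) :
    ((l : ℂ) + 1) * normCoeff V A B (l + 1)
      = ∑ j ∈ Finset.range (l + 1), ((j : ℂ) + 1) * eCoeff V A B (j + 1) * normCoeff V A B (l - j) := by
  have hl : (l : ℂ) + 1 ≠ 0 := Nat.cast_add_one_ne_zero l
  rw [Finset.sum_range_succ, Nat.sub_self, h0, mul_one, eCoeff, Finset.sum_range, ← sub_eq_iff_eq_add']
  have h1 : ∀ j : Fin l, ((j : ℕ) + 1 : ℂ) * eCoeff V A B (j + 1) * normCoeff V A B (l - j)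
      = (2 * Complex.I) ^ nonDirichlet A / leadingConst V A B * ((((j : ℕ) : ℂ) + 1) *
          dCoeff V A B ((l : ℤ) + 1 - (nonDirichlet A : ℤ) - (((j : ℕ) : ℤ) + 1)) *
            eCoeff V A B ((j : ℕ) + 1)) := by
    intro j
    have h2 : ((l - (j : ℕ) : ℕ) : ℤ) - nonDirichlet A
        = (l : ℤ) + 1 - (nonDirichlet A : ℤ) - (((j : ℕ) : ℤ) + 1) := by
      have := j.2
      push_cast [Nat.cast_sub this.le]
      ring
    rw [normCoeff, h2]
    ring
  simp only [h1]
  rw [← Finset.mul_sum, normCoeff]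
  push_cast
  field_simp

end JostExpansion

/-! ### Wronskians on the real line -/

section Wronskian

variable {n : ℕ} {V : ℝ → Mat n}

/-- The Wronskian `f(k, x)† f'(l, x) - f'(k, x)† f(l, x)` of two Jost solutions at real `k` and `l`. -/
noncomputable def wronskian (V : ℝ → Mat n) (k l x : ℝ) : Mat n :=
  (expSol V k x)ᴴ * expSolDeriv V l x - (expSolDeriv V k x)ᴴ * expSol V l x

theorem ofReal_im_nonneg (k : ℝ) : 0 ≤ (k : ℂ).im := by simp

theorem continuousOn_conjTranspose {f : ℝ → Mat n} {s : Set ℝ} (hf : ContinuousOn f s) :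
    ContinuousOn (fun x => (f x)ᴴ) s := hf.star

theorem hasDerivAt_conjTranspose {f : ℝ → Mat n} {f' : Mat n} {x : ℝ} (hf : HasDerivAt f f' x) :
    HasDerivAt (fun x => (f x)ᴴ) f'ᴴ x := hf.star

namespace FiniteMoment

variable (hV : FiniteMoment V)
include hV

theorem wronskian_continuousOn (k l : ℝ) : ContinuousOn (wronskian V k l) (Ici 0) :=
  ((continuousOn_conjTranspose (hV.expSol_continuousOn (ofReal_im_nonneg k))).mul
    (hV.expSolDeriv_continuousOn (ofReal_im_nonneg l))).sub
  ((continuousOn_conjTranspose (hV.expSolDeriv_continuousOn (ofReal_im_nonneg k))).mul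
    (hV.expSol_continuousOn (ofReal_im_nonneg l)))

theorem hasDerivAt_wronskian (hsa : ∀ x : ℝ, 0 < x → (V x)ᴴ = V x) (k l : ℝ) {x : ℝ} (hx : 0 < x) :
    HasDerivAt (wronskian V k l)
      (((k : ℂ) ^ 2 - (l : ℂ) ^ 2) • ((expSol V k x)ᴴ * expSol V l x)) x := by
  have h1 := hV.hasDerivAt_expSol (ofReal_im_nonneg k) hx
  have h2 := hV.hasDerivAt_expSolDeriv (ofReal_im_nonneg k) hx
  have h3 := hV.hasDerivAt_expSol (ofReal_im_nonneg l) hx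
  have h4 := hV.hasDerivAt_expSolDeriv (ofReal_im_nonneg l) hx
  refine (((hasDerivAt_conjTranspose h1).mul h4).sub
    ((hasDerivAt_conjTranspose h2).mul h3)).congr_deriv ?_
  have hk : star ((k : ℂ) ^ 2) = (k : ℂ) ^ 2 := by simp
  simp only [Matrix.conjTranspose_sub, Matrix.conjTranspose_mul, Matrix.conjTranspose_smul, hsa x hx,
    hk, mul_sub, sub_mul, smul_mul_assoc, mul_smul_comm, sub_smul, mul_assoc]
  abel

omit hV in
theorem wronskian_eq_smul (k l x : ℝ) :
    wronskian V k l x = Complex.exp (Complex.I * ((l - k : ℝ) : ℂ) * x) •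
      ((volterraSol V k x)ᴴ * ((Complex.I * l) • volterraSol V l x + volterraSolDeriv V l x)
        - ((Complex.I * k) • volterraSol V k x + volterraSolDeriv V k x)ᴴ * volterraSol V l x) := by
  have h1 : star (Complex.exp (Complex.I * k * x)) = Complex.exp (-(Complex.I * k * x)) := by
    rw [Complex.star_def, ← Complex.exp_conj]
    simp
  have h2 : Complex.exp (Complex.I * ((l - k : ℝ) : ℂ) * x)
      = Complex.exp (-(Complex.I * k * x)) * Complex.exp (Complex.I * l * x) := by
    rw [← Complex.exp_add]
    congr 1
    push_cast
    ring
  rw [wronskian, expSol, expSol, expSolDeriv, expSolDeriv, Matrix.conjTranspose_smul,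
    Matrix.conjTranspose_smul, h1, h2, smul_sub, smul_mul_smul_comm, smul_mul_smul_comm]

/-- The Wronskian of two solutions of the same energy is its limit at infinity. -/
theorem wronskian_zero_eq (hsa : ∀ x : ℝ, 0 < x → (V x)ᴴ = V x) {k l : ℝ} (h : l = k ∨ l = -k) :
    wronskian V k l 0 = (Complex.I * (k + l)) • (1 : Mat n) := by
  have hsq : (k : ℂ) ^ 2 - (l : ℂ) ^ 2 = 0 := by
    rcases h with rfl | rfl
    · simp
    · push_cast; ring
  have hconst : ∀ x, 0 ≤ x → wronskian V k l x = wronskian V k l 0 := by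
    intro x hx
    refine constant_of_has_deriv_right_zero ((hV.wronskian_continuousOn k l).mono Icc_subset_Ici_self)
      (fun y hy => ?_) x ⟨hx, le_rfl⟩
    refine (hasDerivWithinAt_Ici_zero (f' := fun _ => 0) (hV.wronskian_continuousOn k l)
      continuousOn_const (fun z hz => ?_) hy.1).mono (Ici_subset_Ici.2 hy.1)
    have := hV.hasDerivAt_wronskian hsa k l hz
    rwa [hsq, zero_smul] at this
  have hm := hV.volterraSol_tendsto (ofReal_im_nonneg k)
  have hm' := hV.volterraSolDeriv_tendsto (ofReal_im_nonneg k)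
  have hl := hV.volterraSol_tendsto (ofReal_im_nonneg l)
  have hl' := hV.volterraSolDeriv_tendsto (ofReal_im_nonneg l)
  have hstar : ∀ {f : ℝ → Mat n} {a : Mat n}, Tendsto f atTop (𝓝 a) →
      Tendsto (fun x => (f x)ᴴ) atTop (𝓝 aᴴ) := fun hf => hf.star
  have hlim : Tendsto (fun x => (volterraSol V k x)ᴴ *
        ((Complex.I * l) • volterraSol V l x + volterraSolDeriv V l x)
        - ((Complex.I * k) • volterraSol V k x + volterraSolDeriv V k x)ᴴ * volterraSol V l x) atTop
      (𝓝 ((Complex.I * (k + l)) • (1 : Mat n))) := by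
    have h1 := ((hstar hm).mul ((hl.const_smul (Complex.I * l)).add hl')).sub
      ((hstar ((hm.const_smul (Complex.I * k)).add hm')).mul hl)
    convert h1 using 2
    rw [Matrix.conjTranspose_one, add_zero, add_zero, Matrix.conjTranspose_smul,
      Matrix.conjTranspose_one, one_mul, mul_one]
    have : star (Complex.I * (k : ℂ)) = -(Complex.I * k) := by simp
    rw [this]
    module
  have hW : Tendsto (wronskian V k l) atTop (𝓝 ((Complex.I * (k + l)) • (1 : Mat n))) := by
    rcases h with rfl | rfl
    · refine hlim.congr fun x => ?_
      rw [wronskian_eq_smul]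
      simp
    · rw [Complex.ofReal_neg, add_neg_cancel, mul_zero, zero_smul] at hlim ⊢
      rw [tendsto_zero_iff_norm_tendsto_zero] at hlim ⊢
      refine hlim.congr fun x => ?_
      rw [wronskian_eq_smul, norm_smul, Complex.norm_exp]
      simp
  refine tendsto_nhds_unique (tendsto_const_nhds.congr' ?_) hW
  filter_upwards [eventually_ge_atTop 0] with x hx using (hconst x hx).symm

/-- The zero-energy Wronskian with `f(k, ·)` at `0` is `i k + o(k)`. Its derivative, with the free part
removed, is `k² (m_k† m_0 - 1)`, which is small beyond `|k|^(-1/2)`, and at `|k|^(-1)` the Wronskian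
is close to its free value. -/
theorem wronskian_zero_right_isLittleO (hsa : ∀ x : ℝ, 0 < x → (V x)ᴴ = V x) :
    (fun k : ℝ => wronskian V k 0 0 - (Complex.I * k) • (1 : Mat n)) =o[𝓝[≠] 0] fun k => k := by
  set K := 2 * ‖(1 : Mat n)‖ * Real.exp (2 * momentTail V 0) with hK
  have hK0 : 0 ≤ K := by positivity
  set μ := momentTail V with hμ
  have hμ0 : ∀ x, 0 ≤ x → 0 ≤ μ x := fun x hx => momentTail_nonneg hx
  set C := K * K + K with hC
  have hC0 : 0 ≤ C := by positivity
  set r : ℝ → ℝ → Mat n := fun k x => (volterraSol V k x)ᴴ * volterraSol V ((0 : ℝ) : ℂ) x - 1 with hr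
  have hmsub : ∀ (k : ℝ) {x : ℝ}, 0 ≤ x → ‖volterraSol V k x - 1‖ ≤ K * μ x := fun k x hx =>
    hV.norm_volterraSol_sub_one_le (ofReal_im_nonneg k) hx
  have hmle : ∀ (k : ℝ) {x : ℝ}, 0 ≤ x → ‖volterraSol V k x‖ ≤ K := fun k x hx =>
    hV.norm_volterraSol_le (ofReal_im_nonneg k) hx
  have hmder : ∀ (k : ℝ) {x : ℝ}, 0 ≤ x → ‖volterraSolDeriv V k x‖ ≤ K * (μ x / (1 + x)) :=
    fun k x hx => hV.norm_volterraSolDeriv_le (ofReal_im_nonneg k) hx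
  have hct : ∀ M : Mat n, ‖Mᴴ‖ = ‖M‖ := fun M => Matrix.l2_opNorm_conjTranspose M
  have hrle : ∀ (k : ℝ) {x : ℝ}, 0 ≤ x → ‖r k x‖ ≤ C * μ x := by
    intro k x hx
    have h1 : r k x = (volterraSol V k x - 1)ᴴ * volterraSol V ((0 : ℝ) : ℂ) x
        + (volterraSol V ((0 : ℝ) : ℂ) x - 1) := by
      simp only [hr, Matrix.conjTranspose_sub, Matrix.conjTranspose_one, sub_mul, one_mul]
      abel
    rw [h1]
    refine (norm_add_le _ _).trans ((add_le_add ((Matrix.l2_opNorm_mul _ _).trans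
      (mul_le_mul (by rw [hct]; exact hmsub k hx) (hmle 0 hx) (norm_nonneg _)
        (mul_nonneg hK0 (hμ0 x hx)))) (hmsub 0 hx)).trans_eq ?_)
    rw [hC]
    ring
  set Z : ℝ → ℝ → Mat n := fun k x => wronskian V k 0 x
    - (Complex.I * k * Complex.exp ((-(Complex.I * k)) * x)) • (1 : Mat n) with hZ
  have hexp : ∀ k x : ℝ, ‖Complex.exp ((-(Complex.I * k)) * x)‖ = 1 := by
    intro k x
    rw [Complex.norm_exp]
    simp
  have hZc : ∀ k, ContinuousOn (Z k) (Ici 0) := fun k =>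
    (hV.wronskian_continuousOn k 0).sub (ContinuousOn.smul (f := fun x : ℝ =>
      Complex.I * k * Complex.exp ((-(Complex.I * k)) * x)) (Continuous.continuousOn (by fun_prop))
        continuousOn_const)
  set Z' : ℝ → ℝ → Mat n := fun k x =>
    ((k : ℂ) ^ 2 * Complex.exp ((-(Complex.I * k)) * x)) • r k x with hZ'
  have hZ'c : ∀ k, ContinuousOn (Z' k) (Ici 0) := fun k =>
    ContinuousOn.smul (f := fun x : ℝ => (k : ℂ) ^ 2 * Complex.exp ((-(Complex.I * k)) * x))
      (Continuous.continuousOn (by fun_prop))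
      (((continuousOn_conjTranspose (hV.isVolterraSol (ofReal_im_nonneg k)).continuousOn).mul
        (hV.isVolterraSol (ofReal_im_nonneg 0)).continuousOn).sub continuousOn_const)
  have hZd : ∀ k x, 0 < x → HasDerivAt (Z k) (Z' k x) x := by
    intro k x hx
    have h1 := ((hasDerivAt_cexp_mul (-(Complex.I * k)) x).const_mul (Complex.I * k)).smul_const
      (1 : Mat n)
    refine ((hV.hasDerivAt_wronskian hsa k 0 hx).sub h1).congr_deriv ?_
    have h2 : star (Complex.exp (Complex.I * k * x)) = Complex.exp ((-(Complex.I * k)) * x) := by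
      rw [Complex.star_def, ← Complex.exp_conj]
      simp
    have h3 : (expSol V k x)ᴴ * expSol V ((0 : ℝ) : ℂ) x
        = Complex.exp ((-(Complex.I * k)) * x) • (r k x + 1) := by
      simp only [expSol, hr, sub_add_cancel]
      rw [Matrix.conjTranspose_smul, h2]
      simp
    rw [h3]
    simp only [hZ']
    have h4 : Complex.I * k * (Complex.exp ((-(Complex.I * k)) * x) * -(Complex.I * k))
        = (k : ℂ) ^ 2 * Complex.exp ((-(Complex.I * k)) * x) := by
      linear_combination (-(k : ℂ) ^ 2 * Complex.exp ((-(Complex.I * k)) * x)) * Complex.I_mul_I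
    rw [h4]
    push_cast
    module
  have hstep : ∀ (k a b : ℝ), 0 ≤ a → a ≤ b → ‖Z k b - Z k a‖ ≤ k ^ 2 * (C * μ a) * (b - a) := by
    intro k a b ha hab
    refine norm_image_sub_le_of_norm_deriv_right_le_segment (f' := Z' k)
      ((hZc k).mono fun y hy => ha.trans hy.1) (fun y hy => ?_) (fun y hy => ?_) b ⟨hab, le_rfl⟩
    · have hy0 : 0 ≤ y := ha.trans hy.1
      exact (hasDerivWithinAt_Ici_zero (hZc k) (hZ'c k) (hZd k) hy0).mono (Ici_subset_Ici.2 hy0)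
    · have hy0 : 0 ≤ y := ha.trans hy.1
      simp only [hZ']
      rw [norm_smul, norm_mul, hexp, mul_one, norm_pow, Complex.norm_real, Real.norm_eq_abs, sq_abs]
      refine mul_le_mul_of_nonneg_left ((hrle k hy0).trans ?_) (sq_nonneg k)
      exact mul_le_mul_of_nonneg_left (hV.momentTail_anti ha hy.1) hC0
  have hfar : ∀ (k x : ℝ), 0 ≤ x → ‖Z k x‖ ≤ (2 * (K * K)) * (μ x / (1 + x)) + |k| * (C * μ x) := by
    intro k x hx
    have h1 : Z k x = Complex.exp ((-(Complex.I * k)) * x) •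
        ((volterraSol V k x)ᴴ * volterraSolDeriv V ((0 : ℝ) : ℂ) x
          - (volterraSolDeriv V k x)ᴴ * volterraSol V ((0 : ℝ) : ℂ) x + (Complex.I * k) • r k x) := by
      simp only [hZ]
      rw [wronskian_eq_smul]
      have h2 : star (Complex.I * (k : ℂ)) = -(Complex.I * k) := by simp
      have h3 : Complex.I * ((0 - k : ℝ) : ℂ) * x = (-(Complex.I * k)) * x := by push_cast; ring
      rw [h3, Matrix.conjTranspose_add, Matrix.conjTranspose_smul, h2]
      simp only [hr, Complex.ofReal_zero, mul_zero, zero_smul, zero_add, add_mul, smul_mul_assoc]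
      module
    have hq : 0 ≤ μ x / (1 + x) := div_nonneg (hμ0 x hx) (by linarith)
    rw [h1, norm_smul, hexp, one_mul]
    have h2 : ‖(volterraSol V k x)ᴴ * volterraSolDeriv V ((0 : ℝ) : ℂ) x‖ ≤ K * (K * (μ x / (1 + x))) :=
      (Matrix.l2_opNorm_mul _ _).trans (mul_le_mul (by rw [hct]; exact hmle k hx) (hmder 0 hx)
        (norm_nonneg _) hK0)
    have h3 : ‖(volterraSolDeriv V k x)ᴴ * volterraSol V ((0 : ℝ) : ℂ) x‖ ≤ K * (μ x / (1 + x)) * K :=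
      (Matrix.l2_opNorm_mul _ _).trans (mul_le_mul (by rw [hct]; exact hmder k hx) (hmle 0 hx)
        (norm_nonneg _) (mul_nonneg hK0 hq))
    have h4 : ‖(Complex.I * (k : ℂ)) • r k x‖ ≤ |k| * (C * μ x) := by
      rw [norm_smul, norm_mul, Complex.norm_I, one_mul, Complex.norm_real, Real.norm_eq_abs]
      exact mul_le_mul_of_nonneg_left (hrle k hx) (abs_nonneg k)
    refine (norm_add_le _ _).trans ((add_le_add ((norm_sub_le _ _).trans (add_le_add h2 h3)) h4).trans_eq
      ?_)
    ring
  -- the three contributions: `[0, √X]`, `[√X, X]` and `X`, where `X = 1 / |k|`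
  have hbound : ∀ k : ℝ, k ≠ 0 → |k| < 1 → ‖wronskian V k 0 0 - (Complex.I * k) • (1 : Mat n)‖
      ≤ (C * μ 0 * √|k| + C * μ (√|k|)⁻¹ + (2 * (K * K) + C) * μ (|k|⁻¹)) * |k| := by
    intro k hk hk1
    have hk0 : 0 < |k| := abs_pos.2 hk
    set q := √|k| with hq
    have hq0 : 0 < q := Real.sqrt_pos.2 hk0
    have hqq : |k| = q * q := (Real.mul_self_sqrt hk0.le).symm
    have hq1 : q ≤ 1 := Real.sqrt_le_one.2 hk1.le
    have hle : q⁻¹ ≤ |k|⁻¹ := by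
      rw [hqq]
      exact inv_anti₀ (by positivity) (by nlinarith)
    have h1 := hstep k 0 q⁻¹ le_rfl (by positivity)
    have h2 := hstep k q⁻¹ |k|⁻¹ (by positivity) hle
    have h3 := hfar k |k|⁻¹ (by positivity)
    have hZ0 : wronskian V k 0 0 - (Complex.I * k) • (1 : Mat n) = Z k 0 := by simp [hZ]
    have h4 : k ^ 2 = |k| * |k| := by rw [← sq, sq_abs]
    have e1 : k ^ 2 * (C * μ 0) * (q⁻¹ - 0) = C * μ 0 * q * |k| := by
      rw [h4, hqq]; field_simp; ring
    have e2 : k ^ 2 * (C * μ q⁻¹) * (|k|⁻¹ - q⁻¹) ≤ C * μ q⁻¹ * |k| := by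
      have : 0 ≤ C * μ q⁻¹ := mul_nonneg hC0 (hμ0 _ (by positivity))
      calc k ^ 2 * (C * μ q⁻¹) * (|k|⁻¹ - q⁻¹) ≤ k ^ 2 * (C * μ q⁻¹) * |k|⁻¹ :=
            mul_le_mul_of_nonneg_left (by have := inv_pos.2 hq0; linarith) (by positivity)
        _ = _ := by rw [h4]; field_simp
    have e3 : μ |k|⁻¹ / (1 + |k|⁻¹) ≤ μ |k|⁻¹ * |k| := by
      rw [div_eq_mul_inv]
      refine mul_le_mul_of_nonneg_left ?_ (hμ0 _ (by positivity))
      rw [inv_le_comm₀ (by positivity) hk0]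
      linarith
    have e4 : Z k 0 = Z k |k|⁻¹ - (Z k |k|⁻¹ - Z k q⁻¹) - (Z k q⁻¹ - Z k 0) := by abel
    rw [hZ0, e4]
    have e5 := mul_le_mul_of_nonneg_left e3 (by positivity : 0 ≤ 2 * (K * K))
    refine (norm_sub_le _ _).trans ((add_le_add (norm_sub_le _ _) le_rfl).trans ?_)
    linarith
  have habs : Tendsto (fun k : ℝ => |k|) (𝓝[≠] 0) (𝓝[>] 0) := by
    refine tendsto_nhdsWithin_iff.2 ⟨?_, ?_⟩
    · have := (continuous_abs.tendsto (0 : ℝ)).mono_left (nhdsWithin_le_nhds (s := {0}ᶜ))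
      simpa using this
    · filter_upwards [self_mem_nhdsWithin] with k hk using abs_pos.2 hk
  have hsqrt : Tendsto (fun k : ℝ => √|k|) (𝓝[≠] 0) (𝓝[>] 0) := by
    refine tendsto_nhdsWithin_iff.2 ⟨?_, ?_⟩
    · have := (Real.continuous_sqrt.tendsto 0).comp (tendsto_nhdsWithin_iff.1 habs).1
      simpa [Function.comp_def] using this
    · filter_upwards [self_mem_nhdsWithin] with k hk using Real.sqrt_pos.2 (abs_pos.2 hk)
  have hμt : Tendsto μ atTop (𝓝 0) := momentTail_tendsto
  have hlim : Tendsto (fun k : ℝ => C * μ 0 * √|k| + C * μ (√|k|)⁻¹ + (2 * (K * K) + C) * μ (|k|⁻¹))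
      (𝓝[≠] 0) (𝓝 0) := by
    have h1 := (tendsto_nhdsWithin_iff.1 hsqrt).1.const_mul (C * μ 0)
    have h2 := (hμt.comp (tendsto_inv_nhdsGT_zero.comp hsqrt)).const_mul C
    have h3 := (hμt.comp (tendsto_inv_nhdsGT_zero.comp habs)).const_mul (2 * (K * K) + C)
    simpa using (h1.add h2).add h3
  refine isLittleO_iff.2 fun c hc => ?_
  have hlt : ∀ᶠ k : ℝ in 𝓝[≠] 0, |k| < 1 :=
    (tendsto_nhdsWithin_iff.1 habs).1.eventually_lt_const one_pos
  filter_upwards [hlim.eventually_le_const hc, hlt, self_mem_nhdsWithin] with k h1 h2 h3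
  refine (hbound k h3 h2).trans ?_
  rw [Real.norm_eq_abs]
  exact mul_le_mul_of_nonneg_right h1 (abs_nonneg k)

end FiniteMoment

end Wronskian

/-! ### The Jost matrix at real energies -/

section RealEnergy

variable {n : ℕ} {V : ℝ → Mat n} {A B : Mat n}

/-- The Jost matrix at a real number. Unlike `jostMatrix`, it has its continuous value at `k = 0`. -/
noncomputable def realJost (V : ℝ → Mat n) (A B : Mat n) (k : ℝ) : Mat n :=
  (expSol V ((-k : ℝ) : ℂ) 0)ᴴ * B - (expSolDeriv V ((-k : ℝ) : ℂ) 0)ᴴ * A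

/-- If `h†b = h'†a`, then `(a, b)` is a multiple of `(f, f')`: the Wronskians of `f` and `h` say that
`[f h; f' h']` has a left inverse made of its own adjoint blocks, which is then a right inverse. -/
theorem exists_smul_of_wronskian {c : ℂ} (hc : c ≠ 0) {f f' h h' : Mat n}
    (hff : fᴴ * f' - f'ᴴ * f = c • 1) (hhh : hᴴ * h' - h'ᴴ * h = -(c • 1))
    (hfh : fᴴ * h' - f'ᴴ * h = 0) (hhf : hᴴ * f' - h'ᴴ * f = 0) {a b : Fin n → ℂ}
    (hab : hᴴ *ᵥ b - h'ᴴ *ᵥ a = 0) : ∃ w, a = f *ᵥ w ∧ b = f' *ᵥ w := by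
  have hN : Matrix.fromBlocks (-f'ᴴ) fᴴ h'ᴴ (-hᴴ) * Matrix.fromBlocks f h f' h'
      = c • (1 : Matrix (Fin n ⊕ Fin n) (Fin n ⊕ Fin n) ℂ) := by
    rw [Matrix.fromBlocks_multiply, ← Matrix.fromBlocks_one, Matrix.fromBlocks_smul]
    congr 1
    · rw [← hff, neg_mul]; abel
    · rw [smul_zero, ← hfh, neg_mul]; abel
    · rw [smul_zero, ← neg_zero, ← hhf, neg_mul]; abel
    · rw [← neg_neg (c • (1 : Mat n)), ← hhh, neg_mul]; abel
  have hN' : Matrix.fromBlocks f h f' h' * Matrix.fromBlocks (-f'ᴴ) fᴴ h'ᴴ (-hᴴ)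
      = c • (1 : Matrix (Fin n ⊕ Fin n) (Fin n ⊕ Fin n) ℂ) := by
    have h1 : (c⁻¹ • Matrix.fromBlocks (-f'ᴴ) fᴴ h'ᴴ (-hᴴ)) * Matrix.fromBlocks f h f' h' = 1 := by
      rw [smul_mul_assoc, hN, smul_smul, inv_mul_cancel₀ hc, one_smul]
    rw [mul_eq_one_comm, mul_smul_comm] at h1
    rw [← h1, smul_smul, mul_inv_cancel₀ hc, one_smul]
  rw [Matrix.fromBlocks_multiply, ← Matrix.fromBlocks_one, Matrix.fromBlocks_smul,
    Matrix.fromBlocks_inj] at hN'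
  obtain ⟨h11, h12, h21, h22⟩ := hN'
  have hab' : hᴴ *ᵥ b = h'ᴴ *ᵥ a := sub_eq_zero.1 hab
  refine ⟨c⁻¹ • (fᴴ *ᵥ b - f'ᴴ *ᵥ a), ?_, ?_⟩
  · have h1 := congrArg (fun M => M *ᵥ a) h11
    have h2 := congrArg (fun M => M *ᵥ b) h12
    simp only [Matrix.add_mulVec, Matrix.smul_mulVec, Matrix.one_mulVec, mul_neg, Matrix.neg_mulVec,
      ← Matrix.mulVec_mulVec, smul_zero, Matrix.zero_mulVec, hab'] at h1 h2
    rw [Matrix.mulVec_smul, Matrix.mulVec_sub, eq_inv_smul_iff₀ hc, ← h1, add_neg_eq_zero.1 h2]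
    abel
  · have h1 := congrArg (fun M => M *ᵥ a) h21
    have h2 := congrArg (fun M => M *ᵥ b) h22
    simp only [Matrix.add_mulVec, Matrix.smul_mulVec, Matrix.one_mulVec, mul_neg, Matrix.neg_mulVec,
      ← Matrix.mulVec_mulVec, smul_zero, Matrix.zero_mulVec, hab'] at h1 h2
    rw [Matrix.mulVec_smul, Matrix.mulVec_sub, eq_inv_smul_iff₀ hc, ← h2, ← neg_add_eq_zero.1 h1]
    abel

theorem realJost_mulVec (V : ℝ → Mat n) (A B : Mat n) (k : ℝ) (v : Fin n → ℂ) :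
    realJost V A B k *ᵥ v = (expSol V ((-k : ℝ) : ℂ) 0)ᴴ *ᵥ (B *ᵥ v)
      - (expSolDeriv V ((-k : ℝ) : ℂ) 0)ᴴ *ᵥ (A *ᵥ v) := by
  rw [realJost, Matrix.sub_mulVec, Matrix.mulVec_mulVec, Matrix.mulVec_mulVec]

theorem star_mulVec_dotProduct_sub (M N M' N' : Mat n) (v w : Fin n → ℂ) :
    star (M *ᵥ v) ⬝ᵥ (N *ᵥ w) - star (M' *ᵥ v) ⬝ᵥ (N' *ᵥ w)
      = star v ⬝ᵥ ((Mᴴ * N - M'ᴴ * N') *ᵥ w) := by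
  rw [Matrix.star_mulVec, Matrix.star_mulVec, ← Matrix.dotProduct_mulVec, ← Matrix.dotProduct_mulVec,
    Matrix.mulVec_mulVec, Matrix.mulVec_mulVec, ← dotProduct_sub, Matrix.sub_mulVec]

theorem dotProduct_boundary_eq_zero (hA : -(Bᴴ * A) + Aᴴ * B = 0) (v w : Fin n → ℂ) :
    star (A *ᵥ v) ⬝ᵥ (B *ᵥ w) - star (B *ᵥ v) ⬝ᵥ (A *ᵥ w) = 0 := by
  rw [star_mulVec_dotProduct_sub, sub_eq_neg_add, hA, Matrix.zero_mulVec, dotProduct_zero]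

namespace FiniteMoment

variable (hV : FiniteMoment V)
include hV

theorem jostMatrix_ofReal {k : ℝ} (hk : k ≠ 0) : jostMatrix V A B k = realJost V A B k := by
  rw [hV.jostMatrix_eq A B (by simpa using hk) (ofReal_im_nonneg k), realJost]
  simp [expSol, expSolDeriv]

theorem continuous_realJost : Continuous (realJost V A B) := by
  have h1 : Continuous fun k : ℝ => volterraSol V ((-k : ℝ) : ℂ) 0 :=
    (hV.continuous_volterraSol le_rfl).comp continuous_neg
  have h2 : Continuous fun k : ℝ => volterraSolDeriv V ((-k : ℝ) : ℂ) 0 :=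
    (hV.continuous_volterraSolDeriv le_rfl).comp continuous_neg
  have h3 : ∀ {f : ℝ → Mat n}, Continuous f → Continuous fun k => (f k)ᴴ := fun hf => hf.star
  have h4 : realJost V A B = fun k : ℝ => (volterraSol V ((-k : ℝ) : ℂ) 0)ᴴ * B
      - ((Complex.I * ((-k : ℝ) : ℂ)) • volterraSol V ((-k : ℝ) : ℂ) 0
        + volterraSolDeriv V ((-k : ℝ) : ℂ) 0)ᴴ * A := by
    ext1 k
    simp [realJost, expSol, expSolDeriv]
  have h5 : Continuous fun k : ℝ => Complex.I * ((-k : ℝ) : ℂ) := by fun_prop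
  have h6 := h3 ((h5.smul h1).add h2)
  rw [h4]
  exact ((h3 h1).mul_const B).sub (h6.mul_const A)

/-- There is no bound state at a real `k ≠ 0`: a vector in the kernel of `J(k)` gives a multiple
`f(k, ·) w` of the Jost solution satisfying the selfadjoint boundary condition, while its Wronskian
with itself is `2ik |w|²`. -/
theorem eq_zero_of_realJost_mulVec_eq_zero (hsa : ∀ x : ℝ, 0 < x → (V x)ᴴ = V x)
    (hA : -(Bᴴ * A) + Aᴴ * B = 0) (hAB : (Aᴴ * A + Bᴴ * B).PosDef) {k : ℝ} (hk : k ≠ 0)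
    {v : Fin n → ℂ} (hv : realJost V A B k *ᵥ v = 0) : v = 0 := by
  have hc : Complex.I * ((k : ℂ) + k) ≠ 0 := by
    rw [← two_mul]
    simpa using hk
  have hff := hV.wronskian_zero_eq hsa (k := k) (l := k) (Or.inl rfl)
  have hhh := hV.wronskian_zero_eq hsa (k := -k) (l := -k) (Or.inl rfl)
  have hfh := hV.wronskian_zero_eq hsa (k := k) (l := -k) (Or.inr rfl)
  have hhf := hV.wronskian_zero_eq hsa (k := -k) (l := k) (Or.inr (neg_neg k).symm)
  rw [Complex.ofReal_neg, add_neg_cancel, mul_zero, zero_smul] at hfh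
  rw [Complex.ofReal_neg, neg_add_cancel, mul_zero, zero_smul] at hhf
  rw [show Complex.I * (((-k : ℝ) : ℂ) + ((-k : ℝ) : ℂ)) = -(Complex.I * ((k : ℂ) + k)) by
    push_cast; ring, neg_smul] at hhh
  rw [realJost_mulVec] at hv
  obtain ⟨w, ha, hb⟩ := exists_smul_of_wronskian hc hff hhh hfh hhf hv
  have h1 := dotProduct_boundary_eq_zero hA v v
  rw [ha, hb, star_mulVec_dotProduct_sub] at h1
  rw [wronskian] at hff
  rw [hff, Matrix.smul_mulVec, Matrix.one_mulVec, dotProduct_smul, smul_eq_mul] at h1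
  have hw : w = 0 := dotProduct_star_self_eq_zero.1 ((mul_eq_zero.1 h1).resolve_left hc)
  rw [hw, Matrix.mulVec_zero] at ha hb
  exact eq_zero_of_mulVec_eq_zero hAB ha hb

theorem det_realJost_ne_zero (hsa : ∀ x : ℝ, 0 < x → (V x)ᴴ = V x)
    (hA : -(Bᴴ * A) + Aᴴ * B = 0) (hAB : (Aᴴ * A + Bᴴ * B).PosDef) {k : ℝ} (hk : k ≠ 0) :
    (realJost V A B k).det ≠ 0 := by
  intro h
  obtain ⟨v, hv0, hv⟩ := Matrix.exists_mulVec_eq_zero_iff.2 h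
  exact hv0 (hV.eq_zero_of_realJost_mulVec_eq_zero hsa hA hAB hk hv)

end FiniteMoment

/-! ### The Jost matrix at low energy -/

/-- A Lagrangian pair `(P, Q)` with `P†P + Q†Q` invertible spans the solutions of
`P†b = Q†a`. -/
theorem eq_mulVec_of_lagrangian {P Q : Mat n} (hPQ : Pᴴ * Q - Qᴴ * P = 0)
    (hS : IsUnit (Pᴴ * P + Qᴴ * Q)) {a b : Fin n → ℂ} (hab : Pᴴ *ᵥ b - Qᴴ *ᵥ a = 0) :
    a = P *ᵥ ((Pᴴ * P + Qᴴ * Q)⁻¹ *ᵥ (Pᴴ *ᵥ a + Qᴴ *ᵥ b)) ∧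
      b = Q *ᵥ ((Pᴴ * P + Qᴴ * Q)⁻¹ *ᵥ (Pᴴ *ᵥ a + Qᴴ *ᵥ b)) := by
  set S := Pᴴ * P + Qᴴ * Q with hSdef
  have hSS : S * S⁻¹ = 1 := Matrix.mul_nonsing_inv S ((Matrix.isUnit_iff_isUnit_det S).1 hS)
  have hN : Matrix.fromBlocks Pᴴ Qᴴ (-Qᴴ) Pᴴ * Matrix.fromBlocks (P * S⁻¹) (-(Q * S⁻¹)) (Q * S⁻¹) (P * S⁻¹)
      = (1 : Matrix (Fin n ⊕ Fin n) (Fin n ⊕ Fin n) ℂ) := by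
    have hz : Pᴴ * Q = Qᴴ * P := sub_eq_zero.1 hPQ
    rw [Matrix.fromBlocks_multiply, ← Matrix.fromBlocks_one]
    simp only [mul_neg, neg_mul, neg_neg, ← mul_assoc, hz, neg_add_cancel]
    rw [← add_mul, ← hSdef, hSS, add_comm (Qᴴ * Q * S⁻¹), ← add_mul, ← hSdef, hSS]
  rw [mul_eq_one_comm, Matrix.fromBlocks_multiply, ← Matrix.fromBlocks_one,
    Matrix.fromBlocks_inj] at hN
  obtain ⟨h11, h12, h21, h22⟩ := hN
  have hab' : Pᴴ *ᵥ b = Qᴴ *ᵥ a := sub_eq_zero.1 hab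
  constructor
  · have h1 := congrArg (fun M => M *ᵥ a) h11
    have h2 := congrArg (fun M => M *ᵥ b) h12
    simp only [Matrix.add_mulVec, Matrix.one_mulVec, mul_neg, Matrix.neg_mulVec,
      ← Matrix.mulVec_mulVec, Matrix.zero_mulVec, hab'] at h1 h2
    rw [Matrix.mulVec_add, Matrix.mulVec_add, add_neg_eq_zero.1 h2, ← neg_neg (Q *ᵥ _), h1]
  · have h1 := congrArg (fun M => M *ᵥ a) h21
    have h2 := congrArg (fun M => M *ᵥ b) h22
    simp only [Matrix.add_mulVec, Matrix.one_mulVec, mul_neg, Matrix.neg_mulVec,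
      ← Matrix.mulVec_mulVec, Matrix.zero_mulVec, hab'] at h1 h2
    rw [Matrix.mulVec_add, Matrix.mulVec_add, add_neg_eq_zero.1 h1, add_comm, h2]

theorem isUnit_conjTranspose_mul_self_add {P Q : Mat n}
    (h : ∀ v, P *ᵥ v = 0 → Q *ᵥ v = 0 → v = 0) : IsUnit (Pᴴ * P + Qᴴ * Q) := by
  rw [Matrix.isUnit_iff_isUnit_det, isUnit_iff_ne_zero]
  intro hdet
  obtain ⟨v, hv0, hv⟩ := Matrix.exists_mulVec_eq_zero_iff.2 hdet
  have h1 : star (P *ᵥ v) ⬝ᵥ (P *ᵥ v) + star (Q *ᵥ v) ⬝ᵥ (Q *ᵥ v) = 0 := by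
    rw [Matrix.star_mulVec, Matrix.star_mulVec, ← Matrix.dotProduct_mulVec, ← Matrix.dotProduct_mulVec,
      Matrix.mulVec_mulVec, Matrix.mulVec_mulVec, ← dotProduct_add, ← Matrix.add_mulVec, hv,
      dotProduct_zero]
  rw [add_eq_zero_iff_of_nonneg (dotProduct_star_self_nonneg _) (dotProduct_star_self_nonneg _)] at h1
  exact hv0 (h v (dotProduct_star_self_eq_zero.1 h1.1) (dotProduct_star_self_eq_zero.1 h1.2))

/-- `det J(k)` vanishes at `k = 0` to an exact finite order. On the kernel of `J(0)` the regular solution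
is `f(0, ·) β` with `β = T v`, and `J(k) v` is the Wronskian of `f(-k, ·)` and `f(0, ·)` applied to `β`,
which is asymptotic to `-ik β`. -/
theorem FiniteMoment.exists_tendsto_det_realJost_div_pow (hV : FiniteMoment V)
    (hsa : ∀ x : ℝ, 0 < x → (V x)ᴴ = V x) (hA : -(Bᴴ * A) + Aᴴ * B = 0)
    (hAB : (Aᴴ * A + Bᴴ * B).PosDef) : ∃ (m : ℕ) (c : ℂ), c ≠ 0 ∧
      Tendsto (fun k : ℝ => (realJost V A B k).det / (k : ℂ) ^ m) (𝓝[≠] 0) (𝓝 c) := by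
  set P := expSol V ((0 : ℝ) : ℂ) 0 with hP
  set Q := expSolDeriv V ((0 : ℝ) : ℂ) 0 with hQ
  have hPQ : Pᴴ * Q - Qᴴ * P = 0 := by
    have := hV.wronskian_zero_eq hsa (k := 0) (l := 0) (Or.inl rfl)
    simpa [wronskian, hP, hQ] using this
  have hε : ∀ᶠ k : ℝ in 𝓝[≠] 0, -(Complex.I * (k : ℂ)) ≠ 0 := by
    filter_upwards [self_mem_nhdsWithin] with k hk
    simpa using hk
  have hneg : Tendsto (fun k : ℝ => -k) (𝓝[≠] 0) (𝓝[≠] 0) := by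
    refine tendsto_nhdsWithin_iff.2 ⟨?_, ?_⟩
    · have := (continuous_neg.tendsto (0 : ℝ)).mono_left (nhdsWithin_le_nhds (s := {0}ᶜ))
      simpa using this
    · filter_upwards [self_mem_nhdsWithin] with k hk using neg_ne_zero.2 hk
  have hW : Tendsto (fun k : ℝ => (-(Complex.I * (k : ℂ)))⁻¹ • wronskian V (-k) 0 0) (𝓝[≠] 0)
      (𝓝 (1 : Mat n)) := by
    have h1 := (hV.wronskian_zero_right_isLittleO hsa).comp_tendsto hneg
    have h2 : (fun k : ℝ => (-(Complex.I * (k : ℂ)))⁻¹ • wronskian V (-k) 0 0 - (1 : Mat n))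
        =o[𝓝[≠] 0] fun _ => (1 : ℝ) := by
      refine isLittleO_iff.2 fun c hc => ?_
      filter_upwards [isLittleO_iff.1 h1 hc, hε, self_mem_nhdsWithin] with k hk hk0 hk1
      have h3 : (-(Complex.I * (k : ℂ)))⁻¹ • wronskian V (-k) 0 0 - (1 : Mat n)
          = (-(Complex.I * (k : ℂ)))⁻¹ •
            (wronskian V (-k) 0 0 - (Complex.I * ((-k : ℝ) : ℂ)) • (1 : Mat n)) := by
        rw [smul_sub, smul_smul, Complex.ofReal_neg, mul_neg, inv_mul_cancel₀ hk0, one_smul]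
      have hk2 : 0 < ‖k‖ := norm_pos_iff.2 hk1
      rw [h3, norm_smul, norm_inv, norm_neg, norm_mul, Complex.norm_I, one_mul, Complex.norm_real,
        norm_one, mul_one, inv_mul_le_iff₀ hk2, mul_comm]
      simpa [mul_comm] using hk
    have h4 := (isLittleO_one_iff ℝ).1 h2
    simpa using h4.add_const (1 : Mat n)
  have hmulVec : ∀ v : Fin n → ℂ, Tendsto (fun k : ℝ => (-(Complex.I * (k : ℂ)))⁻¹ •
      (wronskian V (-k) 0 0 *ᵥ v)) (𝓝[≠] 0) (𝓝 v) := by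
    intro v
    have hcont : Continuous fun X : Mat n => X *ᵥ v := by fun_prop
    have := (hcont.tendsto _).comp hW
    rw [Matrix.one_mulVec] at this
    refine this.congr fun k => ?_
    simp only [Function.comp_apply, Matrix.smul_mulVec]
  have hWv : ∀ (k : ℝ) (v : Fin n → ℂ), wronskian V (-k) 0 0 *ᵥ v
      = (expSol V ((-k : ℝ) : ℂ) 0)ᴴ *ᵥ (Q *ᵥ v) - (expSolDeriv V ((-k : ℝ) : ℂ) 0)ᴴ *ᵥ (P *ᵥ v) := by
    intro k v
    rw [wronskian, Matrix.sub_mulVec, Matrix.mulVec_mulVec, Matrix.mulVec_mulVec]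
  have hS : IsUnit (Pᴴ * P + Qᴴ * Q) := by
    refine isUnit_conjTranspose_mul_self_add fun v hPv hQv => ?_
    refine tendsto_nhds_unique (hmulVec v) (tendsto_const_nhds.congr fun k => ?_)
    rw [hWv, hPv, hQv, Matrix.mulVec_zero, Matrix.mulVec_zero, sub_zero, smul_zero]
  set T : Mat n := (Pᴴ * P + Qᴴ * Q)⁻¹ * (Pᴴ * A + Qᴴ * B) with hT
  have hker : ∀ v, realJost V A B 0 *ᵥ v = 0 → A *ᵥ v = P *ᵥ (T *ᵥ v) ∧ B *ᵥ v = Q *ᵥ (T *ᵥ v) := by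
    intro v hv
    rw [realJost_mulVec, neg_zero] at hv
    have h1 := eq_mulVec_of_lagrangian hPQ hS hv
    have h2 : T *ᵥ v = (Pᴴ * P + Qᴴ * Q)⁻¹ *ᵥ (Pᴴ *ᵥ (A *ᵥ v) + Qᴴ *ᵥ (B *ᵥ v)) := by
      rw [hT, ← Matrix.mulVec_mulVec, Matrix.add_mulVec, Matrix.mulVec_mulVec, Matrix.mulVec_mulVec]
    rwa [h2]
  have hM : Tendsto (realJost V A B) (𝓝[≠] 0) (𝓝 (realJost V A B 0)) :=
    (hV.continuous_realJost.tendsto 0).mono_left nhdsWithin_le_nhds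
  have hlim : ∀ v, realJost V A B 0 *ᵥ v = 0 → Tendsto (fun k : ℝ => (-(Complex.I * (k : ℂ)))⁻¹ •
      (realJost V A B k *ᵥ v)) (𝓝[≠] 0) (𝓝 (T *ᵥ v)) := by
    intro v hv
    obtain ⟨h1, h2⟩ := hker v hv
    refine (hmulVec (T *ᵥ v)).congr fun k => ?_
    rw [hWv, realJost_mulVec, h1, h2]
  have hinj : ∀ v, realJost V A B 0 *ᵥ v = 0 → T *ᵥ v = 0 → v = 0 := by
    intro v hv hv'
    obtain ⟨h1, h2⟩ := hker v hv
    rw [hv', Matrix.mulVec_zero] at h1 h2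
    exact eq_zero_of_mulVec_eq_zero hAB h1 h2
  have horth : ∀ v w, realJost V A B 0 *ᵥ v = 0 →
      star (T *ᵥ v) ⬝ᵥ (realJost V A B 0 *ᵥ w) = 0 := by
    intro v w hv
    obtain ⟨h1, h2⟩ := hker v hv
    have h3 := dotProduct_boundary_eq_zero hA v w
    rw [h1, h2] at h3
    rw [realJost_mulVec, neg_zero, dotProduct_sub, Matrix.dotProduct_mulVec _ (expSol _ _ _)ᴴ,
      Matrix.dotProduct_mulVec _ (expSolDeriv _ _ _)ᴴ, ← Matrix.star_mulVec, ← Matrix.star_mulVec]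
    exact h3
  obtain ⟨c, hc0, hc⟩ := exists_tendsto_det_div_pow hε hM hlim hinj horth
  refine ⟨n - (realJost V A B 0).rank, c * (-Complex.I) ^ (n - (realJost V A B 0).rank),
    mul_ne_zero hc0 (pow_ne_zero _ (by simp)), ?_⟩
  refine (hc.mul_const _).congr' ?_
  filter_upwards [hε] with k hk
  have hk' : (k : ℂ) ≠ 0 := by simpa using hk
  have hI : (-Complex.I) ^ (n - (realJost V A B 0).rank) ≠ 0 := pow_ne_zero _ (by simp)
  rw [show -(Complex.I * (k : ℂ)) = (-Complex.I) * k by ring, mul_pow]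
  field_simp

end RealEnergy

/-! ### The Mellin transforms in the variable `z = s/2` -/

theorem HasSimplePoleWithResidue.meromorphicAt {f : ℂ → ℂ} {a c : ℂ}
    (h : HasSimplePoleWithResidue f a c) : MeromorphicAt f a := by
  obtain ⟨g, hg, hfg⟩ := h
  have h1 : MeromorphicAt (fun z => c / (z - a) + g z) a :=
    ((MeromorphicAt.const c a).div ((MeromorphicAt.id a).sub (MeromorphicAt.const a a))).add
      hg.meromorphicAt
  exact h1.congr (hfg.mono fun z hz => hz.symm)

theorem HasPowerExpansion.exists_continuation_two_mul {ψ : ℝ → ℂ} {β : ℕ → ℂ} {lam : ℕ → ℝ}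
    (h : HasPowerExpansion ψ β lam) (hlam : Tendsto lam atTop atTop) :
    ∃ F : ℂ → ℂ, MeromorphicOn F {z | 0 < z.re} ∧
      (∀ z : ℂ, 0 < z.re → (∀ l, 2 * z ≠ lam l) → AnalyticAt ℂ F z) ∧
      (∀ l, HasSimplePoleWithResidue F (lam l / 2) (-β l / 2)) ∧
      ∀ (N : ℕ) (z : ℂ), 0 < z.re → 2 * z.re < lam N → (∀ l < N, lam l < 2 * z.re) →
        IntegrableOn (fun k : ℝ => (ψ k - partialExpansion β lam N k) * (k : ℂ) ^ (2 * z - 1)) (Ioi 0) ∧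
        F z = ∫ k in Ioi (0 : ℝ), (ψ k - partialExpansion β lam N k) * (k : ℂ) ^ (2 * z - 1) := by
  obtain ⟨M, hM, hpole, hint⟩ := h.exists_continuation hlam
  have h2 : ∀ z : ℂ, AnalyticAt ℂ (fun z : ℂ => 2 * z) z := fun z => by fun_prop
  have hre : ∀ z : ℂ, (2 * z).re = 2 * z.re := fun z => by simp
  have hana : ∀ z : ℂ, 0 < z.re → (∀ l, 2 * z ≠ lam l) → AnalyticAt ℂ (fun z => M (2 * z)) z :=
    fun z hz hl => (hM (2 * z) (by rw [hre]; linarith) hl).fun_comp (h2 z)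
  have hres : ∀ l, HasSimplePoleWithResidue (fun z => M (2 * z)) (lam l / 2) (-β l / 2) := by
    intro l
    obtain ⟨g, hg, hMg⟩ := hpole l
    have hl : (2 : ℂ) * (lam l / 2) = lam l := by ring
    refine ⟨fun z => g (2 * z), ?_, ?_⟩
    · refine AnalyticAt.fun_comp ?_ (h2 _)
      rwa [hl]
    · have ht : Tendsto (fun z : ℂ => 2 * z) (𝓝[≠] (lam l / 2 : ℂ)) (𝓝[≠] (lam l : ℂ)) := by
        refine tendsto_nhdsWithin_iff.2 ⟨?_, ?_⟩
        · have := ((h2 (lam l / 2)).continuousAt.tendsto).mono_left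
            (nhdsWithin_le_nhds (s := {(lam l / 2 : ℂ)}ᶜ))
          rwa [hl] at this
        · filter_upwards [self_mem_nhdsWithin] with z hz h3
          refine hz ?_
          rw [mem_singleton_iff] at h3 ⊢
          rw [← h3]
          ring
      filter_upwards [ht.eventually hMg, self_mem_nhdsWithin] with z hz hne
      have h3 : z - lam l / 2 ≠ 0 := sub_ne_zero.2 hne
      have h4 : 2 * z - lam l ≠ 0 := by
        have : 2 * z - lam l = 2 * (z - lam l / 2) := by ring
        rw [this]
        exact mul_ne_zero two_ne_zero h3
      rw [hz]
      congr 1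
      field_simp
  refine ⟨fun z => M (2 * z), ?_, hana, hres, ?_⟩
  · intro z hz
    by_cases hl : ∀ l, 2 * z ≠ lam l
    · exact (hana z hz hl).meromorphicAt
    · push Not at hl
      obtain ⟨l, hl⟩ := hl
      have h3 : z = lam l / 2 := by rw [← hl]; ring
      rw [h3]
      exact (hres l).meromorphicAt
  · intro N z hz h1 h3
    have h4 := hint N (2 * z) (by rw [hre]; linarith) (by rwa [hre]) (by simpa only [hre] using h3)
    have h5 : (fun k : ℝ => (ψ k - partialExpansion β lam N k) * (k : ℂ) ^ (2 * z - 1))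
        = fun k : ℝ => (k : ℂ) ^ (2 * z - 1) • (ψ k - partialExpansion β lam N k) := by
      funext k
      rw [smul_eq_mul, mul_comm]
    rw [h5]
    exact ⟨h4.1, h4.2.symm⟩

/-! ### The logarithm of the normalized determinant -/

theorem sum_Icc_one_eq_sum_range (f : ℕ → ℂ) (N : ℕ) :
    ∑ l ∈ Finset.Icc 1 N, f l = ∑ l ∈ Finset.range N, f (l + 1) := by
  rw [Finset.range_eq_Ico, Finset.sum_Ico_add' f 0 N 1]
  rfl

theorem sum_even_part (e : ℕ → ℂ) (t : ℂ) (N : ℕ) :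
    (1 / 2) * (∑ l ∈ Finset.range (2 * N + 1), e (l + 1) * t ^ (l + 1)
        + ∑ l ∈ Finset.range (2 * N + 1), e (l + 1) * (-t) ^ (l + 1))
      = ∑ l ∈ Finset.range N, e (2 * l + 2) * (t ^ 2) ^ (l + 1) := by
  induction N with
  | zero => simp
  | succ N ih =>
    rw [Finset.sum_range_succ _ N, ← ih, show 2 * (N + 1) + 1 = 2 * N + 1 + 1 + 1 by ring]
    simp only [Finset.sum_range_succ _ (2 * N + 1 + 1), Finset.sum_range_succ _ (2 * N + 1)]
    have h1 : (-t) ^ (2 * N + 1 + 1) = t ^ (2 * N + 1 + 1) := Even.neg_pow ⟨N + 1, by ring⟩ t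
    have h2 : (-t) ^ (2 * N + 1 + 1 + 1) = -t ^ (2 * N + 1 + 1 + 1) := Odd.neg_pow ⟨N + 1, by ring⟩ t
    rw [h1, h2]
    ring

theorem sum_odd_part (e : ℕ → ℂ) (t : ℂ) (N : ℕ) :
    (1 / 2) * (∑ l ∈ Finset.range (2 * N), e (l + 1) * t ^ (l + 1)
        - ∑ l ∈ Finset.range (2 * N), e (l + 1) * (-t) ^ (l + 1))
      = ∑ l ∈ Finset.range N, e (2 * l + 1) * ((t ^ 2) ^ l * t) := by
  induction N with
  | zero => simp
  | succ N ih =>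
    rw [Finset.sum_range_succ _ N, ← ih, show 2 * (N + 1) = 2 * N + 1 + 1 by ring]
    simp only [Finset.sum_range_succ _ (2 * N + 1), Finset.sum_range_succ _ (2 * N)]
    have h1 : (-t) ^ (2 * N + 1 + 1) = t ^ (2 * N + 1 + 1) := Even.neg_pow ⟨N + 1, by ring⟩ t
    have h2 : (-t) ^ (2 * N + 1) = -t ^ (2 * N + 1) := Odd.neg_pow ⟨N, by ring⟩ t
    rw [h1, h2]
    ring

theorem invTwoI_neg (k : ℝ) : invTwoI ((-k : ℝ) : ℂ) = -invTwoI k := by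
  rw [invTwoI, invTwoI, Complex.ofReal_neg, mul_neg, inv_neg]

theorem invTwoI_eq (k : ℂ) : invTwoI k = -Complex.I * (1 / (2 * k)) := by
  rw [invTwoI, mul_inv, mul_inv, Complex.inv_I, one_div, mul_inv]
  ring

theorem invTwoI_sq (k : ℂ) : invTwoI k ^ 2 = -(1 / (2 * k) ^ 2) := by
  rw [invTwoI_eq, mul_pow, neg_sq, Complex.I_sq, div_pow, one_pow, neg_one_mul]

theorem invTwoI_pow_isBigO (N : ℕ) :
    (fun k : ℝ => invTwoI k ^ N) =O[atTop] fun k : ℝ => k ^ (-(N : ℝ)) := by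
  refine IsBigO.of_bound 1 ?_
  filter_upwards [eventually_gt_atTop 0] with k hk
  rw [Real.norm_of_nonneg (by positivity), Real.rpow_neg hk.le, Real.rpow_natCast, one_mul, norm_pow,
    ← inv_pow]
  refine pow_le_pow_left₀ (norm_nonneg _) ?_ N
  rw [invTwoI, norm_inv]
  simp only [norm_mul, Complex.norm_I, Complex.norm_real, Real.norm_of_nonneg hk.le, Complex.norm_ofNat,
    mul_one]
  exact inv_anti₀ hk (by linarith)

section LogDet

variable {n : ℕ} {V : ℝ → Mat n} {A B : Mat n}

/-- The coefficients of the expansion of `ln_e h` at infinity. -/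
noncomputable def evenCoeff (V : ℝ → Mat n) (A B : Mat n) (l : ℕ) : ℂ :=
  (-1) ^ (l + 1) * eCoeff V A B (2 * l + 2) / 2 ^ (2 * l + 2)

/-- The coefficients of the expansion of `-i ln_o h` at infinity. -/
noncomputable def oddCoeff (V : ℝ → Mat n) (A B : Mat n) (l : ℕ) : ℂ :=
  (-1) ^ (l + 1) * eCoeff V A B (2 * l + 1) / 2 ^ (2 * l + 1)

theorem cpow_neg_natCast_eq {x : ℝ} (m : ℕ) : (x : ℂ) ^ (-((m : ℝ) : ℂ)) = 1 / (x : ℂ) ^ m := by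
  rw [Complex.ofReal_natCast, Complex.cpow_neg, Complex.cpow_natCast, one_div]

theorem partialExpansion_evenCoeff (V : ℝ → Mat n) (A B : Mat n) (N : ℕ) (x : ℝ) :
    partialExpansion (evenCoeff V A B) (fun l => ((2 * l + 2 : ℕ) : ℝ)) N x
      = ∑ l ∈ Finset.range N, (-1) ^ (l + 1) * eCoeff V A B (2 * l + 2)
          * (1 / (2 * (x : ℂ)) ^ (2 * l + 2)) := by
  refine Finset.sum_congr rfl fun l _ => ?_
  rw [cpow_neg_natCast_eq, evenCoeff, mul_pow, one_div, one_div, mul_inv]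
  ring

theorem partialExpansion_oddCoeff (V : ℝ → Mat n) (A B : Mat n) (N : ℕ) (x : ℝ) :
    partialExpansion (oddCoeff V A B) (fun l => ((2 * l + 1 : ℕ) : ℝ)) N x
      = ∑ l ∈ Finset.range N, (-1) ^ (l + 1) * eCoeff V A B (2 * l + 1)
          * (1 / (2 * (x : ℂ)) ^ (2 * l + 1)) := by
  refine Finset.sum_congr rfl fun l _ => ?_
  rw [cpow_neg_natCast_eq, oddCoeff, mul_pow, one_div, one_div, mul_inv]
  ring

/-- What is needed of `ln h`: it is a continuous logarithm, singular at most logarithmically at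
`k = 0`, with the expansion `∑ e_l / (2ik)^l` at `±∞`. -/
structure LogDetSpec (V : ℝ → Mat n) (A B : Mat n) : Prop where
  isLogBranch : IsLogBranch (normalizedDet V A B) (lnDet V A B)
  isBigO_zero : ∀ ε : ℝ, 0 < ε → lnDet V A B =O[𝓝[>] 0] fun x : ℝ => x ^ (-ε)
  isBigO_zero_neg : ∀ ε : ℝ, 0 < ε → (fun x => lnDet V A B (-x)) =O[𝓝[>] 0] fun x : ℝ => x ^ (-ε)
  isBigO_atTop : ∀ N, (fun x : ℝ => lnDet V A B x
    - ∑ l ∈ Finset.range N, eCoeff V A B (l + 1) * invTwoI x ^ (l + 1))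
      =O[atTop] fun x : ℝ => x ^ (-((N + 1 : ℕ) : ℝ))
  isBigO_atTop_neg : ∀ N, (fun x : ℝ => lnDet V A B (-x)
    - ∑ l ∈ Finset.range N, eCoeff V A B (l + 1) * (-invTwoI x) ^ (l + 1))
      =O[atTop] fun x : ℝ => x ^ (-((N + 1 : ℕ) : ℝ))

theorem FiniteMoment.logDetSpec (hV : FiniteMoment V) (hsa : ∀ x : ℝ, 0 < x → (V x)ᴴ = V x)
    (hb : IsJostExpansion V (bCoeff V) fun l => derivWithin (bCoeff V l) (Ici 0))
    (hA : -(Bᴴ * A) + Aᴴ * B = 0) (hAB : (Aᴴ * A + Bᴴ * B).PosDef) : LogDetSpec V A B := by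
  obtain ⟨hc0, hc⟩ := hV.leadingConst_spec hb hA hAB
  obtain ⟨ha0, hexp⟩ := hV.normalizedDet_expansion hb hA hAB
  have hrec := normCoeff_recursion V A B ha0
  set c₂ := leadingConst V A B with hc₂
  set r := nonDirichlet A with hr
  have hreal : ∀ k : ℝ, k ≠ 0 → normalizedDet V A B k = (realJost V A B k).det / (c₂ * (k : ℂ) ^ r) := by
    intro k hk
    rw [normalizedDet, hV.jostMatrix_ofReal hk, ← hc₂, ← hr]
  have hden : ∀ k : ℝ, k ≠ 0 → c₂ * (k : ℂ) ^ r ≠ 0 := fun k hk =>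
    mul_ne_zero hc0 (pow_ne_zero _ (by exact_mod_cast hk))
  have hlim : Tendsto (normalizedDet V A B) highEnergy (𝓝 1) := by
    have h1 := hc.div_const c₂
    rw [div_self hc0] at h1
    refine h1.congr fun k => ?_
    rw [normalizedDet, ← hc₂, ← hr, div_div, mul_comm]
  have hbot : Tendsto (fun x : ℝ => (x : ℂ)) atBot highEnergy := by
    have := tendsto_neg_ofReal_highEnergy_atTop.comp tendsto_neg_atBot_atTop
    simpa [Function.comp_def] using this
  have hcont : ContinuousOn (fun k : ℝ => normalizedDet V A B k) {0}ᶜ := by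
    have h1 : ContinuousOn (fun k : ℝ => (realJost V A B k).det / (c₂ * (k : ℂ) ^ r)) {0}ᶜ :=
      (hV.continuous_realJost.matrix_det).continuousOn.div (Continuous.continuousOn (by fun_prop))
        fun k hk => hden k hk
    exact h1.congr fun k hk => hreal k hk
  have hbranch : IsLogBranch (normalizedDet V A B) (lnDet V A B) := by
    have hex := exists_isLogBranch hcont (fun k hk => by
      rw [hreal k hk]
      exact div_ne_zero (hV.det_realJost_ne_zero hsa hA hAB hk) (hden k hk))
      (hlim.comp tendsto_ofReal_highEnergy_atTop) (hlim.comp hbot)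
    rw [lnDet, dif_pos hex]
    exact hex.choose_spec
  obtain ⟨m, c, hcc, hdet⟩ := hV.exists_tendsto_det_realJost_div_pow hsa hA hAB
  have hzero : Tendsto (fun k : ℝ => normalizedDet V A B k / (k : ℂ) ^ ((m : ℤ) - r)) (𝓝[≠] 0)
      (𝓝 (c / c₂)) := by
    refine (hdet.div_const c₂).congr' ?_
    filter_upwards [self_mem_nhdsWithin] with k hk
    have hk0 : (k : ℂ) ≠ 0 := by exact_mod_cast (show k ≠ 0 from hk)
    rw [hreal k hk, zpow_sub₀ hk0, zpow_natCast, zpow_natCast]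
    field_simp
  have hgt : Tendsto (fun k : ℝ => -k) (𝓝[>] 0) (𝓝[≠] 0) := by
    refine tendsto_nhdsWithin_iff.2 ⟨?_, ?_⟩
    · have := (continuous_neg.tendsto (0 : ℝ)).mono_left (nhdsWithin_le_nhds (s := Ioi 0))
      simpa using this
    · filter_upwards [self_mem_nhdsWithin] with k hk using neg_ne_zero.2 (ne_of_gt hk)
  have hne : c / c₂ ≠ 0 := div_ne_zero hcc hc0
  refine ⟨hbranch, fun ε hε => ?_, fun ε hε => ?_, fun N => ?_, fun N => ?_⟩
  · exact isBigO_of_exp_eq (hbranch.continuousOn.mono fun x hx => ne_of_gt hx)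
      (fun x hx => hbranch.exp_eq x hx.ne') hne
      (hzero.mono_left (nhdsWithin_mono _ fun x hx => ne_of_gt hx)) hε
  · refine isBigO_of_exp_eq (m := (m : ℤ) - r)
      (h := fun x : ℝ => normalizedDet V A B ((-x : ℝ) : ℂ))
      (hbranch.continuousOn.comp continuousOn_neg fun x hx => ?_)
      (fun x hx => hbranch.exp_eq (-x) (neg_ne_zero.2 hx.ne'))
      (mul_ne_zero (zpow_ne_zero ((m : ℤ) - r) (neg_ne_zero.2 one_ne_zero)) hne)
      (((hzero.comp hgt).const_mul ((-1 : ℂ) ^ ((m : ℤ) - r))).congr fun x => ?_) hε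
    · simpa using ne_of_gt hx
    · have h1 : (((-x : ℝ) : ℂ)) ^ ((m : ℤ) - r) = (-1) ^ ((m : ℤ) - r) * (x : ℂ) ^ ((m : ℤ) - r) := by
        rw [← mul_zpow, Complex.ofReal_neg, neg_one_mul]
      have h2 : ((-1 : ℂ)) ^ ((m : ℤ) - r) ≠ 0 := zpow_ne_zero _ (neg_ne_zero.2 one_ne_zero)
      simp only [Function.comp_apply]
      rw [h1, ← mul_div_assoc, mul_div_mul_left _ _ h2]
  · refine IsBigO.trans ?_ (invTwoI_pow_isBigO (N + 1))
    refine sub_sum_isBigO_of_exp_eq ha0 hrec N (tendsto_invTwoI.comp tendsto_ofReal_highEnergy_atTop)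
      ((hexp N).comp_tendsto tendsto_ofReal_highEnergy_atTop) hbranch.tendsto_atTop ?_
    filter_upwards [eventually_gt_atTop 0] with x hx using hbranch.exp_eq x hx.ne'
  · refine IsBigO.trans ?_ (invTwoI_pow_isBigO (N + 1))
    have h1 := sub_sum_isBigO_of_exp_eq ha0 hrec N
      (tendsto_invTwoI.comp tendsto_neg_ofReal_highEnergy_atTop)
      ((hexp N).comp_tendsto tendsto_neg_ofReal_highEnergy_atTop)
      (hbranch.tendsto_atBot.comp tendsto_neg_atTop_atBot)
      (by filter_upwards [eventually_gt_atTop 0] with x hx using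
            hbranch.exp_eq (-x) (neg_ne_zero.2 hx.ne'))
    simp only [Function.comp_def, invTwoI_neg] at h1
    refine h1.trans (IsBigO.of_bound' (Eventually.of_forall fun x => ?_))
    rw [norm_pow, norm_pow, norm_neg]

namespace LogDetSpec

variable (h : LogDetSpec V A B)
include h

theorem continuousOn : ContinuousOn (lnDet V A B) (Ioi 0) :=
  h.isLogBranch.continuousOn.mono fun _ hx => ne_of_gt hx

theorem continuousOn_neg : ContinuousOn (fun x => lnDet V A B (-x)) (Ioi 0) :=
  h.isLogBranch.continuousOn.comp _root_.continuousOn_neg fun x hx => by simpa using ne_of_gt hx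

theorem hasPowerExpansion_even : HasPowerExpansion (lnEven V A B) (evenCoeff V A B)
    fun l => ((2 * l + 2 : ℕ) : ℝ) where
  pos l := by positivity
  strictMono := fun a b hab => by
    have : 2 * a + 2 < 2 * b + 2 := by omega
    exact Nat.cast_lt.2 this
  locallyIntegrableOn := by
    refine ContinuousOn.locallyIntegrableOn ?_ measurableSet_Ioi
    exact continuousOn_const.mul (h.continuousOn.add h.continuousOn_neg)
  isBigO_zero ε hε := ((h.isBigO_zero ε hε).add (h.isBigO_zero_neg ε hε)).const_mul_left _
  isBigO_atTop N := by
    refine (((h.isBigO_atTop (2 * N + 1)).add (h.isBigO_atTop_neg (2 * N + 1))).const_mul_left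
      (1 / 2)).congr_left fun x => ?_
    have h1 := sum_even_part (eCoeff V A B) (invTwoI x) N
    have h2 : partialExpansion (evenCoeff V A B) (fun l => ((2 * l + 2 : ℕ) : ℝ)) N x
        = ∑ l ∈ Finset.range N, eCoeff V A B (2 * l + 2) * (invTwoI x ^ 2) ^ (l + 1) := by
      rw [partialExpansion_evenCoeff]
      refine Finset.sum_congr rfl fun l _ => ?_
      rw [invTwoI_sq, neg_pow (1 / (2 * (x : ℂ)) ^ 2), div_pow, one_pow, ← pow_mul, mul_add, mul_one]
      ring
    rw [h2, ← h1, lnEven]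
    ring

theorem hasPowerExpansion_odd : HasPowerExpansion (fun x => -Complex.I * lnOdd V A B x)
    (oddCoeff V A B) fun l => ((2 * l + 1 : ℕ) : ℝ) where
  pos l := by positivity
  strictMono := fun a b hab => by
    have : 2 * a + 1 < 2 * b + 1 := by omega
    exact Nat.cast_lt.2 this
  locallyIntegrableOn := by
    refine ContinuousOn.locallyIntegrableOn ?_ measurableSet_Ioi
    exact continuousOn_const.mul (continuousOn_const.mul (h.continuousOn.sub h.continuousOn_neg))
  isBigO_zero ε hε := (((h.isBigO_zero ε hε).sub (h.isBigO_zero_neg ε hε)).const_mul_left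
    _).const_mul_left _
  isBigO_atTop N := by
    refine (((h.isBigO_atTop (2 * N)).sub (h.isBigO_atTop_neg (2 * N))).const_mul_left
      (-Complex.I * (1 / 2))).congr_left fun x => ?_
    have h1 := sum_odd_part (eCoeff V A B) (invTwoI x) N
    have h2 : partialExpansion (oddCoeff V A B) (fun l => ((2 * l + 1 : ℕ) : ℝ)) N x
        = -Complex.I * ∑ l ∈ Finset.range N, eCoeff V A B (2 * l + 1)
            * ((invTwoI x ^ 2) ^ l * invTwoI x) := by
      rw [partialExpansion_oddCoeff, Finset.mul_sum]
      refine Finset.sum_congr rfl fun l _ => ?_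
      rw [invTwoI_sq, neg_pow (1 / (2 * (x : ℂ)) ^ 2), div_pow, one_pow, ← pow_mul, invTwoI_eq,
        pow_succ (2 * (x : ℂ)), ← one_div_mul_one_div]
      linear_combination (-(-1) ^ l * eCoeff V A B (2 * l + 1) * (1 / (2 * (x : ℂ)) ^ (2 * l))
        * (1 / (2 * (x : ℂ)))) * Complex.I_mul_I
    rw [h2, ← h1, lnOdd]
    ring

end LogDetSpec

end LogDet

end HalfLine

open HalfLine in
theorem proposition3p5 (n : ℕ) (V : ℝ → Mat n) (A B : Mat n)
    (hA : -(Bᴴ * A) + Aᴴ * B = 0) (hAB : (Aᴴ * A + Bᴴ * B).PosDef)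
    (hsa : ∀ x : ℝ, 0 < x → (V x)ᴴ = V x)
    (hint : IntegrableOn (fun x : ℝ => (1 + x) * ‖V x‖) (Ioi 0))
    (hsmooth : ContDiffOn ℝ ∞ V (Ioi 0)) (hdecay : SymbolDecay V) :
    (∀ z : ℂ, 0 < z.re → z.re < 1 / 2 →
      IntegrableOn (fun k : ℝ => lnEven V A B k * (k : ℂ) ^ (2 * z - 1)) (Ioi 0) ∧
      IntegrableOn (fun k : ℝ => lnOdd V A B k * (k : ℂ) ^ (2 * z - 1)) (Ioi 0)) ∧
    (∃ F : ℂ → ℂ, MeromorphicOn F {z | 0 < z.re} ∧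
      (∀ z : ℂ, 0 < z.re → z.re < 1 / 2 → F z = evenMellin V A B z) ∧
      (∀ z : ℂ, 0 < z.re → (∀ j : ℕ, 1 ≤ j → z ≠ j) → AnalyticAt ℂ F z) ∧
      (∀ j : ℕ, 1 ≤ j → HasSimplePoleWithResidue F j
        ((-1) ^ (j + 1) * (2 : ℂ) ^ (-2 * (j : ℤ) - 1) * eCoeff V A B (2 * j))) ∧
      (∀ z : ℂ, 0 < z.re → z.re < 1 →
        IntegrableOn (fun k : ℝ => lnEven V A B k * (k : ℂ) ^ (2 * z - 1)) (Ioi 0) ∧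
        F z = evenMellin V A B z) ∧
      (∀ j : ℕ, 1 ≤ j → ∀ z : ℂ, (j : ℝ) < z.re → z.re < j + 1 →
        IntegrableOn (evenIntegrand V A B j z) (Ioi 0) ∧
        F z = ∫ k in Ioi (0 : ℝ), evenIntegrand V A B j z k)) ∧
    (∃ G : ℂ → ℂ, MeromorphicOn G {z | 0 < z.re} ∧
      (∀ z : ℂ, 0 < z.re → z.re < 1 / 2 → G z = oddMellin V A B z) ∧
      (∀ z : ℂ, 0 < z.re → (∀ j : ℕ, z ≠ j + 1 / 2) → AnalyticAt ℂ G z) ∧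
      (∀ j : ℕ, HasSimplePoleWithResidue G (j + 1 / 2)
        ((-1) ^ j * (2 : ℂ) ^ (-2 * (j : ℤ) - 2) * eCoeff V A B (2 * j + 1))) ∧
      (∀ j : ℕ, 1 ≤ j → ∀ z : ℂ, (j : ℝ) - 1 / 2 < z.re → z.re < j + 1 / 2 →
        IntegrableOn (oddIntegrand V A B j z) (Ioi 0) ∧
        G z = ∫ k in Ioi (0 : ℝ), oddIntegrand V A B j z k)) := by
  have hV : FiniteMoment V := ⟨hsmooth.continuousOn, hint⟩
  obtain ⟨δ, hδ, hs⟩ := hdecay.exists_isSymbol hsmooth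
  have hspec : LogDetSpec V A B := hV.logDetSpec hsa (isJostExpansion_bCoeff hδ hs hV) hA hAB
  have hlam : ∀ c : ℕ, Tendsto (fun l : ℕ => ((2 * l + c : ℕ) : ℝ)) atTop atTop := fun c =>
    tendsto_natCast_atTop_atTop.comp
      (tendsto_atTop_mono (fun l => by omega : ∀ l, l ≤ 2 * l + c) tendsto_id)
  obtain ⟨F, hFmer, hFan, hFres, hFint⟩ :=
    hspec.hasPowerExpansion_even.exists_continuation_two_mul (hlam 2)
  obtain ⟨G, hGmer, hGan, hGres, hGint⟩ :=
    hspec.hasPowerExpansion_odd.exists_continuation_two_mul (hlam 1)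
  have hF1 : ∀ z : ℂ, 0 < z.re → z.re < 1 →
      IntegrableOn (fun k : ℝ => lnEven V A B k * (k : ℂ) ^ (2 * z - 1)) (Ioi 0) ∧
      F z = evenMellin V A B z := by
    intro z h0 h1
    have h2 := hFint 0 z h0 (by push_cast; linarith) (by simp)
    simpa [partialExpansion, evenMellin] using h2
  have hG1 : ∀ z : ℂ, 0 < z.re → z.re < 1 / 2 →
      IntegrableOn (fun k : ℝ => lnOdd V A B k * (k : ℂ) ^ (2 * z - 1)) (Ioi 0) ∧
      G z = oddMellin V A B z := by
    intro z h0 h1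
    obtain ⟨h2, h3⟩ := hGint 0 z h0 (by push_cast; linarith) (by simp)
    simp only [partialExpansion, Finset.range_zero, Finset.sum_empty, sub_zero, mul_assoc] at h2 h3
    rw [integral_const_mul] at h3
    refine ⟨?_, h3⟩
    have h4 := h2.const_mul Complex.I
    refine h4.congr (ae_of_all _ fun k => ?_)
    linear_combination (-(lnOdd V A B k * (k : ℂ) ^ (2 * z - 1))) * Complex.I_mul_I
  refine ⟨fun z h0 h1 => ⟨(hF1 z h0 (by linarith)).1, (hG1 z h0 h1).1⟩,
    ⟨F, hFmer, fun z h0 h1 => (hF1 z h0 (by linarith)).2, fun z h0 hz => ?_, fun j hj => ?_, hF1,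
      fun j hj z h0 h1 => ?_⟩,
    ⟨G, hGmer, fun z h0 h1 => (hG1 z h0 h1).2, fun z h0 hz => ?_, fun j => ?_,
      fun j hj z h0 h1 => ?_⟩⟩
  · refine hFan z h0 fun l hl => hz (l + 1) (by omega) ?_
    push_cast at hl ⊢
    linear_combination hl / 2
  · obtain ⟨l, rfl⟩ : ∃ l, j = l + 1 := ⟨j - 1, by omega⟩
    have h1 := hFres l
    have h2 : (((2 * l + 2 : ℕ) : ℝ) : ℂ) / 2 = ((l + 1 : ℕ) : ℂ) := by push_cast; ring
    have h3 : -evenCoeff V A B l / 2 = (-1) ^ (l + 1 + 1) * (2 : ℂ) ^ (-2 * ((l + 1 : ℕ) : ℤ) - 1)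
        * eCoeff V A B (2 * (l + 1)) := by
      have h4 : (2 : ℂ) ^ (-2 * ((l + 1 : ℕ) : ℤ) - 1) = (2 ^ (2 * l + 3))⁻¹ := by
        rw [← zpow_natCast, ← zpow_neg]
        congr 1
      rw [h4, evenCoeff, show 2 * (l + 1) = 2 * l + 2 by ring]
      field_simp
      ring
    rwa [h2, h3] at h1
  · have h2 := hFint j z (lt_of_le_of_lt (Nat.cast_nonneg j) h0) (by push_cast; linarith)
      fun l hl => by
        have : (l : ℝ) + 1 ≤ j := by exact_mod_cast hl
        push_cast
        linarith
    have h3 : evenIntegrand V A B j z = fun k : ℝ => (lnEven V A B k - partialExpansion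
        (evenCoeff V A B) (fun l => ((2 * l + 2 : ℕ) : ℝ)) j k) * (k : ℂ) ^ (2 * z - 1) := by
      funext k
      rw [evenIntegrand, partialExpansion_evenCoeff, sum_Icc_one_eq_sum_range]
      rfl
    rw [h3]
    exact h2
  · refine hGan z h0 fun l hl => hz l ?_
    push_cast at hl ⊢
    linear_combination hl / 2
  · have h1 := hGres j
    have h2 : (((2 * j + 1 : ℕ) : ℝ) : ℂ) / 2 = (j : ℂ) + 1 / 2 := by push_cast; ring
    have h3 : -oddCoeff V A B j / 2 = (-1) ^ j * (2 : ℂ) ^ (-2 * (j : ℤ) - 2)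
        * eCoeff V A B (2 * j + 1) := by
      have h4 : (2 : ℂ) ^ (-2 * (j : ℤ) - 2) = (2 ^ (2 * j + 2))⁻¹ := by
        rw [← zpow_natCast, ← zpow_neg]
        congr 1
        push_cast
        ring
      rw [h4, oddCoeff]
      field_simp
      ring
    rwa [h2, h3] at h1
  · have hj' : (1 : ℝ) ≤ j := by exact_mod_cast hj
    have h2 := hGint j z (by linarith) (by push_cast; linarith)
      fun l hl => by
        have : (l : ℝ) + 1 ≤ j := by exact_mod_cast hl
        push_cast
        linarith
    have h3 : oddIntegrand V A B j z = fun k : ℝ => (-Complex.I * lnOdd V A B k - partialExpansion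
        (oddCoeff V A B) (fun l => ((2 * l + 1 : ℕ) : ℝ)) j k) * (k : ℂ) ^ (2 * z - 1) := by
      funext k
      rw [oddIntegrand, partialExpansion_oddCoeff]
    rw [h3]
    exact h2
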